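/- Let $\mathcal S\subset\mathbb R^2$ be a nonempty open set (a coordinate domain of a surface) with coordinates $t^1,t^2$, and let $\pi$ be the rank-six vector bundle over $\mathcal S$ whose sections are pairs $(g,h)$ of symmetric $2\times 2$ matrices of functions $g_{ij}(t)$, $h_{kl}(t)$. Let $\mathfrak G$ be the pseudogroup of smooth diffeomorphisms between open subsets of $\mathcal S$. The pseudogroup $\mathfrak G\times GL_2(\mathbb R)$ acts on local sections of $\pi$: the pair $(\phi,a)$ takes $(g,h)$ to $(\phi^*g,\ (a^i_k a^j_l\, h_{ij}\circ\phi)_{kl})$, and hence it acts on the jet spaces $J^r\pi$. Its infinitesimal generators are $$U_\psi=\psi^i\frac{\partial}{\partial t^i}-\sum_{i\le j}\Big(g_{is}\frac{\partial\psi^s}{\partial t^j}+g_{sj}\frac{\partial\psi^s}{\partial t^i}\Big)\frac{\partial}{\partial g_{ij}},\qquad V_a=-\sum_{k\le l}\big(h_{ks}a^s_l+h_{sl}a^s_k\big)\frac{\partial}{\partial h_{kl}},$$ where $\psi=(\psi^1,\psi^2)$ is any pair of smooth functions of $t^1,t^2$ and $a\in\mathfrak{gl}_2(\mathbb R)$.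 A scalar differential invariant of order (at most) $r$ on an open set $U\subset J^r\pi$ is a smooth function on $U$ annihilated by the prolongations to $J^r\pi$ of all $U_\psi$ and $V_a$. Let $(r,N_r)$ be one of $(0,0),(1,4),(2,14),(3,28),(4,46)$. Then: 1. The orbit space $J^r\pi/(\mathfrak G\times GL_2)$ has dimension $N_r$ at generic points: there is an open dense subset $\Omega\subset J^r\pi$, invariant under $\mathfrak G\times GL_2$, each point of which has an open neighbourhood $W\subset\Omega$ with a smooth submersion $I:W\to\mathbb R^{N_r}$ such that two points of $W$ lie in the same $\mathfrak G\times GL_2$-orbit if and only if $I$ takes the same value at them. 2. The number of functionally independent scalar differential invariants of order $r$ is exactly $N_r$: every point of some open dense subset of $J^r\pi$ has a neighbourhood on which there are $N_r$ scalar differential invariants whose differentials are linearly independent at every point; and if $f_1,\dots,f_m$ are scalar differential invariants on an open set $U\subset J^r\pi$ whose differentials are linearly independent at some point of $U$, then $m\le N_r$. In particular, there are exactly four independent first-order invariants. -/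

import Mathlib

open scoped ContDiff

noncomputable section

/-- Coordinate space for the surface: points `t = (t¹, t²)`. -/
abbrev Base : Type := Fin 2 → ℝ

/-- Symmetric bilinear forms on a plane, `b s(i, j)` being the component `b_ij = b_ji`. -/
abbrev SymForm : Type := Sym2 (Fin 2) → ℝ

/-- The fibre of the six-dimensional bundle `π`: pairs `(g, h)` of symmetric forms. A local section
of `π` is a function `Base → Fibre`. -/
abbrev Fibre : Type := SymForm × SymForm

/-- The partial derivative `∂f/∂tⁱ`. -/
def pd {F : Type*} [NormedAddCommGroup F] [NormedSpace ℝ F] (i : Fin 2) (f : Base → F) :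
    Base → F :=
  fun t => fderiv ℝ f t (Pi.single i 1)

/-- The higher partial derivative `∂^{a+b} f / (∂t¹)^a (∂t²)^b`. -/
def mpd {F : Type*} [NormedAddCommGroup F] [NormedSpace ℝ F] (a b : ℕ) (f : Base → F) :
    Base → F :=
  (pd 0)^[a] ((pd 1)^[b] f)

/-- Multi-indices `(a, b)` with `a + b ≤ r`. -/
abbrev MultiIdx (r : ℕ) : Type :=
  {J : Fin (r + 1) × Fin (r + 1) // (J.1 : ℕ) + (J.2 : ℕ) ≤ r}

/-- The space of `r`-jets of sections of `π` over the plane, in its standard coordinates: the base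
point `t` and the values of all partial derivatives of `(g, h)` of order at most `r`. -/
abbrev Jet (r : ℕ) : Type := Base × (MultiIdx r → Fibre)

/-- The `r`-jet at `t` of a section. -/
def jet (r : ℕ) (σ : Base → Fibre) (t : Base) : Jet r :=
  (t, fun J => mpd (J.1.1 : ℕ) (J.1.2 : ℕ) σ t)

/-- The jet space `J^r π` over a coordinate domain `S`. -/
def jetSpace (S : Set Base) (r : ℕ) : Set (Jet r) := {θ | θ.1 ∈ S}

/-- The form with components `b'_kl = Aⁱ_k Aʲ_l b_ij`. -/
def congrForm (A : Matrix (Fin 2) (Fin 2) ℝ) (b : SymForm) : SymForm :=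
  Sym2.lift ⟨fun k l => ∑ i, ∑ j, A i k * A j l * b s(i, j), fun k l => by
    show ∑ i, ∑ j, A i k * A j l * b s(i, j) = ∑ i, ∑ j, A i l * A j k * b s(i, j)
    rw [Finset.sum_comm]
    refine Finset.sum_congr rfl fun i _ => Finset.sum_congr rfl fun j _ => ?_
    rw [Sym2.eq_swap (a := j) (b := i)]
    ring⟩

/-- The Jacobian matrix `(∂φⁱ/∂tᵏ)`. -/
def jacobian (φ : Base → Base) (t : Base) : Matrix (Fin 2) (Fin 2) ℝ :=
  Matrix.of fun i k => pd k φ t i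

/-- The action of `(φ, a) ∈ 𝔊 × GL₂` on sections: `g` goes to `φ^* g` and the functions `h_kl` go to
`aⁱ_k aʲ_l (h_ij ∘ φ)`. -/
def transformSection (φ : Base → Base) (a : GL (Fin 2) ℝ) (σ : Base → Fibre) : Base → Fibre :=
  fun t => (congrForm (jacobian φ t) (σ (φ t)).1,
    congrForm (a : Matrix (Fin 2) (Fin 2) ℝ) (σ (φ t)).2)

/-- Two `r`-jets lie in the same orbit of the prolonged action of the pseudogroup `𝔊 × GL₂`, where
`𝔊` consists of the diffeomorphisms between open subsets of `S`: some `(φ, a)` takes a local section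
with one jet to a local section with the other jet. -/
def SameOrbit (S : Set Base) (r : ℕ) (θ θ' : Jet r) : Prop :=
  ∃ (φ : OpenPartialHomeomorph Base Base) (a : GL (Fin 2) ℝ) (σ : Base → Fibre),
    φ.source ⊆ S ∧ φ.target ⊆ S ∧
    ContDiffOn ℝ ∞ φ φ.source ∧ ContDiffOn ℝ ∞ φ.symm φ.target ∧
    ContDiffOn ℝ ∞ σ φ.target ∧
    θ.1 ∈ φ.source ∧
    jet r σ (φ θ.1) = θ' ∧
    jet r (transformSection φ a σ) θ.1 = θ

/-- The orbit space `J^r π / (𝔊 × GL₂)` has dimension `N` (at generic points, as usual): for some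
invariant dense open subset `Ω` of `J^r π`, the quotient of `Ω` is locally an `N`-dimensional
manifold, that is, near every point of `Ω` the orbits are exactly the fibres of a smooth submersion
to `ℝ^N`. -/
def HasOrbitSpaceDim (S : Set Base) (r N : ℕ) : Prop :=
  ∃ Ω : Set (Jet r), IsOpen Ω ∧ Ω ⊆ jetSpace S r ∧ jetSpace S r ⊆ closure Ω ∧
    (∀ θ ∈ Ω, ∀ θ', SameOrbit S r θ θ' → θ' ∈ Ω) ∧
    ∀ θ ∈ Ω, ∃ W : Set (Jet r), IsOpen W ∧ θ ∈ W ∧ W ⊆ Ω ∧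
      ∃ I : Jet r → (Fin N → ℝ), ContDiffOn ℝ ∞ I W ∧
        (∀ η ∈ W, Function.Surjective (fderiv ℝ I η)) ∧
        ∀ η ∈ W, ∀ η' ∈ W, SameOrbit S r η η' ↔ I η = I η'

/-- The components `-(b_is A^s_j + b_sj A^s_i)` of the infinitesimal action of `A ∈ 𝔤𝔩₂` on a
symmetric form. -/
def infCongrForm (A : Matrix (Fin 2) (Fin 2) ℝ) (b : SymForm) : SymForm :=
  Sym2.lift ⟨fun i j => -∑ s, (b s(i, s) * A s j + b s(s, j) * A s i), fun i j => by
    show -∑ s, (b s(i, s) * A s j + b s(s, j) * A s i) =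
      -∑ s, (b s(j, s) * A s i + b s(s, i) * A s j)
    congr 1
    refine Finset.sum_congr rfl fun s _ => ?_
    rw [Sym2.eq_swap (a := i) (b := s), Sym2.eq_swap (a := s) (b := j)]
    ring⟩

/-- The characteristic (vertical part along the section `σ`) of the vector field `U_ψ + V_a` on the
total space of `π`. Here `U_ψ` has the base components `ψⁱ` and the `g_ij`-components
`-(g_is ∂_j ψ^s + g_sj ∂_i ψ^s)`, and `V_a` has the `h_kl`-components `-(h_ks a^s_l + h_sl a^s_k)`. -/
def characteristic (ψ : Base → Base) (a : Matrix (Fin 2) (Fin 2) ℝ) (σ : Base → Fibre) :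
    Base → Fibre :=
  fun t => (infCongrForm (jacobian ψ t) (σ t).1, infCongrForm a (σ t).2) - ∑ i, ψ t i • pd i σ t

/-- `v` is the value at the jet `θ` of the prolongation to `J^r π` of a field `U_ψ + V_a`. With `Q`
the characteristic, the prolonged field is `ψⁱ D_i + ∑_J D_J Q ∂/∂u_J`. It is evaluated along a
section `σ` with jet `θ`; the derivatives of `σ` of order `r + 1` cancel. -/
def IsProlongedVector (S : Set Base) (r : ℕ) (θ v : Jet r) : Prop :=
  ∃ (ψ : Base → Base) (a : Matrix (Fin 2) (Fin 2) ℝ) (σ : Base → Fibre),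
    ContDiffOn ℝ ∞ ψ S ∧ ContDiffOn ℝ ∞ σ S ∧ jet r σ θ.1 = θ ∧
    v = (ψ θ.1, fun J =>
      mpd (J.1.1 : ℕ) (J.1.2 : ℕ) (characteristic ψ a σ) θ.1 +
        ∑ i, ψ θ.1 i • mpd (J.1.1 : ℕ) (J.1.2 : ℕ) (pd i σ) θ.1)

/-- `f` is a scalar differential invariant of order at most `r` on the open subset `U` of `J^r π`:
a smooth function annihilated by all prolonged fields. -/
def IsScalarInvariant (S : Set Base) (r : ℕ) (U : Set (Jet r)) (f : Jet r → ℝ) : Prop :=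
  ContDiffOn ℝ ∞ f U ∧ ∀ θ ∈ U, ∀ v, IsProlongedVector S r θ v → fderiv ℝ f θ v = 0

/-- The number of functionally independent scalar differential invariants of order at most `r` is
exactly `N`: such invariants exist near every point of a dense open set, and nowhere
are there more than `N` independent ones. -/
def HasInvariantCount (S : Set Base) (r N : ℕ) : Prop :=
  (∃ Ω : Set (Jet r), IsOpen Ω ∧ Ω ⊆ jetSpace S r ∧ jetSpace S r ⊆ closure Ω ∧
    ∀ θ ∈ Ω, ∃ W : Set (Jet r), IsOpen W ∧ θ ∈ W ∧ W ⊆ Ω ∧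
      ∃ I : Fin N → Jet r → ℝ, (∀ n, IsScalarInvariant S r W (I n)) ∧
        ∀ η ∈ W, LinearIndependent ℝ fun n => fderiv ℝ (I n) η) ∧
  ∀ U : Set (Jet r), IsOpen U → U ⊆ jetSpace S r →
    ∀ (m : ℕ) (f : Fin m → Jet r → ℝ), (∀ n, IsScalarInvariant S r U (f n)) →
      ∀ η ∈ U, LinearIndependent ℝ (fun n => fderiv ℝ (f n) η) → m ≤ N

end

/-! Translating base points to the origin turns orbits in the jet space into classes of `JetRel` on
the fibre `JetFibre r` (`sameOrbit_iff`). There the acting transformations are the (r+1)-jets of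
diffeomorphisms fixing the origin, together with a matrix. They form a family `Param r` of dimension
(r+2)(r+3) + 2, while the fibre has dimension 3(r+1)(r+2). For r ≥ 1 the difference is 2r² + 4r - 2,
that is 4, 14, 28, 46 for r = 1, 2, 3, 4. So for r ≥ 1 it has to be shown that near a generic jet
the action is infinitesimally free, and that nearby related jets are related by a transformation
near the identity.

Both facts come from one estimate, `NearbyJets.param_isLittleO`: if θ and θ' tend to a generic jet,
m carries θ' to θ, and θ - θ' = o(e), then m = o(e). The gauge e = 1 gives `exists_near_param`; the
gauge e = s along the line s • v gives `infAct_injective`. Since a and -a act alike, the sign of a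
is fixed by requiring its entry at (0, 0) to be nonnegative.

The estimate recovers a transformation from its effect on a jet. The data (g, h, ∂h) yield two
covectors on the surface: α = disc(h, ∂h) / disc(h, h), and γ, proportional to β g⁻¹ α, where β =
disc(∂h, ∂h). Up to powers of determinants they do not see a, and generically they are independent,
so the Jacobian of φ at the point is determined (`jacobian_sub_one`). Generically h, ∂₁h, ∂₂h also
span the symmetric forms, so the action of a on all forms is determined, hence a up to sign
(`paramMatrix_sub_one`). The chain rule for ∂h then expresses the Jacobian of φ through lower order
data, and induction controls the derivatives of φ up to order r (`close_map`). The remaining order r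
+ 1 comes from g: the second derivatives of φ are isolated as in the Koszul formula for the
Levi-Civita connection (`close_map_last`).

Freeness and properness give a local slice (`exists_slice`): the coordinate along a complement of
the orbit direction is a submersion whose fibres are the local orbits. Its components are invariants
with independent differentials. Conversely, differentials of invariants annihilate all base
directions and the range of `infAct` (`isProlongedVector_iff`), which has codimension N on a dense
set; independence is an open condition, so the bound holds everywhere (`invariant_count_le`).

For r = 0 the transformations outnumber the coordinates. The infinitesimal action is onto wherever g
and h are nondegenerate, so orbits are open and N = 0. -/

open Filter Topology Asymptotics

/-! ### Calculus of iterated partial derivatives. -/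

section PartialDerivatives

variable {V W : Type*} [NormedAddCommGroup V] [NormedSpace ℝ V]
  [NormedAddCommGroup W] [NormedSpace ℝ W]

/-- The rules below are equalities of germs rather than of values: only these can be differentiated
again, and the functions involved are smooth only near a point. -/
theorem pd_congr {f g : Base → V} {t : Base} (h : f =ᶠ[𝓝 t] g) (i : Fin 2) :
    pd i f =ᶠ[𝓝 t] pd i g := by
  filter_upwards [h.fderiv (𝕜 := ℝ)] with y hy
  simp [pd, hy]

theorem ContDiffAt.pd {f : Base → V} {t : Base} (h : ContDiffAt ℝ ∞ f t) (i : Fin 2) :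
    ContDiffAt ℝ ∞ (pd i f) t :=
  (h.fderiv_right (m := ∞) le_rfl).clm_apply contDiffAt_const

theorem ContDiffAt.eventually_differentiableAt {f : Base → V} {t : Base}
    (h : ContDiffAt ℝ ∞ f t) : ∀ᶠ y in 𝓝 t, DifferentiableAt ℝ f y := by
  have h1 : ContDiffAt ℝ 1 f t := h.of_le (by exact_mod_cast le_top)
  filter_upwards [h1.eventually (by simp)] with y hy
  exact hy.differentiableAt (by simp)

theorem pd_comm {f : Base → V} {t : Base} (h : ContDiffAt ℝ ∞ f t) (i j : Fin 2) :
    pd i (pd j f) =ᶠ[𝓝 t] pd j (pd i f) := by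
  have h2 : ContDiffAt ℝ 2 f t := h.of_le (WithTop.coe_le_coe.2 le_top)
  filter_upwards [h2.eventually (by simp)] with y hy
  have hs : IsSymmSndFDerivAt ℝ f y := hy.isSymmSndFDerivAt (by simp)
  have hd : DifferentiableAt ℝ (fderiv ℝ f) y :=
    (hy.fderiv_right (m := 1) (by norm_num)).differentiableAt (by simp)
  have key : ∀ k l : Fin 2, pd k (pd l f) y =
      fderiv ℝ (fderiv ℝ f) y (Pi.single k 1) (Pi.single l 1) := by
    intro k l
    have := fderiv_clm_apply (𝕜 := ℝ) hd (differentiableAt_const (Pi.single l (1 : ℝ) : Base))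
    simp only [pd]
    erw [this]
    simp
  rw [key, key, hs]

theorem pd_add {f g : Base → V} {t : Base} (hf : ContDiffAt ℝ ∞ f t) (hg : ContDiffAt ℝ ∞ g t)
    (i : Fin 2) : pd i (fun y => f y + g y) =ᶠ[𝓝 t] fun y => pd i f y + pd i g y := by
  filter_upwards [hf.eventually_differentiableAt, hg.eventually_differentiableAt] with y h1 h2
  simp [pd, fderiv_fun_add h1 h2]

theorem pd_neg (f : Base → V) (i : Fin 2) : pd i (fun y => - f y) = fun y => - pd i f y := by
  funext y
  simp [pd, fderiv_fun_neg]

theorem pd_const (c : V) (i : Fin 2) : pd i (fun _ : Base => c) = fun _ => 0 := by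
  funext y
  simp [pd]

theorem pd_mul {f g : Base → ℝ} {t : Base} (hf : ContDiffAt ℝ ∞ f t) (hg : ContDiffAt ℝ ∞ g t)
    (i : Fin 2) : pd i (fun y => f y * g y) =ᶠ[𝓝 t] fun y => pd i f y * g y + f y * pd i g y := by
  filter_upwards [hf.eventually_differentiableAt, hg.eventually_differentiableAt] with y h1 h2
  simp [pd, fderiv_fun_mul h1 h2]
  ring

theorem pd_clm (L : V →L[ℝ] W) {f : Base → V} {t : Base} (hf : ContDiffAt ℝ ∞ f t) (i : Fin 2) :
    pd i (fun y => L (f y)) =ᶠ[𝓝 t] fun y => L (pd i f y) := by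
  filter_upwards [hf.eventually_differentiableAt] with y h1
  have : fderiv ℝ (fun y => L (f y)) y = L.comp (fderiv ℝ f y) :=
    (L.hasFDerivAt.comp y h1.hasFDerivAt).fderiv
  simp [pd, this]

theorem pd_comp {f : Base → V} {φ : Base → Base} {t : Base}
    (hf : ContDiffAt ℝ ∞ f (φ t)) (hφ : ContDiffAt ℝ ∞ φ t) (i : Fin 2) :
    pd i (fun y => f (φ y)) =ᶠ[𝓝 t]
      fun y => ∑ s, pd i (fun z => φ z s) y • pd s f (φ y) := by
  filter_upwards [hφ.eventually_differentiableAt,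
    hφ.continuousAt.eventually hf.eventually_differentiableAt] with y h1 h2
  have h3 : fderiv ℝ (fun y => f (φ y)) y = (fderiv ℝ f (φ y)).comp (fderiv ℝ φ y) :=
    (h2.hasFDerivAt.comp y h1.hasFDerivAt).fderiv
  have h4 : ∀ s, pd i (fun z => φ z s) y = (fderiv ℝ φ y (Pi.single i 1)) s := by
    intro s
    have : HasFDerivAt (fun z => φ z s) ((ContinuousLinearMap.proj s).comp (fderiv ℝ φ y)) y :=
      (ContinuousLinearMap.proj (R := ℝ) (φ := fun _ : Fin 2 => ℝ) s).hasFDerivAt.comp y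
        h1.hasFDerivAt
    simp [pd, this.fderiv]
  simp only [h4]
  simp only [pd, h3, ContinuousLinearMap.comp_apply, ← map_smul, ← map_sum]
  congr 1
  ext s
  fin_cases s <;> simp [Fin.sum_univ_two]

theorem pd_translate (f : Base → V) (t : Base) (i : Fin 2) :
    pd i (fun z => f (t + z)) = fun z => pd i f (t + z) := by
  funext z
  simp [pd, fderiv_comp_add_left]

theorem mpd_translate (a b : ℕ) (f : Base → V) (t : Base) :
    mpd a b (fun z => f (t + z)) = fun z => mpd a b f (t + z) := by
  have h : ∀ (i : Fin 2) (n : ℕ) (f : Base → V),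
      (pd i)^[n] (fun z => f (t + z)) = fun z => (pd i)^[n] f (t + z) := by
    intro i n
    induction n with
    | zero => intro f; rfl
    | succ n ih => intro f; rw [Function.iterate_succ_apply, pd_translate, ih]; rfl
  simp [mpd, h]

theorem iterate_pd_congr {f g : Base → V} {t : Base} (h : f =ᶠ[𝓝 t] g) (i : Fin 2) (n : ℕ) :
    (pd i)^[n] f =ᶠ[𝓝 t] (pd i)^[n] g := by
  induction n with
  | zero => exact h
  | succ n ih => simpa only [Function.iterate_succ_apply'] using pd_congr ih i

theorem mpd_congr {f g : Base → V} {t : Base} (h : f =ᶠ[𝓝 t] g) (a b : ℕ) :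
    mpd a b f =ᶠ[𝓝 t] mpd a b g :=
  iterate_pd_congr (iterate_pd_congr h 1 b) 0 a

theorem ContDiffAt.iterate_pd {f : Base → V} {t : Base} (h : ContDiffAt ℝ ∞ f t) (i : Fin 2)
    (n : ℕ) : ContDiffAt ℝ ∞ ((_root_.pd i)^[n] f) t := by
  induction n with
  | zero => exact h
  | succ n ih => simpa only [Function.iterate_succ_apply'] using ih.pd i

theorem mpd_pd_one (a b : ℕ) (f : Base → V) : mpd a b (pd 1 f) = mpd a (b + 1) f := by
  simp [mpd, Function.iterate_succ_apply]

theorem mpd_pd_zero (a b : ℕ) {f : Base → V} {t : Base} (h : ContDiffAt ℝ ∞ f t) :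
    mpd a b (pd 0 f) =ᶠ[𝓝 t] mpd (a + 1) b f := by
  have h1 : (pd 1)^[b] (pd 0 f) =ᶠ[𝓝 t] pd 0 ((pd 1)^[b] f) := by
    induction b with
    | zero => rfl
    | succ b ih =>
      simp only [Function.iterate_succ_apply']
      exact (pd_congr ih 1).trans (pd_comm (h.iterate_pd 1 b) 1 0)
  simpa only [mpd, Function.iterate_succ_apply] using iterate_pd_congr h1 0 a

theorem mpd_clm (L : V →L[ℝ] W) {f : Base → V} {t : Base} (hf : ContDiffAt ℝ ∞ f t) (a b : ℕ) :
    mpd a b (fun y => L (f y)) =ᶠ[𝓝 t] fun y => L (mpd a b f y) := by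
  have key : ∀ (i : Fin 2) (n : ℕ) (f : Base → V), ContDiffAt ℝ ∞ f t →
      (pd i)^[n] (fun y => L (f y)) =ᶠ[𝓝 t] fun y => L ((pd i)^[n] f y) := by
    intro i n f hf
    induction n with
    | zero => rfl
    | succ n ih =>
      simp only [Function.iterate_succ_apply']
      exact (pd_congr ih i).trans (pd_clm L (hf.iterate_pd i n) i)
  exact (iterate_pd_congr (key 1 b f hf) 0 a).trans (key 0 a _ (hf.iterate_pd 1 b))

theorem mpd_add {f g : Base → V} {t : Base} (hf : ContDiffAt ℝ ∞ f t) (hg : ContDiffAt ℝ ∞ g t)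
    (a b : ℕ) : mpd a b (fun y => f y + g y) =ᶠ[𝓝 t] fun y => mpd a b f y + mpd a b g y := by
  have e1 : (fun y => f y) =ᶠ[𝓝 t] fun y => (ContinuousLinearMap.fst ℝ V V) (f y, g y) := by rfl
  have hfg : ContDiffAt ℝ ∞ (fun y => (f y, g y)) t := hf.prodMk hg
  have h1 := mpd_clm (ContinuousLinearMap.fst ℝ V V) hfg a b
  have h2 := mpd_clm (ContinuousLinearMap.snd ℝ V V) hfg a b
  have h3 := mpd_clm (ContinuousLinearMap.fst ℝ V V + ContinuousLinearMap.snd ℝ V V) hfg a b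
  filter_upwards [h1, h2, h3] with y e1 e2 e3
  simp at e1 e2 e3
  rw [e3, e1, e2]

end PartialDerivatives

/-! ### Jets of families of functions modulo a group of number families. -/

section Jetwise

variable {ι : Type*}

/-- The families of functions `f n` all of whose derivatives of order less than `k`, evaluated at
the points `x n`, belong to a given group `p` of families of numbers. -/
def Jetwise (p : AddSubgroup (ι → ℝ)) (x : ι → Base) : ℕ → (ι → Base → ℝ) → Prop
  | 0, _ => True
  | k + 1, f => (fun n => f n (x n)) ∈ p ∧ ∀ i, Jetwise p x k fun n => pd i (f n)

/-- Families of functions smooth at the points `x n`. -/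
def SmoothFamily {V : Type*} [NormedAddCommGroup V] [NormedSpace ℝ V]
    (x : ι → Base) (f : ι → Base → V) : Prop :=
  ∀ n, ContDiffAt ℝ ∞ (f n) (x n)

/-- `p` is closed under multiplication by elements of `b`, and `b` is a subring containing it. -/
structure IdealPair (b p : AddSubgroup (ι → ℝ)) : Prop where
  le : p ≤ b
  one : (fun _ => 1) ∈ b
  mul_base : ∀ {u v : ι → ℝ}, u ∈ b → v ∈ b → (fun n => u n * v n) ∈ b
  mul : ∀ {u v : ι → ℝ}, u ∈ b → v ∈ p → (fun n => u n * v n) ∈ p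

theorem IdealPair.base {b p : AddSubgroup (ι → ℝ)} (h : IdealPair b p) : IdealPair b b :=
  ⟨le_rfl, h.one, h.mul_base, h.mul_base⟩

variable {b p : AddSubgroup (ι → ℝ)} {x y : ι → Base} {k : ℕ} {f g : ι → Base → ℝ}

theorem SmoothFamily.pd {V : Type*} [NormedAddCommGroup V] [NormedSpace ℝ V]
    {f : ι → Base → V} (h : SmoothFamily x f) (i : Fin 2) :
    SmoothFamily x fun n => pd i (f n) := fun n => (h n).pd i

theorem SmoothFamily.add (hf : SmoothFamily x f) (hg : SmoothFamily x g) :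
    SmoothFamily x fun n z => f n z + g n z := fun n => (hf n).add (hg n)

theorem SmoothFamily.sub (hf : SmoothFamily x f) (hg : SmoothFamily x g) :
    SmoothFamily x fun n z => f n z - g n z := fun n => (hf n).sub (hg n)

theorem SmoothFamily.neg (hf : SmoothFamily x f) :
    SmoothFamily x fun n z => - f n z := fun n => (hf n).neg

theorem SmoothFamily.mul (hf : SmoothFamily x f) (hg : SmoothFamily x g) :
    SmoothFamily x fun n z => f n z * g n z := fun n => (hf n).mul (hg n)

theorem SmoothFamily.const {V : Type*} [NormedAddCommGroup V] [NormedSpace ℝ V] (c : ι → V) :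
    SmoothFamily x fun n _ => c n := fun _ => contDiffAt_const

theorem SmoothFamily.sum {κ : Type*} {s : Finset κ} {F : κ → ι → Base → ℝ}
    (h : ∀ j ∈ s, SmoothFamily x (F j)) : SmoothFamily x fun n z => ∑ j ∈ s, F j n z :=
  fun n => ContDiffAt.sum fun j hj => h j hj n

theorem SmoothFamily.comp {V : Type*} [NormedAddCommGroup V] [NormedSpace ℝ V]
    {f : ι → Base → V} {φ : ι → Base → Base}
    (hf : SmoothFamily y f) (hφ : SmoothFamily x φ) (hy : ∀ n, φ n (x n) = y n) :
    SmoothFamily x fun n z => f n (φ n z) :=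
  fun n => ContDiffAt.comp (x n) (by simpa only [hy] using hf n) (hφ n)

theorem SmoothFamily.coord {φ : ι → Base → Base} (hφ : SmoothFamily x φ) (s : Fin 2) :
    SmoothFamily x fun n z => φ n z s := fun n => contDiffAt_pi.1 (hφ n) s

theorem Jetwise.congr (hf : Jetwise p x k f) (h : ∀ n, f n =ᶠ[𝓝 (x n)] g n) :
    Jetwise p x k g := by
  induction k generalizing f g with
  | zero => trivial
  | succ k ih =>
    refine ⟨?_, fun i => ih (hf.2 i) fun n => pd_congr (h n) i⟩
    convert hf.1 using 2 with n
    exact (h n).self_of_nhds.symm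

theorem Jetwise.mono (hf : Jetwise p x k f) {q : AddSubgroup (ι → ℝ)} (h : p ≤ q) :
    Jetwise q x k f := by
  induction k generalizing f with
  | zero => trivial
  | succ k ih => exact ⟨h hf.1, fun i => ih (hf.2 i)⟩

theorem Jetwise.of_le (hf : Jetwise p x k f) {j : ℕ} (h : j ≤ k) : Jetwise p x j f := by
  induction j generalizing f k with
  | zero => trivial
  | succ j ih =>
    obtain _ | k := k
    · omega
    · exact ⟨hf.1, fun i => ih (hf.2 i) (by omega)⟩

theorem Jetwise.zero : Jetwise p x k fun _ _ => 0 := by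
  induction k with
  | zero => trivial
  | succ k ih => exact ⟨p.zero_mem, fun i => by simpa only [pd_const] using ih⟩

theorem Jetwise.const {c : ι → ℝ} (h : c ∈ p) : Jetwise p x k fun n _ => c n := by
  cases k with
  | zero => trivial
  | succ k => exact ⟨h, fun i => by simpa only [pd_const] using Jetwise.zero⟩

theorem Jetwise.add (hf : Jetwise p x k f) (hg : Jetwise p x k g) (sf : SmoothFamily x f)
    (sg : SmoothFamily x g) : Jetwise p x k fun n z => f n z + g n z := by
  induction k generalizing f g with
  | zero => trivial
  | succ k ih =>
    exact ⟨p.add_mem hf.1 hg.1, fun i => (ih (hf.2 i) (hg.2 i) (sf.pd i) (sg.pd i)).congr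
      fun n => (pd_add (sf n) (sg n) i).symm⟩

theorem Jetwise.neg (hf : Jetwise p x k f) : Jetwise p x k fun n z => - f n z := by
  induction k generalizing f with
  | zero => trivial
  | succ k ih =>
    exact ⟨p.neg_mem hf.1, fun i => by simpa only [pd_neg] using ih (hf.2 i)⟩

theorem Jetwise.sub (hf : Jetwise p x k f) (hg : Jetwise p x k g) (sf : SmoothFamily x f)
    (sg : SmoothFamily x g) : Jetwise p x k fun n z => f n z - g n z := by
  simpa only [sub_eq_add_neg] using hf.add hg.neg sf sg.neg

theorem Jetwise.sum {κ : Type*} {s : Finset κ} {F : κ → ι → Base → ℝ}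
    (h : ∀ j ∈ s, Jetwise p x k (F j)) (hs : ∀ j ∈ s, SmoothFamily x (F j)) :
    Jetwise p x k fun n z => ∑ j ∈ s, F j n z := by
  classical
  induction s using Finset.induction_on with
  | empty => simpa using Jetwise.zero
  | insert j s hj ih =>
    simp only [Finset.sum_insert hj]
    exact (h j (by simp)).add (ih (fun i hi => h i (by simp [hi])) fun i hi => hs i (by simp [hi]))
      (hs j (by simp)) (SmoothFamily.sum fun i hi => hs i (by simp [hi]))

theorem Jetwise.mul (hbp : IdealPair b p) (hf : Jetwise b x k f) (hg : Jetwise p x k g)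
    (sf : SmoothFamily x f) (sg : SmoothFamily x g) :
    Jetwise p x k fun n z => f n z * g n z := by
  induction k generalizing f g with
  | zero => trivial
  | succ k ih =>
    refine ⟨hbp.mul hf.1 hg.1, fun i => Jetwise.congr ?_ fun n => (pd_mul (sf n) (sg n) i).symm⟩
    exact (ih (hf.2 i) (hg.of_le (Nat.le_succ k)) (sf.pd i) sg).add
      (ih (hf.of_le (Nat.le_succ k)) (hg.2 i) sf (sg.pd i)) ((sf.pd i).mul sg) (sf.mul (sg.pd i))

theorem Jetwise.mul' (hbp : IdealPair b p) (hf : Jetwise p x k f) (hg : Jetwise b x k g)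
    (sf : SmoothFamily x f) (sg : SmoothFamily x g) :
    Jetwise p x k fun n z => f n z * g n z := by
  simpa only [mul_comm] using hg.mul hbp hf sg sf

/-- A factor whose values absorb `b` into `p` raises the order by one. -/
theorem Jetwise.mul_succ (hbp : IdealPair b p) (hf : Jetwise b x (k + 1) f)
    (h0 : ∀ u ∈ b, (fun n => f n (x n) * u n) ∈ p) (hg : Jetwise p x k g)
    (hgb : Jetwise b x (k + 1) g) (sf : SmoothFamily x f) (sg : SmoothFamily x g) :
    Jetwise p x (k + 1) fun n z => f n z * g n z := by
  induction k generalizing g with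
  | zero => exact ⟨h0 _ hgb.1, fun i => trivial⟩
  | succ k ih =>
    refine ⟨h0 _ hgb.1, fun i => Jetwise.congr ?_ fun n => (pd_mul (sf n) (sg n) i).symm⟩
    exact ((hf.2 i).mul hbp hg (sf.pd i) sg).add
      (ih (hf.of_le (Nat.le_succ _)) (hg.2 i) (hgb.2 i) (sg.pd i)) ((sf.pd i).mul sg)
      (sf.mul (sg.pd i))

/-- Division. By the Leibniz rule f · ∂g = ∂(fg) - ∂f · g, and g is already controlled one order
lower, so only the value of f at the point has to be cancellable modulo p. -/
theorem Jetwise.of_mul (hbp : IdealPair b p) (hf : Jetwise b x k f)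
    (h0 : ∀ u : ι → ℝ, (fun n => f n (x n) * u n) ∈ p → u ∈ p)
    (hfg : Jetwise p x k fun n z => f n z * g n z)
    (sf : SmoothFamily x f) (sg : SmoothFamily x g) : Jetwise p x k g := by
  induction k generalizing g with
  | zero => trivial
  | succ k ih =>
    have hg : Jetwise p x k g :=
      ih (hf.of_le (Nat.le_succ k)) (hfg.of_le (Nat.le_succ k)) sg
    refine ⟨h0 _ hfg.1, fun i => ih (hf.of_le (Nat.le_succ k)) ?_ (sg.pd i)⟩
    refine (((hfg.2 i).congr fun n => pd_mul (sf n) (sg n) i).sub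
      ((hf.2 i).mul hbp hg (sf.pd i) sg) (((sf.pd i).mul sg).add (sf.mul (sg.pd i)))
      ((sf.pd i).mul sg)).congr fun n => Eventually.of_forall fun z => ?_
    simp

theorem Jetwise.comp (hbp : IdealPair b p) {φ : ι → Base → Base} (hy : ∀ n, φ n (x n) = y n)
    (hf : Jetwise p y k f) (hφ : ∀ s, Jetwise b x k fun n z => φ n z s)
    (sf : SmoothFamily y f) (sφ : SmoothFamily x φ) :
    Jetwise p x k fun n z => f n (φ n z) := by
  induction k generalizing f with
  | zero => trivial
  | succ k ih =>
    refine ⟨by simpa only [hy] using hf.1, fun i => Jetwise.congr ?_ fun n =>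
      (pd_comp (by simpa only [hy] using sf n) (sφ n) i).symm⟩
    simp only [smul_eq_mul]
    refine Jetwise.sum (fun s _ => Jetwise.mul hbp ((hφ s).2 i)
      (ih (hf.2 s) (fun s => (hφ s).of_le (Nat.le_succ k)) (sf.pd s)) ((sφ.coord s).pd i)
      ((sf.pd s).comp sφ hy)) fun s _ => ((sφ.coord s).pd i).mul ((sf.pd s).comp sφ hy)

/-- The chain rule makes the derivative of the difference a sum of terms ∂φ (∂f∘φ - ∂f∘φ') + (∂φ -
∂φ') ∂f∘φ'. The first factor difference falls under induction, the second under the hypothesis on φ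
- φ'. -/
theorem Jetwise.comp_sub_comp (hbp : IdealPair b p) {φ φ' : ι → Base → Base}
    (hy : ∀ n, φ n (x n) = y n) (hy' : ∀ n, φ' n (x n) = y n)
    (hf : Jetwise b y k f) (hφ : ∀ s, Jetwise b x k fun n z => φ n z s)
    (hφ' : ∀ s, Jetwise b x k fun n z => φ' n z s)
    (hsub : ∀ s, Jetwise p x k fun n z => φ n z s - φ' n z s)
    (sf : SmoothFamily y f) (sφ : SmoothFamily x φ) (sφ' : SmoothFamily x φ') :
    Jetwise p x k fun n z => f n (φ n z) - f n (φ' n z) := by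
  induction k generalizing f with
  | zero => trivial
  | succ k ih =>
    refine ⟨by simp only [hy, hy', sub_self]; exact p.zero_mem, fun i => ?_⟩
    have s1 : ∀ s, SmoothFamily x fun n z => pd i (fun z => φ n z s) z :=
      fun s => (sφ.coord s).pd i
    have s1' : ∀ s, SmoothFamily x fun n z => pd i (fun z => φ' n z s) z :=
      fun s => (sφ'.coord s).pd i
    have s2 : ∀ s, SmoothFamily x fun n z => pd s (f n) (φ n z) :=
      fun s => (sf.pd s).comp sφ hy
    have s2' : ∀ s, SmoothFamily x fun n z => pd s (f n) (φ' n z) :=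
      fun s => (sf.pd s).comp sφ' hy'
    have main : Jetwise p x k fun n z =>
        ∑ s, (pd i (fun z => φ n z s) z * (pd s (f n) (φ n z) - pd s (f n) (φ' n z)) +
          (pd i (fun z => φ n z s) z - pd i (fun z => φ' n z s) z) * pd s (f n) (φ' n z)) := by
      refine Jetwise.sum (fun s _ => Jetwise.add ?_ ?_ ((s1 s).mul ((s2 s).sub (s2' s)))
        (((s1 s).sub (s1' s)).mul (s2' s))) fun s _ => ((s1 s).mul ((s2 s).sub (s2' s))).add
        (((s1 s).sub (s1' s)).mul (s2' s))
      · exact Jetwise.mul hbp ((hφ s).2 i) (ih (hf.2 s) (fun s => (hφ s).of_le (Nat.le_succ k))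
          (fun s => (hφ' s).of_le (Nat.le_succ k)) (fun s => (hsub s).of_le (Nat.le_succ k))
          (sf.pd s)) (s1 s) ((s2 s).sub (s2' s))
      · refine Jetwise.mul' hbp (((hsub s).2 i).congr fun n => ?_)
          (Jetwise.comp hbp.base hy' (hf.2 s) (fun s => (hφ' s).of_le (Nat.le_succ k)) (sf.pd s)
            sφ') ((s1 s).sub (s1' s)) (s2' s)
        have := pd_add (sφ.coord s n) (sφ'.coord s n).neg i
        simpa only [pd_neg, ← sub_eq_add_neg] using this
    refine main.congr fun n => ?_
    have e1 := pd_comp (by simpa only [hy] using sf n) (sφ n) i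
    have e2 := pd_comp (by simpa only [hy'] using sf n) (sφ' n) i
    have e3 := pd_add (sf.comp sφ hy n) (sf.comp sφ' hy' n).neg i
    filter_upwards [e1, e2, e3] with z h1 h2 h3
    simp only [← sub_eq_add_neg] at h3
    simp only [pd_neg] at h3
    rw [h3, h1, h2, ← Finset.sum_neg_distrib, ← Finset.sum_add_distrib]
    refine Finset.sum_congr rfl fun s _ => ?_
    simp only [smul_eq_mul]
    ring

/-- The recursive definition allows derivatives in any order of variables; symmetry of mixed
derivatives reduces them to the ordered ones. -/
theorem jetwise_iff_mpd (sf : SmoothFamily x f) :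
    Jetwise p x k f ↔ ∀ a b : ℕ, a + b < k → (fun n => mpd a b (f n) (x n)) ∈ p := by
  induction k generalizing f with
  | zero => simp [Jetwise]
  | succ k ih =>
    simp only [Jetwise, ih (sf.pd _)]
    constructor
    · rintro ⟨h0, h⟩ a b hab
      obtain _ | b := b
      · obtain _ | a := a
        · exact h0
        · convert h 0 a 0 (by omega) using 2 with n
          exact (mpd_pd_zero a 0 (sf n)).self_of_nhds.symm
      · simpa only [mpd_pd_one] using h 1 a b (by omega)
    · intro h
      refine ⟨h 0 0 (by omega), fun i a b hab => ?_⟩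
      fin_cases i
      · convert h (a + 1) b (by omega) using 2 with n
        exact (mpd_pd_zero a b (sf n)).self_of_nhds
      · have := h a (b + 1) (by omega)
        simp only [← mpd_pd_one] at this
        exact this

end Jetwise

/-! ### Smooth dependence of derivatives on parameters and on time. -/

section Parameters

variable {E V : Type*} [NormedAddCommGroup E] [NormedSpace ℝ E]
  [NormedAddCommGroup V] [NormedSpace ℝ V]

/-- The partial derivative in the base direction of a function with parameters. -/
noncomputable def parPd (i : Fin 2) (F : E × Base → V) : E × Base → V :=
  fun q => fderiv ℝ F q (0, Pi.single i 1)

theorem ContDiff.parPd {F : E × Base → V} (hF : ContDiff ℝ ∞ F) (i : Fin 2) :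
    ContDiff ℝ ∞ (parPd i F) :=
  (hF.fderiv_right (m := ∞) le_rfl).clm_apply contDiff_const

theorem pd_section {F : E × Base → V} (hF : ContDiff ℝ ∞ F) (i : Fin 2) (e : E) :
    pd i (fun z => F (e, z)) = fun z => parPd i F (e, z) := by
  funext z
  have h1 : HasFDerivAt (fun z : Base => (e, z)) (ContinuousLinearMap.inr ℝ E Base) z :=
    hasFDerivAt_prodMk_right e z
  have h2 := ((hF.differentiable (by simp)) (e, z)).hasFDerivAt.comp z h1
  have h3 : fderiv ℝ (fun z => F (e, z)) z =
    (fderiv ℝ F (e, z)).comp (ContinuousLinearMap.inr ℝ E Base) := h2.fderiv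
  simp [pd, parPd, h3]

theorem ContDiff.iterate_parPd {F : E × Base → V} (hF : ContDiff ℝ ∞ F) (i : Fin 2) (n : ℕ) :
    ContDiff ℝ ∞ ((_root_.parPd i)^[n] F) := by
  induction n with
  | zero => exact hF
  | succ n ih => simpa only [Function.iterate_succ_apply'] using ih.parPd i

theorem iterate_pd_section {F : E × Base → V} (hF : ContDiff ℝ ∞ F) (i : Fin 2) (n : ℕ) (e : E) :
    (pd i)^[n] (fun z => F (e, z)) = fun z => (parPd i)^[n] F (e, z) := by
  induction n with
  | zero => rfl
  | succ n ih =>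
    simp only [Function.iterate_succ_apply', ih]
    exact pd_section (hF.iterate_parPd i n) i e

theorem mpd_section {F : E × Base → V} (hF : ContDiff ℝ ∞ F) (a b : ℕ) (e : E) :
    mpd a b (fun z => F (e, z)) = fun z => (parPd 0)^[a] ((parPd 1)^[b] F) (e, z) := by
  simp only [mpd, iterate_pd_section hF]
  exact iterate_pd_section (hF.iterate_parPd 1 b) 0 a e

/-- Behind the smoothness of the action on jets: derivatives in the base variable alone are
derivatives of the joint function in the directions (0, eᵢ). -/
theorem contDiff_mpd {F : E × Base → V} (hF : ContDiff ℝ ∞ F) (a b : ℕ) :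
    ContDiff ℝ ∞ fun q : E × Base => mpd a b (fun z => F (q.1, z)) q.2 := by
  simp only [mpd_section hF]
  exact (hF.iterate_parPd 1 b).iterate_parPd 0 a

theorem contDiff_pd {F : E × Base → V} (hF : ContDiff ℝ ∞ F) (i : Fin 2) :
    ContDiff ℝ ∞ fun q : E × Base => pd i (fun z => F (q.1, z)) q.2 := by
  simp only [pd_section hF]
  exact hF.parPd i

/-- The time derivative of a function of time and position. -/
noncomputable def timeDeriv (F : ℝ × Base → V) : ℝ × Base → V := fun q => fderiv ℝ F q (1, 0)

theorem ContDiff.timeDeriv {F : ℝ × Base → V} (hF : ContDiff ℝ ∞ F) :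
    ContDiff ℝ ∞ (timeDeriv F) :=
  (hF.fderiv_right (m := ∞) le_rfl).clm_apply contDiff_const

theorem hasDerivAt_timeDeriv {F : ℝ × Base → V} (hF : ContDiff ℝ ∞ F) (s : ℝ) (z : Base) :
    HasDerivAt (fun s => F (s, z)) (timeDeriv F (s, z)) s := by
  have h1 : HasDerivAt (fun s : ℝ => (s, z)) (1, 0) s :=
    (hasDerivAt_id s).prodMk (hasDerivAt_const s z)
  exact ((hF.differentiable (by simp)) (s, z)).hasFDerivAt.comp_hasDerivAt s h1

theorem timeDeriv_parPd {F : ℝ × Base → V} (hF : ContDiff ℝ ∞ F) (i : Fin 2) :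
    timeDeriv (parPd i F) = parPd i (timeDeriv F) := by
  funext q
  have hs : IsSymmSndFDerivAt ℝ F q :=
    (hF.contDiffAt (x := q)).isSymmSndFDerivAt (by simp; exact WithTop.coe_le_coe.2 le_top)
  have hd : DifferentiableAt ℝ (fderiv ℝ F) q :=
    (hF.fderiv_right (m := ∞) le_rfl).differentiable (by simp) q
  have key : ∀ v w : ℝ × Base, fderiv ℝ (fun q => fderiv ℝ F q w) q v =
      fderiv ℝ (fderiv ℝ F) q v w := by
    intro v w
    have := fderiv_clm_apply (𝕜 := ℝ) hd (differentiableAt_const w)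
    erw [this]
    simp
  refine (key (1, 0) (0, Pi.single i 1)).trans ?_
  rw [hs]
  exact (key (0, Pi.single i 1) (1, 0)).symm

theorem hasDerivAt_mpd {F : ℝ × Base → V} (hF : ContDiff ℝ ∞ F) (a b : ℕ) (s : ℝ) (z : Base) :
    HasDerivAt (fun s => mpd a b (fun z => F (s, z)) z)
      (mpd a b (fun z => timeDeriv F (s, z)) z) s := by
  have key : ∀ (i : Fin 2) (n : ℕ) (G : ℝ × Base → V), ContDiff ℝ ∞ G →
      timeDeriv ((parPd i)^[n] G) = (parPd i)^[n] (timeDeriv G) := by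
    intro i n G hG
    induction n with
    | zero => rfl
    | succ n ih =>
      simp only [Function.iterate_succ_apply', ← ih]
      exact timeDeriv_parPd (hG.iterate_parPd i n) i
  simp only [mpd_section hF, mpd_section hF.timeDeriv]
  rw [← key 1 b F hF, ← key 0 a _ (hF.iterate_parPd 1 b)]
  exact hasDerivAt_timeDeriv ((hF.iterate_parPd 1 b).iterate_parPd 0 a) s z

end Parameters

/-! ### Polynomials with prescribed Taylor coefficients at the origin. -/

section Polynomials

variable {V : Type*} [NormedAddCommGroup V] [NormedSpace ℝ V]

/-- The monomial `(z¹)^a (z²)^b / (a! b!)`. -/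
noncomputable def mono (a b : ℕ) (z : Base) : ℝ :=
  z 0 ^ a / (a.factorial : ℝ) * (z 1 ^ b / (b.factorial : ℝ))

theorem contDiff_mono (a b : ℕ) : ContDiff ℝ ∞ (mono a b) := by
  unfold mono
  fun_prop

theorem pd_pow_div (i j : Fin 2) (a : ℕ) :
    pd i (fun z : Base => z j ^ (a + 1) / ((a + 1).factorial : ℝ)) =
      fun z => if i = j then z j ^ a / (a.factorial : ℝ) else 0 := by
  funext z
  have h1 : HasFDerivAt (fun z : Base => z j)
      (ContinuousLinearMap.proj (R := ℝ) (φ := fun _ : Fin 2 => ℝ) j) z := hasFDerivAt_apply j z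
  have h2 := (h1.pow (a + 1)).mul_const ((((a + 1).factorial : ℝ))⁻¹)
  simp only [← div_eq_mul_inv] at h2
  have h3 := h2.fderiv
  have h4 : ((a : ℝ) + 1) ≠ 0 := by positivity
  have h5 : (a.factorial : ℝ) ≠ 0 := by positivity
  simp only [pd, h3]
  by_cases hij : i = j
  · subst hij
    simp [Nat.factorial_succ]
    field_simp
  · have : j ≠ i := fun h => hij h.symm
    simp [hij, this]

theorem pd_mono (i : Fin 2) (a b : ℕ) : pd i (mono a b) =
    if i = 0 then (if a = 0 then fun _ => 0 else mono (a - 1) b)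
    else (if b = 0 then fun _ => 0 else mono a (b - 1)) := by
  have hd : ∀ (j : Fin 2) (a : ℕ), ContDiff ℝ ∞ (fun z : Base => z j ^ a / (a.factorial : ℝ)) := by
    intro j a
    fun_prop
  have h0 : ∀ (i j : Fin 2) (a : ℕ), pd i (fun z : Base => z j ^ a / (a.factorial : ℝ)) =
      fun z => if i = j ∧ a ≠ 0 then z j ^ (a - 1) / ((a - 1).factorial : ℝ) else 0 := by
    intro i j a
    cases a with
    | zero => simp [pd_const]
    | succ a => rw [pd_pow_div]; simp
  funext z
  have := (pd_mul (hd 0 a).contDiffAt (hd 1 b).contDiffAt i (t := z)).self_of_nhds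
  unfold mono
  rw [this, h0, h0]
  fin_cases i
  · by_cases ha : a = 0 <;> simp [ha]
  · by_cases hb : b = 0 <;> simp [hb]

theorem pd_mono_smul (i : Fin 2) (a b : ℕ) (v : V) : pd i (fun z => mono a b z • v) =
    fun z => pd i (mono a b) z • v := by
  funext z
  have := ((contDiff_mono a b).differentiable (by simp) z).hasFDerivAt.smul_const v
  simp [pd, this.fderiv]

theorem iterate_pd_zero_mono_smul (n a b : ℕ) (v : V) : (pd 0)^[n] (fun z => mono a b z • v) =
    fun z => if n ≤ a then mono (a - n) b z • v else 0 := by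
  induction n with
  | zero => simp
  | succ n ih =>
    rw [Function.iterate_succ_apply', ih]
    by_cases h : n ≤ a
    · simp only [h, if_true]
      rw [pd_mono_smul, pd_mono]
      by_cases h' : a - n = 0
      · have : ¬ n + 1 ≤ a := by omega
        simp [h', this]
      · have h2 : n + 1 ≤ a := by omega
        have h3 : a - n - 1 = a - (n + 1) := by omega
        simp [h', h2, h3]
    · have h2 : ¬ n + 1 ≤ a := by omega
      simp only [h, h2, if_false, pd_const]

theorem iterate_pd_one_mono_smul (n a b : ℕ) (v : V) : (pd 1)^[n] (fun z => mono a b z • v) =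
    fun z => if n ≤ b then mono a (b - n) z • v else 0 := by
  induction n with
  | zero => simp
  | succ n ih =>
    rw [Function.iterate_succ_apply', ih]
    by_cases h : n ≤ b
    · simp only [h, if_true]
      rw [pd_mono_smul, pd_mono]
      by_cases h' : b - n = 0
      · have : ¬ n + 1 ≤ b := by omega
        simp [h', this]
      · have h2 : n + 1 ≤ b := by omega
        have h3 : b - n - 1 = b - (n + 1) := by omega
        simp [h', h2, h3]
    · have h2 : ¬ n + 1 ≤ b := by omega
      simp only [h, h2, if_false, pd_const]

theorem mpd_mono_smul_zero (a b a' b' : ℕ) (v : V) :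
    mpd a b (fun z => mono a' b' z • v) 0 = if a = a' ∧ b = b' then v else 0 := by
  have hm : ∀ p q : ℕ, mono p q 0 = if p = 0 ∧ q = 0 then 1 else 0 := by
    intro p q
    by_cases hp : p = 0 <;> by_cases hq : q = 0 <;> simp [mono, hp, hq]
  have hz : ∀ n : ℕ, (pd 0)^[n] (fun _ : Base => (0 : V)) = fun _ => 0 := by
    intro n
    induction n with
    | zero => rfl
    | succ n ih => rw [Function.iterate_succ_apply', ih, pd_const]
  rw [mpd, iterate_pd_one_mono_smul]
  by_cases hb : b ≤ b'
  · simp only [hb, if_true, iterate_pd_zero_mono_smul, hm]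
    by_cases ha : a ≤ a'
    · by_cases h : a = a' ∧ b = b'
      · obtain ⟨rfl, rfl⟩ := h
        simp
      · have : ¬ (a' - a = 0 ∧ b' - b = 0) := by omega
        rw [if_neg this, if_neg h]
        simp
    · have h : ¬ (a = a' ∧ b = b') := by omega
      rw [if_neg h]
      simp [ha]
  · have h : ¬ (a = a' ∧ b = b') := by omega
    simp only [hb, if_false, h, hz]

theorem mpd_sum {κ : Type*} (s : Finset κ) (F : κ → Base → V)
    (hF : ∀ j, ContDiff ℝ ∞ (F j)) (a b : ℕ) (t : Base) :
    mpd a b (fun z => ∑ j ∈ s, F j z) t = ∑ j ∈ s, mpd a b (F j) t := by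
  classical
  induction s using Finset.induction_on with
  | empty =>
    have := (mpd_clm (0 : V →L[ℝ] V) (f := fun _ : Base => (0 : V)) (t := t)
      contDiffAt_const a b).self_of_nhds
    simpa using this
  | insert j s hj ih =>
    simp only [Finset.sum_insert hj]
    refine (mpd_add (hF j).contDiffAt (ContDiff.sum fun i _ => hF i).contDiffAt a b).self_of_nhds.trans ?_
    exact congrArg _ ih

/-- The polynomial map with Taylor coefficients `c`, indexed by multi-indices `(α j, β j)`. -/
noncomputable def polyMap {κ : Type*} [Fintype κ] (α : κ → ℕ × ℕ) (c : κ → V) (z : Base) : V :=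
  ∑ j, mono (α j).1 (α j).2 z • c j

theorem contDiff_polyMap {κ : Type*} [Fintype κ] (α : κ → ℕ × ℕ) (c : κ → V) :
    ContDiff ℝ ∞ (polyMap α c) :=
  ContDiff.sum fun _ _ => (contDiff_mono _ _).smul contDiff_const

theorem contDiff_polyMap_param {κ : Type*} [Fintype κ] (α : κ → ℕ × ℕ) {E : Type*}
    [NormedAddCommGroup E] [NormedSpace ℝ E] {c : E → κ → V} {f : E → Base}
    (hc : ContDiff ℝ ∞ c) (hf : ContDiff ℝ ∞ f) :
    ContDiff ℝ ∞ fun e => polyMap α (c e) (f e) :=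
  ContDiff.sum fun j _ => ((contDiff_mono _ _).comp hf).smul (contDiff_pi.1 hc j)

theorem mpd_polyMap {κ : Type*} [Fintype κ] [DecidableEq κ] {α : κ → ℕ × ℕ} (hα : α.Injective)
    (c : κ → V) (j : κ) : mpd (α j).1 (α j).2 (polyMap α c) 0 = c j := by
  unfold polyMap
  rw [mpd_sum _ (fun j z => mono (α j).1 (α j).2 z • c j)
    fun j => (contDiff_mono _ _).smul contDiff_const]
  simp only [mpd_mono_smul_zero]
  rw [Finset.sum_eq_single j]
  · simp
  · intro i _ hij
    rw [if_neg]
    rintro ⟨h1, h2⟩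
    exact hij (hα (Prod.ext h1 h2)).symm
  · simp

theorem mpd_polyMap_of_notMem {κ : Type*} [Fintype κ] {α : κ → ℕ × ℕ}
    (c : κ → V) {a b : ℕ} (h : ∀ j, α j ≠ (a, b)) : mpd a b (polyMap α c) 0 = 0 := by
  unfold polyMap
  rw [mpd_sum _ (fun j z => mono (α j).1 (α j).2 z • c j)
    fun j => (contDiff_mono _ _).smul contDiff_const]
  refine Finset.sum_eq_zero fun j _ => ?_
  rw [mpd_mono_smul_zero, if_neg]
  rintro ⟨h1, h2⟩
  exact h j (Prod.ext h1.symm h2.symm)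

theorem polyMap_zero_of_notMem {κ : Type*} [Fintype κ] {α : κ → ℕ × ℕ}
    (c : κ → V) (h : ∀ j, α j ≠ (0, 0)) : polyMap α c 0 = 0 :=
  mpd_polyMap_of_notMem c h

end Polynomials

/-! ### Closeness of jets modulo a group. -/

section Close

variable {ι : Type*} {b p : AddSubgroup (ι → ℝ)} {x y : ι → Base} {k : ℕ}
  {f f' g g' : ι → Base → ℝ}

/-- Two families of functions whose derivatives of order less than `k` agree modulo `p`. -/
def Close (p : AddSubgroup (ι → ℝ)) (x : ι → Base) (k : ℕ) (f g : ι → Base → ℝ) : Prop :=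
  Jetwise p x k fun n z => f n z - g n z

theorem Close.refl (f : ι → Base → ℝ) : Close p x k f f := by
  simpa [Close] using Jetwise.zero

theorem Close.trans (h : Close p x k f g) (h' : Close p x k g g') (sf : SmoothFamily x f)
    (sg : SmoothFamily x g) (sg' : SmoothFamily x g') : Close p x k f g' := by
  simpa [Close] using Jetwise.add h h' (sf.sub sg) (sg.sub sg')

theorem Close.of_le (h : Close p x k f g) {j : ℕ} (hj : j ≤ k) : Close p x j f g :=
  Jetwise.of_le h hj

theorem Close.congr (h : Close p x k f g) (hf : ∀ n, f n =ᶠ[𝓝 (x n)] f' n)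
    (hg : ∀ n, g n =ᶠ[𝓝 (x n)] g' n) : Close p x k f' g' :=
  Jetwise.congr h fun n => (hf n).sub (hg n)

theorem Close.pd (h : Close p x (k + 1) f g) (sf : SmoothFamily x f) (sg : SmoothFamily x g)
    (i : Fin 2) : Close p x k (fun n => pd i (f n)) fun n => pd i (g n) :=
  (Jetwise.congr (h.2 i) fun n => by
    simpa only [pd_neg, ← sub_eq_add_neg] using pd_add (sf n) (sg n).neg i)

theorem Close.mul (hbp : IdealPair b p) (hf : Close p x k f f') (hg : Close p x k g g')
    (bf : Jetwise b x k f) (bg : Jetwise b x k g') (sf : SmoothFamily x f)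
    (sf' : SmoothFamily x f') (sg : SmoothFamily x g) (sg' : SmoothFamily x g') :
    Close p x k (fun n z => f n z * g n z) fun n z => f' n z * g' n z := by
  refine ((bf.mul hbp hg sf (sg.sub sg')).add (Jetwise.mul' hbp hf bg (sf.sub sf') sg')
    (sf.mul (sg.sub sg')) ((sf.sub sf').mul sg')).congr fun n => Eventually.of_forall fun z => ?_
  ring

theorem Close.sum {κ : Type*} {s : Finset κ} {F G : κ → ι → Base → ℝ}
    (h : ∀ j ∈ s, Close p x k (F j) (G j)) (sF : ∀ j ∈ s, SmoothFamily x (F j))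
    (sG : ∀ j ∈ s, SmoothFamily x (G j)) :
    Close p x k (fun n z => ∑ j ∈ s, F j n z) fun n z => ∑ j ∈ s, G j n z := by
  simp only [Close, ← Finset.sum_sub_distrib]
  exact Jetwise.sum h fun j hj => (sF j hj).sub (sG j hj)

theorem Close.comp (hbp : IdealPair b p) {φ φ' : ι → Base → Base}
    (hy : ∀ n, φ n (x n) = y n) (hy' : ∀ n, φ' n (x n) = y n)
    (hfg : Close p y k f g) (bg : Jetwise b y k g) (hφ : ∀ s, Jetwise b x k fun n z => φ n z s)
    (hφ' : ∀ s, Jetwise b x k fun n z => φ' n z s)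
    (hsub : ∀ s, Close p x k (fun n z => φ n z s) fun n z => φ' n z s)
    (sf : SmoothFamily y f) (sg : SmoothFamily y g) (sφ : SmoothFamily x φ)
    (sφ' : SmoothFamily x φ') :
    Close p x k (fun n z => f n (φ n z)) fun n z => g n (φ' n z) :=
  Close.trans (Jetwise.comp hbp hy hfg hφ (sf.sub sg) sφ)
    (Jetwise.comp_sub_comp hbp hy hy' bg hφ hφ' hsub sg sφ sφ') (sf.comp sφ hy) (sg.comp sφ hy)
    (sg.comp sφ' hy')

theorem mpd_sub {V : Type*} [NormedAddCommGroup V] [NormedSpace ℝ V] {f g : Base → V} {t : Base}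
    (hf : ContDiffAt ℝ ∞ f t) (hg : ContDiffAt ℝ ∞ g t) (a b : ℕ) :
    mpd a b (fun y => f y - g y) t = mpd a b f t - mpd a b g t := by
  have h1 := (mpd_clm (-ContinuousLinearMap.id ℝ V) hg a b).self_of_nhds
  have h2 := (mpd_add hf hg.neg a b).self_of_nhds
  simp only [neg_apply, ContinuousLinearMap.id_apply] at h1
  simp only [sub_eq_add_neg, ← h1]
  exact h2

theorem close_iff_mpd (sf : SmoothFamily x f) (sg : SmoothFamily x g) :
    Close p x k f g ↔
      ∀ a b : ℕ, a + b < k → (fun n => mpd a b (f n) (x n) - mpd a b (g n) (x n)) ∈ p := by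
  rw [Close, jetwise_iff_mpd (sf.sub sg)]
  simp only [mpd_sub (sf _) (sg _)]

theorem jetwise_top (f : ι → Base → ℝ) : Jetwise ⊤ x k f := by
  induction k generalizing f with
  | zero => trivial
  | succ k ih => exact ⟨AddSubgroup.mem_top _, fun i => ih _⟩

/-- With one index and p = ⊥, closeness is equality of jets. Thus one calculus serves both exact
statements on jets and the asymptotic ones, where the pair is (O(1), o(e)). -/
theorem idealPair_top_bot : IdealPair (⊤ : AddSubgroup (ι → ℝ)) ⊥ :=
  ⟨bot_le, AddSubgroup.mem_top _, fun _ _ => AddSubgroup.mem_top _, fun {u v} _ hv => by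
    rw [AddSubgroup.mem_bot] at hv ⊢
    subst hv
    funext n
    simp⟩

end Close

/-! ### Transformation of sections by a map and a matrix. -/

section Transform

theorem swap_eq : s((1 : Fin 2), (0 : Fin 2)) = s(0, 1) := Sym2.eq_swap

theorem congrForm_mk (A : Matrix (Fin 2) (Fin 2) ℝ) (b : SymForm) (k l : Fin 2) :
    congrForm A b s(k, l) = ∑ i, ∑ j, A i k * A j l * b s(i, j) := rfl

theorem symForm_ext {b c : SymForm} (h : ∀ k l, b s(k, l) = c s(k, l)) : b = c :=
  funext fun s => Sym2.ind h s

/-- The order of factors is reversed because pullback is contravariant. -/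
theorem congrForm_congrForm (A B : Matrix (Fin 2) (Fin 2) ℝ) (b : SymForm) :
    congrForm A (congrForm B b) = congrForm (B * A) b := by
  refine symForm_ext fun k l => ?_
  simp only [congrForm_mk, Matrix.mul_apply, Fin.sum_univ_two, swap_eq]
  ring

theorem congrForm_one (b : SymForm) : congrForm 1 b = b := by
  refine symForm_ext fun k l => ?_
  fin_cases k <;> fin_cases l <;> simp [congrForm_mk, Fin.sum_univ_two]

/-- The transformed section for an arbitrary matrix. -/
noncomputable def tS (φ : Base → Base) (A : Matrix (Fin 2) (Fin 2) ℝ) (σ : Base → Fibre) :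
    Base → Fibre :=
  fun t => (congrForm (jacobian φ t) (σ (φ t)).1, congrForm A (σ (φ t)).2)

theorem transformSection_eq (φ : Base → Base) (a : GL (Fin 2) ℝ) (σ : Base → Fibre) :
    transformSection φ a σ = tS φ (a : Matrix (Fin 2) (Fin 2) ℝ) σ := rfl

/-- The component `g_s` of a point of the fibre. -/
def gComp (s : Sym2 (Fin 2)) : Fibre →L[ℝ] ℝ :=
  (ContinuousLinearMap.proj (R := ℝ) (φ := fun _ : Sym2 (Fin 2) => ℝ) s).comp
    (ContinuousLinearMap.fst ℝ SymForm SymForm)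

/-- The component `h_s` of a point of the fibre. -/
def hComp (s : Sym2 (Fin 2)) : Fibre →L[ℝ] ℝ :=
  (ContinuousLinearMap.proj (R := ℝ) (φ := fun _ : Sym2 (Fin 2) => ℝ) s).comp
    (ContinuousLinearMap.snd ℝ SymForm SymForm)

@[simp] theorem gComp_apply (s : Sym2 (Fin 2)) (v : Fibre) : gComp s v = v.1 s := rfl

@[simp] theorem hComp_apply (s : Sym2 (Fin 2)) (v : Fibre) : hComp s v = v.2 s := rfl

theorem jacobian_apply (φ : Base → Base) (t : Base) (i k : Fin 2) :
    jacobian φ t i k = pd k φ t i := rfl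

theorem contDiffAt_fibre {E : Type*} [NormedAddCommGroup E] [NormedSpace ℝ E] {f : E → Fibre}
    {x : E} (h1 : ∀ k l, ContDiffAt ℝ ∞ (fun y => (f y).1 s(k, l)) x)
    (h2 : ∀ k l, ContDiffAt ℝ ∞ (fun y => (f y).2 s(k, l)) x) : ContDiffAt ℝ ∞ f x :=
  (contDiffAt_pi.2 fun s => Sym2.ind h1 s).prodMk (contDiffAt_pi.2 fun s => Sym2.ind h2 s)

theorem tS_fst (φ : Base → Base) (A : Matrix (Fin 2) (Fin 2) ℝ) (σ : Base → Fibre) (z : Base)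
    (k l : Fin 2) : (tS φ A σ z).1 s(k, l) =
      ∑ i, ∑ j, pd k φ z i * pd l φ z j * gComp s(i, j) (σ (φ z)) := rfl

theorem tS_snd (φ : Base → Base) (A : Matrix (Fin 2) (Fin 2) ℝ) (σ : Base → Fibre) (z : Base)
    (k l : Fin 2) : (tS φ A σ z).2 s(k, l) =
      ∑ i, ∑ j, A i k * A j l * hComp s(i, j) (σ (φ z)) := rfl

theorem contDiffAt_tS {φ : Base → Base} {A : Matrix (Fin 2) (Fin 2) ℝ} {σ : Base → Fibre}
    {t : Base} (hφ : ContDiffAt ℝ ∞ φ t) (hσ : ContDiffAt ℝ ∞ σ (φ t)) :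
    ContDiffAt ℝ ∞ (tS φ A σ) t := by
  have hc : ContDiffAt ℝ ∞ (fun z => σ (φ z)) t := hσ.comp t hφ
  refine contDiffAt_fibre (fun k l => ?_) fun k l => ?_
  · simp only [tS_fst]
    refine ContDiffAt.sum fun i _ => ContDiffAt.sum fun j _ => ContDiffAt.mul (ContDiffAt.mul
      (contDiffAt_pi.1 (hφ.pd k) i) (contDiffAt_pi.1 (hφ.pd l) j)) ?_
    exact (gComp s(i, j)).contDiff.contDiffAt.comp t hc
  · simp only [tS_snd]
    refine ContDiffAt.sum fun i _ => ContDiffAt.sum fun j _ => contDiffAt_const.mul ?_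
    exact (hComp s(i, j)).contDiff.contDiffAt.comp t hc

theorem pd_coord {φ : Base → Base} {t : Base} (hφ : ContDiffAt ℝ ∞ φ t) (k i : Fin 2) :
    (fun z => pd k φ z i) =ᶠ[𝓝 t] pd k fun z => φ z i :=
  (pd_clm (ContinuousLinearMap.proj (R := ℝ) (φ := fun _ : Fin 2 => ℝ) i) hφ k).symm

theorem jacobian_comp {φ ν : Base → Base} {t : Base} (hφ : DifferentiableAt ℝ φ (ν t))
    (hν : DifferentiableAt ℝ ν t) :
    jacobian (fun z => φ (ν z)) t = jacobian φ (ν t) * jacobian ν t := by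
  have h : fderiv ℝ (fun z => φ (ν z)) t = (fderiv ℝ φ (ν t)).comp (fderiv ℝ ν t) :=
    (hφ.hasFDerivAt.comp t hν.hasFDerivAt).fderiv
  have hJ : ∀ (ψ : Base → Base) z,
      jacobian ψ z = LinearMap.toMatrix' (fderiv ℝ ψ z : Base →ₗ[ℝ] Base) := by
    intro ψ z
    ext i k
    simp [jacobian_apply, pd, LinearMap.toMatrix'_apply]
  rw [hJ, hJ, hJ, h, ← LinearMap.toMatrix'_comp]
  rfl

theorem jacobian_id (t : Base) : jacobian (fun z => z) t = 1 := by
  ext i k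
  simp only [jacobian_apply, pd, fderiv_fun_id, ContinuousLinearMap.id_apply, Matrix.one_apply,
    Pi.single_apply]

theorem jacobian_congr {φ ψ : Base → Base} {t : Base} (h : φ =ᶠ[𝓝 t] ψ) :
    jacobian φ t = jacobian ψ t := by
  ext i k
  simp only [jacobian_apply, (pd_congr h k).self_of_nhds]

/-- The derivative of a map with nonvanishing Jacobian determinant, as an equivalence. -/
theorem exists_equiv_of_jacobian {φ : Base → Base} {t : Base} (h : DifferentiableAt ℝ φ t)
    (hJ : (jacobian φ t).det ≠ 0) : ∃ e : Base ≃L[ℝ] Base, HasFDerivAt φ (e : Base →L[ℝ] Base) t := by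
  have h1 : (fderiv ℝ φ t).det ≠ 0 := by
    have : jacobian φ t = LinearMap.toMatrix' (fderiv ℝ φ t : Base →ₗ[ℝ] Base) := by
      ext i k
      simp [jacobian_apply, pd, LinearMap.toMatrix'_apply]
    rwa [this, LinearMap.det_toMatrix'] at hJ
  exact ⟨(fderiv ℝ φ t).toContinuousLinearEquivOfDetNeZero h1, by simpa using h.hasFDerivAt⟩

theorem tS_tS {φ ν : Base → Base} (A B : Matrix (Fin 2) (Fin 2) ℝ) (σ : Base → Fibre) {t : Base}
    (hφ : DifferentiableAt ℝ φ (ν t)) (hν : DifferentiableAt ℝ ν t) :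
    tS ν B (tS φ A σ) t = tS (fun z => φ (ν z)) (A * B) σ t := by
  simp only [tS, congrForm_congrForm, jacobian_comp hφ hν]

theorem tS_id (σ : Base → Fibre) : tS (fun z => z) 1 σ = σ := by
  funext t
  simp [tS, jacobian_id, congrForm_one]

theorem tS_congr_map {φ ψ : Base → Base} {t : Base} (h : φ =ᶠ[𝓝 t] ψ)
    (A : Matrix (Fin 2) (Fin 2) ℝ) (σ : Base → Fibre) : tS φ A σ =ᶠ[𝓝 t] tS ψ A σ := by
  filter_upwards [h.eventuallyEq_nhds] with z hz
  simp only [tS, jacobian_congr hz, hz.self_of_nhds]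

theorem jacobian_translate (φ : Base → Base) (t c : Base) (z : Base) :
    jacobian (fun z => φ (t + z) - c) z = jacobian φ (t + z) := by
  ext i k
  have h := congrFun (pd_translate φ t k) z
  simp only [jacobian_apply]
  rw [← h]
  simp only [pd, fderiv_sub_const]

/-- Allows both the source and the image point to be moved to the origin. -/
theorem tS_translate (φ : Base → Base) (A : Matrix (Fin 2) (Fin 2) ℝ) (σ : Base → Fibre)
    (t c : Base) :
    (fun z => tS φ A σ (t + z)) = tS (fun z => φ (t + z) - c) A fun z => σ (c + z) := by
  funext z
  simp [tS, jacobian_translate]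

end Transform

/-! ### Jets at the origin and the action of jets of transformations. -/

section Jets

variable {r : ℕ}

/-- The fibre part of an `r`-jet. -/
abbrev JetFibre (r : ℕ) : Type := MultiIdx r → Fibre

/-- The multi-indices of order between `1` and `r + 1`. -/
abbrev PosIdx (r : ℕ) : Type := {J : MultiIdx (r + 1) // 0 < (J.1.1 : ℕ) + (J.1.2 : ℕ)}

/-- Parameters of transformations: the deviation from the identity of the `(r + 1)`-jet of a
diffeomorphism fixing the origin and of a matrix. -/
abbrev Param (r : ℕ) : Type := (PosIdx r → Base) × (Fin 2 → Fin 2 → ℝ)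

noncomputable def jetAt (r : ℕ) (σ : Base → Fibre) (t : Base) : JetFibre r :=
  fun J => mpd (J.1.1 : ℕ) (J.1.2 : ℕ) σ t

def idxPair (J : MultiIdx r) : ℕ × ℕ := (J.1.1, J.1.2)

theorem idxPair_injective : (idxPair (r := r)).Injective := by
  rintro ⟨⟨a, b⟩, h⟩ ⟨⟨c, d⟩, h'⟩ e
  simp only [idxPair, Prod.mk.injEq, Fin.val_inj] at e
  simp [e.1, e.2]

def posPair (J : PosIdx r) : ℕ × ℕ := idxPair J.1

theorem posPair_injective : (posPair (r := r)).Injective :=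
  idxPair_injective.comp Subtype.val_injective

theorem exists_idxPair {a b : ℕ} (h : a + b ≤ r) : ∃ J : MultiIdx r, idxPair J = (a, b) :=
  ⟨⟨(⟨a, by omega⟩, ⟨b, by omega⟩), h⟩, rfl⟩

theorem exists_posPair {a b : ℕ} (h : a + b ≤ r + 1) (h0 : 0 < a + b) :
    ∃ J : PosIdx r, posPair J = (a, b) :=
  ⟨⟨⟨(⟨a, by omega⟩, ⟨b, by omega⟩), h⟩, h0⟩, rfl⟩

/-- The polynomial section with a given jet at the origin. -/
noncomputable def polySec (θ : JetFibre r) : Base → Fibre := polyMap idxPair θ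

/-- The polynomial map `id + ψ` described by a parameter. -/
noncomputable def paramMap (m : Param r) : Base → Base := fun z => z + polyMap posPair m.1 z

noncomputable def paramMatrix (m : Param r) : Matrix (Fin 2) (Fin 2) ℝ := 1 + Matrix.of m.2

/-- The action of transformations on jet fibres. -/
noncomputable def act (m : Param r) (θ : JetFibre r) : JetFibre r :=
  jetAt r (tS (paramMap m) (paramMatrix m) (polySec θ)) 0

theorem contDiff_polySec (θ : JetFibre r) : ContDiff ℝ ∞ (polySec θ) := contDiff_polyMap _ _

theorem contDiff_paramMap (m : Param r) : ContDiff ℝ ∞ (paramMap m) :=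
  contDiff_id.add (contDiff_polyMap _ _)

theorem polyMap_posPair_zero {V : Type*} [NormedAddCommGroup V] [NormedSpace ℝ V]
    (c : PosIdx r → V) : polyMap posPair c 0 = 0 := by
  refine polyMap_zero_of_notMem _ fun J hJ => ?_
  have := J.2
  simp only [posPair, idxPair, Prod.mk.injEq] at hJ
  omega

theorem paramMap_zero (m : Param r) : paramMap m 0 = 0 := by
  simp [paramMap, polyMap_posPair_zero]

theorem jetAt_polySec (θ : JetFibre r) : jetAt r (polySec θ) 0 = θ := by
  funext J
  exact mpd_polyMap idxPair_injective θ J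

theorem jetAt_congr {σ τ : Base → Fibre} {t : Base} (h : σ =ᶠ[𝓝 t] τ) :
    jetAt r σ t = jetAt r τ t :=
  funext fun _ => (mpd_congr h _ _).self_of_nhds

theorem jetAt_translate (σ : Base → Fibre) (t : Base) :
    jetAt r (fun z => σ (t + z)) 0 = jetAt r σ t := by
  funext J
  simp [jetAt, mpd_translate]

theorem act_zero (θ : JetFibre r) : act 0 θ = θ := by
  have h1 : paramMap (0 : Param r) = fun z => z := by
    funext z
    simp [paramMap, polyMap]
  have h2 : paramMatrix (0 : Param r) = 1 := by
    ext i j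
    simp [paramMatrix]
  rw [act, h1, h2, tS_id, jetAt_polySec]

variable {ι : Type*} {p : AddSubgroup (ι → ℝ)} {x : ι → Base}

theorem close_comp_iff {L : Fibre →L[ℝ] ℝ} {σ τ : ι → Base → Fibre} (hσ : SmoothFamily x σ)
    (hτ : SmoothFamily x τ) :
    Close p x (r + 1) (fun n z => L (σ n z)) (fun n z => L (τ n z)) ↔
      ∀ J : MultiIdx r, (fun n => L (jetAt r (σ n) (x n) J) - L (jetAt r (τ n) (x n) J)) ∈ p := by
  have s : ∀ {σ : ι → Base → Fibre}, SmoothFamily x σ → SmoothFamily x fun n z => L (σ n z) :=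
    fun hσ n => L.contDiff.contDiffAt.comp (x n) (hσ n)
  rw [close_iff_mpd (s hσ) (s hτ)]
  have e : ∀ a b, (fun n => mpd a b (fun z => L (σ n z)) (x n) - mpd a b (fun z => L (τ n z)) (x n)) =
      fun n => L (mpd a b (σ n) (x n)) - L (mpd a b (τ n) (x n)) := by
    intro a b
    funext n
    rw [(mpd_clm L (hσ n) a b).self_of_nhds, (mpd_clm L (hτ n) a b).self_of_nhds]
  simp only [e]
  constructor
  · intro h J
    exact h _ _ (Nat.lt_succ_of_le J.2)
  · intro h a b hab
    obtain ⟨J, hJ⟩ := exists_idxPair (r := r) (a := a) (b := b) (by omega)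
    have h1 := h J
    simp only [idxPair, Prod.mk.injEq] at hJ
    simpa only [jetAt, hJ.1, hJ.2] using h1

theorem jetAt_eq_iff {σ τ : Base → Fibre} {t : Base} (hσ : ContDiffAt ℝ ∞ σ t)
    (hτ : ContDiffAt ℝ ∞ τ t) : jetAt r σ t = jetAt r τ t ↔
      (∀ s, Close (⊥ : AddSubgroup (Unit → ℝ)) (fun _ => t) (r + 1) (fun _ z => (σ z).1 s)
        fun _ z => (τ z).1 s) ∧
      ∀ s, Close (⊥ : AddSubgroup (Unit → ℝ)) (fun _ => t) (r + 1) (fun _ z => (σ z).2 s)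
        fun _ z => (τ z).2 s := by
  have hg := fun s => close_comp_iff (r := r) (p := (⊥ : AddSubgroup (Unit → ℝ))) (L := gComp s)
    (x := fun _ => t) (σ := fun _ => σ) (τ := fun _ => τ) (fun _ => hσ) fun _ => hτ
  have hh := fun s => close_comp_iff (r := r) (p := (⊥ : AddSubgroup (Unit → ℝ))) (L := hComp s)
    (x := fun _ => t) (σ := fun _ => σ) (τ := fun _ => τ) (fun _ => hσ) fun _ => hτ
  simp only [gComp_apply] at hg
  simp only [hComp_apply] at hh
  simp only [hg, hh, AddSubgroup.mem_bot]
  constructor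
  · intro h
    simp only [h, sub_self]
    exact ⟨fun _ _ => rfl, fun _ _ => rfl⟩
  · rintro ⟨h1, h2⟩
    funext J
    refine Prod.ext (funext fun s => ?_) (funext fun s => ?_)
    · exact sub_eq_zero.1 (congrFun (h1 s J) ())
    · exact sub_eq_zero.1 (congrFun (h2 s J) ())

/-- The Jacobian factors cost one derivative of φ and none of σ: r-jets of sections need (r+1)-jets
of maps. This makes `act`, defined with polynomial representatives, independent of the
representatives. -/
theorem jetAt_tS_congr {φ φ' : Base → Base} {A : Matrix (Fin 2) (Fin 2) ℝ} {σ σ' : Base → Fibre}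
    {t u : Base} (hu : φ t = u) (hu' : φ' t = u) (sφ : ContDiffAt ℝ ∞ φ t)
    (sφ' : ContDiffAt ℝ ∞ φ' t) (sσ : ContDiffAt ℝ ∞ σ u) (sσ' : ContDiffAt ℝ ∞ σ' u)
    (hφ : ∀ a b, a + b ≤ r + 1 → mpd a b φ t = mpd a b φ' t)
    (hσ : jetAt r σ u = jetAt r σ' u) :
    jetAt r (tS φ A σ) t = jetAt r (tS φ' A σ') t := by
  have hbp := idealPair_top_bot (ι := Unit)
  have sσc : ContDiffAt ℝ ∞ (fun z => σ (φ z)) t := ContDiffAt.comp t (by rwa [hu]) sφ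
  have sσc' : ContDiffAt ℝ ∞ (fun z => σ' (φ' z)) t := ContDiffAt.comp t (by rwa [hu']) sφ'
  have cφ : ∀ s, Close (⊥ : AddSubgroup (Unit → ℝ)) (fun _ => t) (r + 2) (fun _ z => φ z s)
      fun _ z => φ' z s := by
    intro s
    rw [close_iff_mpd (fun _ => contDiffAt_pi.1 sφ s) fun _ => contDiffAt_pi.1 sφ' s]
    intro a b hab
    rw [AddSubgroup.mem_bot]
    funext _
    have h1 := (mpd_clm (ContinuousLinearMap.proj (R := ℝ) (φ := fun _ : Fin 2 => ℝ) s) sφ a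
      b).self_of_nhds
    have h2 := (mpd_clm (ContinuousLinearMap.proj (R := ℝ) (φ := fun _ : Fin 2 => ℝ) s) sφ' a
      b).self_of_nhds
    simp only [ContinuousLinearMap.proj_apply] at h1 h2
    rw [h1, h2, hφ a b (by omega), sub_self]
    rfl
  have cJ : ∀ k i, Close (⊥ : AddSubgroup (Unit → ℝ)) (fun _ => t) (r + 1) (fun _ z => pd k φ z i)
      fun _ z => pd k φ' z i := fun k i =>
    ((cφ i).pd (fun _ => contDiffAt_pi.1 sφ i) (fun _ => contDiffAt_pi.1 sφ' i) k).congr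
      (fun _ => (pd_coord sφ k i).symm) fun _ => (pd_coord sφ' k i).symm
  rw [jetAt_eq_iff (contDiffAt_tS sφ (by rwa [hu])) (contDiffAt_tS sφ' (by rwa [hu']))]
  rw [jetAt_eq_iff sσ sσ'] at hσ
  have cσ : ∀ L : Fibre →L[ℝ] ℝ, Close (⊥ : AddSubgroup (Unit → ℝ)) (fun _ => u) (r + 1)
      (fun _ z => L (σ z)) (fun _ z => L (σ' z)) → Close (⊥ : AddSubgroup (Unit → ℝ)) (fun _ => t)
      (r + 1) (fun _ z => L (σ (φ z))) (fun _ z => L (σ' (φ' z))) := fun L h =>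
    Close.comp (f := fun _ z => L (σ z)) (g := fun _ z => L (σ' z)) (φ := fun _ => φ)
      (φ' := fun _ => φ') hbp (fun _ => hu) (fun _ => hu') h (jetwise_top _)
      (fun _ => jetwise_top _) (fun _ => jetwise_top _) (fun s => (cφ s).of_le (by omega))
      (fun _ => L.contDiff.contDiffAt.comp u sσ) (fun _ => L.contDiff.contDiffAt.comp u sσ')
      (fun _ => sφ) (fun _ => sφ')
  have sJ : ∀ k i, SmoothFamily (fun _ : Unit => t) fun _ z => pd k φ z i :=
    fun k i _ => contDiffAt_pi.1 (sφ.pd k) i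
  have sJ' : ∀ k i, SmoothFamily (fun _ : Unit => t) fun _ z => pd k φ' z i :=
    fun k i _ => contDiffAt_pi.1 (sφ'.pd k) i
  have sL : ∀ L : Fibre →L[ℝ] ℝ, SmoothFamily (fun _ : Unit => t) fun _ z => L (σ (φ z)) :=
    fun L _ => L.contDiff.contDiffAt.comp t sσc
  have sL' : ∀ L : Fibre →L[ℝ] ℝ, SmoothFamily (fun _ : Unit => t) fun _ z => L (σ' (φ' z)) :=
    fun L _ => L.contDiff.contDiffAt.comp t sσc'
  have cc : ∀ c : ℝ, SmoothFamily (fun _ : Unit => t) fun _ _ => c := fun c _ => contDiffAt_const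
  constructor
  · intro s
    induction s using Sym2.ind with
    | _ k l =>
      simp only [tS_fst]
      exact Close.sum (fun i _ => Close.sum (fun j _ => Close.mul hbp
        (Close.mul hbp (cJ k i) (cJ l j) (jetwise_top _) (jetwise_top _) (sJ k i) (sJ' k i)
          (sJ l j) (sJ' l j)) (cσ (gComp s(i, j)) (hσ.1 _)) (jetwise_top _) (jetwise_top _)
        ((sJ k i).mul (sJ l j)) ((sJ' k i).mul (sJ' l j)) (sL (gComp s(i, j)))
        (sL' (gComp s(i, j))))
        (fun j _ => ((sJ k i).mul (sJ l j)).mul (sL (gComp s(i, j))))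
        (fun j _ => ((sJ' k i).mul (sJ' l j)).mul (sL' (gComp s(i, j)))))
        (fun i _ => SmoothFamily.sum fun j _ => ((sJ k i).mul (sJ l j)).mul (sL (gComp s(i, j))))
        (fun i _ => SmoothFamily.sum fun j _ =>
          ((sJ' k i).mul (sJ' l j)).mul (sL' (gComp s(i, j))))
  · intro s
    induction s using Sym2.ind with
    | _ k l =>
      simp only [tS_snd]
      exact Close.sum (fun i _ => Close.sum (fun j _ => Close.mul hbp (Close.refl _)
        (cσ (hComp s(i, j)) (hσ.2 _)) (jetwise_top _) (jetwise_top _)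
        (cc _) (cc _) (sL (hComp s(i, j))) (sL' (hComp s(i, j))))
        (fun j _ => (cc _).mul (sL (hComp s(i, j))))
        (fun j _ => (cc _).mul (sL' (hComp s(i, j)))))
        (fun i _ => SmoothFamily.sum fun j _ => (cc _).mul (sL (hComp s(i, j))))
        (fun i _ => SmoothFamily.sum fun j _ => (cc _).mul (sL' (hComp s(i, j))))

end Jets

/-! ### Orbits in jet space and the relation on jet fibres. -/

section Relation

variable {r : ℕ}

theorem contDiff_tS_param {E : Type*} [NormedAddCommGroup E] [NormedSpace ℝ E]
    {φ : E → Base → Base} {A : E → Matrix (Fin 2) (Fin 2) ℝ} {σ : E → Base → Fibre}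
    (hφ : ContDiff ℝ ∞ fun q : E × Base => φ q.1 q.2)
    (hA : ∀ i k, ContDiff ℝ ∞ fun e => A e i k)
    (hσ : ContDiff ℝ ∞ fun q : E × Base => σ q.1 (φ q.1 q.2)) :
    ContDiff ℝ ∞ fun q : E × Base => tS (φ q.1) (A q.1) (σ q.1) q.2 := by
  have hJ : ∀ k i, ContDiff ℝ ∞ fun q : E × Base => pd k (φ q.1) q.2 i :=
    fun k i => contDiff_pi.1 (contDiff_pd hφ k) i
  have hA' : ∀ i k, ContDiff ℝ ∞ fun q : E × Base => A q.1 i k :=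
    fun i k => (hA i k).comp contDiff_fst
  refine contDiff_iff_contDiffAt.2 fun q => contDiffAt_fibre (fun k l => ?_) fun k l => ?_
  · simp only [tS_fst]
    exact (ContDiff.sum fun i _ => ContDiff.sum fun j _ => ((hJ k i).mul (hJ l j)).mul
      ((gComp s(i, j)).contDiff.comp hσ)).contDiffAt
  · simp only [tS_snd]
    exact (ContDiff.sum fun i _ => ContDiff.sum fun j _ => ((hA' i k).mul (hA' j l)).mul
      ((hComp s(i, j)).contDiff.comp hσ)).contDiffAt

theorem contDiff_mpd_const {E V : Type*} [NormedAddCommGroup E] [NormedSpace ℝ E]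
    [NormedAddCommGroup V] [NormedSpace ℝ V] {F : E × Base → V} (hF : ContDiff ℝ ∞ F) (a b : ℕ)
    (z : Base) : ContDiff ℝ ∞ fun e : E => mpd a b (fun z => F (e, z)) z :=
  (contDiff_mpd hF a b).comp (contDiff_id.prodMk contDiff_const)

theorem contDiff_paramMatrix (i k : Fin 2) : ContDiff ℝ ∞ fun m : Param r => paramMatrix m i k := by
  simp only [paramMatrix, Matrix.add_apply, Matrix.of_apply]
  exact contDiff_const.add (contDiff_pi.1 (contDiff_pi.1 contDiff_snd i) k)

theorem contDiff_act : ContDiff ℝ ∞ fun q : Param r × JetFibre r => act q.1 q.2 := by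
  have hM : ContDiff ℝ ∞ fun q : (Param r × JetFibre r) × Base => paramMap q.1.1 q.2 :=
    contDiff_snd.add (contDiff_polyMap_param _ (contDiff_fst.comp (contDiff_fst.comp contDiff_fst))
      contDiff_snd)
  have hσ : ContDiff ℝ ∞ fun q : (Param r × JetFibre r) × Base =>
      polySec q.1.2 (paramMap q.1.1 q.2) :=
    contDiff_polyMap_param _ (contDiff_snd.comp contDiff_fst) hM
  have hA : ∀ i k, ContDiff ℝ ∞ fun q : Param r × JetFibre r =>
      paramMatrix q.1 i k := fun i k => (contDiff_paramMatrix i k).comp contDiff_fst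
  exact contDiff_pi.2 fun J => contDiff_mpd_const (contDiff_tS_param
    (φ := fun q : Param r × JetFibre r => paramMap q.1) (A := fun q => paramMatrix q.1)
    (σ := fun q => polySec q.2) hM hA hσ) J.1.1 J.1.2 0

/-- Two jet fibres are related by a diffeomorphism fixing the origin and an invertible matrix. -/
def JetRel (θ θ' : JetFibre r) : Prop :=
  ∃ m : Param r, (jacobian (paramMap m) 0).det ≠ 0 ∧ (paramMatrix m).det ≠ 0 ∧ act m θ' = θ

/-- The map ν may be replaced by its Taylor polynomial of order r + 1, which leaves the r-jet of the
transformed section unchanged. -/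
theorem JetRel.of_smooth {ν : Base → Base} {A : Matrix (Fin 2) (Fin 2) ℝ} {σ : Base → Fibre}
    (sν : ContDiffAt ℝ ∞ ν 0) (hν : ν 0 = 0) (hJ : (jacobian ν 0).det ≠ 0) (hA : A.det ≠ 0)
    (sσ : ContDiffAt ℝ ∞ σ 0) : JetRel (jetAt r (tS ν A σ) 0) (jetAt r σ 0) := by
  let m : Param r := (fun J => mpd (posPair J).1 (posPair J).2 (fun z => ν z - z) 0,
    fun i j => (A - 1) i j)
  have sid : ContDiffAt ℝ ∞ (fun z : Base => z) 0 := contDiffAt_id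
  have hmpd : ∀ a b, a + b ≤ r + 1 → mpd a b (paramMap m) 0 = mpd a b ν 0 := by
    intro a b hab
    by_cases h0 : a + b = 0
    · obtain ⟨rfl, rfl⟩ : a = 0 ∧ b = 0 := by omega
      exact (paramMap_zero m).trans hν.symm
    · obtain ⟨J, hJ⟩ := exists_posPair (r := r) hab (by omega)
      have h1 := (mpd_add sid (contDiff_polyMap posPair m.1).contDiffAt a b).self_of_nhds
      have h2 : mpd a b (polyMap posPair m.1) 0 = mpd a b ν 0 - mpd a b (fun z => z) 0 := by
        have h3 := mpd_polyMap posPair_injective m.1 J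
        rw [hJ] at h3
        refine h3.trans ?_
        simp only [m, hJ]
        exact mpd_sub sν sid a b
      refine h1.trans ?_
      simp only [h2]
      abel
  have hmA : paramMatrix m = A := by
    ext i j
    simp [paramMatrix, m]
  have hjac : jacobian (paramMap m) 0 = jacobian ν 0 := by
    ext i k
    simp only [jacobian_apply]
    fin_cases k
    · exact congrFun (hmpd 1 0 (by omega)) i
    · exact congrFun (hmpd 0 1 (by omega)) i
  refine ⟨m, by rwa [hjac], by rwa [hmA], ?_⟩
  rw [act, hmA]
  exact jetAt_tS_congr (paramMap_zero m) hν (contDiff_paramMap m).contDiffAt sν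
    (contDiff_polySec _).contDiffAt sσ hmpd (jetAt_polySec _)

/-- The inverse function theorem gives smoothness of the inverse only at points with invertible
derivative, an open condition; the domain is restricted to such points to have smoothness on the
whole target. -/
theorem exists_local_inverse {φ : Base → Base} (hφ : ContDiff ℝ ∞ φ) {t : Base}
    (hJ : (jacobian φ t).det ≠ 0) {U : Set Base} (hU : IsOpen U) (ht : t ∈ U) :
    ∃ e : OpenPartialHomeomorph Base Base, (e : Base → Base) = φ ∧ t ∈ e.source ∧ e.source ⊆ U ∧
      ContDiffOn ℝ ∞ e.symm e.target := by
  obtain ⟨f, hf⟩ := exists_equiv_of_jacobian (hφ.differentiable (by simp) t) hJ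
  have hcont : Continuous fun z => (jacobian φ z).det := by
    simp only [Matrix.det_fin_two, jacobian_apply]
    have : ∀ k i, Continuous fun z => pd k φ z i := fun k i =>
      (contDiff_pi.1 (contDiff_iff_contDiffAt.2 fun z => (hφ.contDiffAt (x := z)).pd k)
        i).continuous
    fun_prop
  have hO : IsOpen {z | (jacobian φ z).det ≠ 0} := isOpen_ne.preimage hcont
  let e₀ := hφ.contDiffAt.toOpenPartialHomeomorph φ hf (by simp)
  let e := e₀.restrOpen (U ∩ {z | (jacobian φ z).det ≠ 0}) (hU.inter hO)
  refine ⟨e, rfl, ⟨hφ.contDiffAt.mem_toOpenPartialHomeomorph_source hf (by simp), ht, hJ⟩,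
    fun z hz => hz.2.1, fun z hz => ?_⟩
  have h1 : e.symm z ∈ e.source := e.map_target hz
  obtain ⟨f', hf'⟩ := exists_equiv_of_jacobian (hφ.differentiable (by simp) (e.symm z)) h1.2.2
  exact (e.contDiffAt_symm hz hf' hφ.contDiffAt).contDiffWithinAt

/-- The composite of two polynomial maps exceeds the allowed degree; `JetRel.of_smooth` truncates
it. -/
theorem JetRel.trans {θ₁ θ₂ θ₃ : JetFibre r} (h : JetRel θ₁ θ₂) (h' : JetRel θ₂ θ₃) : JetRel θ₁ θ₃ := by
  obtain ⟨m, hJ, hA, rfl⟩ := h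
  obtain ⟨m', hJ', hA', rfl⟩ := h'
  have s := (contDiff_paramMap m)
  have s' := (contDiff_paramMap m')
  have d : Differentiable ℝ (paramMap m) := s.differentiable (by simp)
  have d' : Differentiable ℝ (paramMap m') := s'.differentiable (by simp)
  have sτ : ContDiffAt ℝ ∞ (tS (paramMap m') (paramMatrix m') (polySec θ₃)) 0 :=
    contDiffAt_tS s'.contDiffAt (contDiff_polySec _).contDiffAt
  have h1 : act m (act m' θ₃) =
      jetAt r (tS (fun z => paramMap m' (paramMap m z)) (paramMatrix m' * paramMatrix m)
        (polySec θ₃)) 0 := by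
    have h2 : tS (paramMap m) (paramMatrix m) (tS (paramMap m') (paramMatrix m') (polySec θ₃)) =
        tS (fun z => paramMap m' (paramMap m z)) (paramMatrix m' * paramMatrix m) (polySec θ₃) :=
      funext fun z => tS_tS _ _ _ (d' _) (d z)
    rw [← h2]
    exact jetAt_tS_congr (paramMap_zero m) (paramMap_zero m) s.contDiffAt s.contDiffAt
      (contDiff_polySec _).contDiffAt sτ (fun _ _ _ => rfl) (jetAt_polySec _)
  rw [h1]
  have h3 := JetRel.of_smooth (r := r) (ν := fun z => paramMap m' (paramMap m z))
    (A := paramMatrix m' * paramMatrix m) (σ := polySec θ₃) (s'.comp s).contDiffAt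
    (by simp [paramMap_zero])
    (by rw [jacobian_comp (d' _) (d _), paramMap_zero, Matrix.det_mul]; exact mul_ne_zero hJ' hJ)
    (by rw [Matrix.det_mul]; exact mul_ne_zero hA' hA) (contDiff_polySec _).contDiffAt
  rwa [jetAt_polySec] at h3

theorem JetRel.symm {θ θ' : JetFibre r} (h : JetRel θ θ') : JetRel θ' θ := by
  obtain ⟨m, hJ, hA, rfl⟩ := h
  have s := (contDiff_paramMap m)
  have d : Differentiable ℝ (paramMap m) := s.differentiable (by simp)
  obtain ⟨e, he, h0, -, hs⟩ := exists_local_inverse s hJ isOpen_univ (Set.mem_univ _)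
  have h0' : (0 : Base) ∈ e.target := by
    have := e.map_source h0
    rwa [he, paramMap_zero] at this
  have e0 : e.symm 0 = 0 := by
    have := e.left_inv h0
    rwa [he, paramMap_zero] at this
  have ss : ContDiffAt ℝ ∞ e.symm 0 := (hs 0 h0').contDiffAt (e.open_target.mem_nhds h0')
  have hright : (fun z => paramMap m (e.symm z)) =ᶠ[𝓝 0] fun z => z := by
    filter_upwards [e.open_target.mem_nhds h0'] with z hz
    have := e.right_inv hz
    rwa [he] at this
  have hjac : jacobian (paramMap m) 0 * jacobian e.symm 0 = 1 := by
    have h1 := jacobian_comp (t := 0) (d (e.symm 0)) (ss.differentiableAt (by simp))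
    rw [jacobian_congr hright, jacobian_id, e0] at h1
    exact h1.symm
  have hAA : paramMatrix m * (paramMatrix m)⁻¹ = 1 :=
    Matrix.mul_nonsing_inv _ (isUnit_iff_ne_zero.2 hA)
  have hst : ContDiffAt ℝ ∞ (tS (paramMap m) (paramMatrix m) (polySec θ')) 0 :=
    contDiffAt_tS s.contDiffAt (contDiff_polySec _).contDiffAt
  have h2 : tS e.symm (paramMatrix m)⁻¹ (tS (paramMap m) (paramMatrix m) (polySec θ')) =ᶠ[𝓝 0]
      polySec θ' := by
    have h3 := tS_congr_map hright 1 (polySec θ')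
    rw [tS_id] at h3
    refine EventuallyEq.trans ?_ h3
    filter_upwards [ss.eventually_differentiableAt] with z hz
    rw [tS_tS _ _ _ (d _) hz, hAA]
  have h4 := JetRel.of_smooth (r := r) ss e0
    (fun h => by simpa [h] using congrArg Matrix.det hjac)
    (A := (paramMatrix m)⁻¹) (fun h => by simpa [h] using congrArg Matrix.det hAA) hst
  rwa [jetAt_congr h2, jetAt_polySec] at h4

/-- Transitivity of translations removes the base point. For the converse, the polynomial
transformation is conjugated by the translations to θ.1 and θ'.1, then restricted to a neighbourhood
mapped into S. -/
theorem sameOrbit_iff {S : Set Base} (hS : IsOpen S) {θ θ' : Jet r} :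
    SameOrbit S r θ θ' ↔ θ.1 ∈ S ∧ θ'.1 ∈ S ∧ JetRel θ.2 θ'.2 := by
  constructor
  · rintro ⟨φ, a, σ, hs, ht, sφ, sφ', sσ, h0, h1, h2⟩
    have e1 : φ θ.1 = θ'.1 := congrArg Prod.fst h1
    have e2 : jetAt r σ (φ θ.1) = θ'.2 := congrArg Prod.snd h1
    have e3 : jetAt r (tS φ (a : Matrix (Fin 2) (Fin 2) ℝ) σ) θ.1 = θ.2 := congrArg Prod.snd h2
    have h0' : θ'.1 ∈ φ.target := e1 ▸ φ.map_source h0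
    refine ⟨hs h0, ht h0', ?_⟩
    have s1 : ContDiffAt ℝ ∞ φ θ.1 := sφ.contDiffAt (φ.open_source.mem_nhds h0)
    have s2 : ContDiffAt ℝ ∞ φ.symm (φ θ.1) := by
      rw [e1]
      exact sφ'.contDiffAt (φ.open_target.mem_nhds h0')
    have s3 : ContDiffAt ℝ ∞ σ θ'.1 := sσ.contDiffAt (φ.open_target.mem_nhds h0')
    have hjac : jacobian φ.symm (φ θ.1) * jacobian φ θ.1 = 1 := by
      rw [← jacobian_comp (s2.differentiableAt (by simp)) (s1.differentiableAt (by simp)),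
        ← jacobian_id θ.1]
      refine jacobian_congr ?_
      filter_upwards [φ.open_source.mem_nhds h0] with z hz
      exact φ.left_inv hz
    have key := JetRel.of_smooth (r := r) (ν := fun z => φ (θ.1 + z) - θ'.1)
      (A := (a : Matrix (Fin 2) (Fin 2) ℝ)) (σ := fun z => σ (θ'.1 + z))
      ((ContDiffAt.comp 0 (by simpa using s1) (contDiffAt_const.add contDiffAt_id)).sub
        contDiffAt_const) (by simp [e1])
      (by
        rw [jacobian_translate, add_zero]
        intro h
        simpa [h] using congrArg Matrix.det hjac)
      (by
        have := a.isUnit.map Matrix.detMonoidHom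
        exact this.ne_zero)
      (ContDiffAt.comp 0 (by simpa using s3) (contDiffAt_const.add contDiffAt_id))
    rwa [← tS_translate, jetAt_translate, jetAt_translate, e3, ← e1, e2] at key
  · rintro ⟨h1, h2, m, hJ, hA, hm⟩
    have s : ContDiff ℝ ∞ fun x => θ'.1 + paramMap m (x - θ.1) :=
      contDiff_const.add ((contDiff_paramMap m).comp (contDiff_id.sub contDiff_const))
    have e0 : θ'.1 + paramMap m (θ.1 - θ.1) = θ'.1 := by simp [paramMap_zero]
    have eφ : (fun z => θ'.1 + paramMap m (θ.1 + z - θ.1) - θ'.1) = paramMap m := by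
      funext z
      simp
    have hJ' : (jacobian (fun x => θ'.1 + paramMap m (x - θ.1)) θ.1).det ≠ 0 := by
      have h := jacobian_translate (fun x => θ'.1 + paramMap m (x - θ.1)) θ.1 θ'.1 0
      rw [eφ, add_zero] at h
      rwa [← h]
    obtain ⟨e, he, ht, hsub, hsymm⟩ := exists_local_inverse s hJ'
      (hS.inter (hS.preimage s.continuous)) ⟨h1, by simpa only [Set.mem_preimage, e0] using h2⟩
    have sσ : ContDiff ℝ ∞ fun x => polySec θ'.2 (x - θ'.1) :=
      (contDiff_polySec _).comp (contDiff_id.sub contDiff_const)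
    have eσ : (fun z => polySec θ'.2 (θ'.1 + z - θ'.1)) = polySec θ'.2 := by
      funext z
      simp
    refine ⟨e, Matrix.GeneralLinearGroup.mkOfDetNeZero _ hA, fun x => polySec θ'.2 (x - θ'.1),
      fun x hx => (hsub hx).1, fun x hx => ?_, by rw [he]; exact s.contDiffOn, hsymm,
      sσ.contDiffOn, ht, ?_, ?_⟩
    · have h3 := (hsub (e.map_target hx)).2
      rw [Set.mem_preimage, ← congrFun he, e.right_inv hx] at h3
      exact h3
    · rw [he]
      refine Prod.ext e0 ?_
      have h3 := jetAt_translate (r := r) (fun x => polySec θ'.2 (x - θ'.1)) θ'.1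
      rw [eσ, jetAt_polySec] at h3
      simp only [e0]
      exact h3.symm
    · refine Prod.ext rfl ?_
      have h3 := jetAt_translate (r := r) (tS (fun x => θ'.1 + paramMap m (x - θ.1))
        (paramMatrix m) fun x => polySec θ'.2 (x - θ'.1)) θ.1
      rw [tS_translate _ _ _ _ θ'.1, eφ, eσ] at h3
      rw [he, transformSection_eq]
      exact h3.symm.trans hm

end Relation

/-! ### First order covariants of (g, h, ∂h) and generic jets. -/

section FirstOrder

/-- The polarized discriminant of symmetric forms. -/
def discPair (b c : SymForm) : ℝ :=
  b s(0, 0) * c s(1, 1) + b s(1, 1) * c s(0, 0) - 2 * (b s(0, 1) * c s(0, 1))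

/-- The determinant of a triple of symmetric forms. -/
def tripleDet (b c d : SymForm) : ℝ :=
  b s(0, 0) * (c s(0, 1) * d s(1, 1) - c s(1, 1) * d s(0, 1)) -
    b s(0, 1) * (c s(0, 0) * d s(1, 1) - c s(1, 1) * d s(0, 0)) +
    b s(1, 1) * (c s(0, 0) * d s(0, 1) - c s(0, 1) * d s(0, 0))

/-- The covector `β g⁻¹ α` up to the factor `det g`, where `αᵢ` and `βᵢⱼ` are the discriminant
pairings of `h` and its derivatives `d`. -/
def secondCovector (g h : SymForm) (d : Fin 2 → SymForm) (i : Fin 2) : ℝ :=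
  discPair (d i) (d 0) * (g s(1, 1) * discPair h (d 0) - g s(0, 1) * discPair h (d 1)) +
    discPair (d i) (d 1) * (g s(0, 0) * discPair h (d 1) - g s(0, 1) * discPair h (d 0))

theorem congrForm_add_smul (A : Matrix (Fin 2) (Fin 2) ℝ) (b c : SymForm) (x y : ℝ) :
    congrForm A (x • b + y • c) = x • congrForm A b + y • congrForm A c := by
  refine symForm_ext fun k l => ?_
  simp only [congrForm_mk, Pi.add_apply, Pi.smul_apply, Fin.sum_univ_two, smul_eq_mul]
  ring

theorem discPair_congrForm (A : Matrix (Fin 2) (Fin 2) ℝ) (b c : SymForm) :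
    discPair (congrForm A b) (congrForm A c) = A.det ^ 2 * discPair b c := by
  simp only [discPair, congrForm_mk, Fin.sum_univ_two, swap_eq, Matrix.det_fin_two]
  ring

theorem tripleDet_congrForm (A : Matrix (Fin 2) (Fin 2) ℝ) (b c d : SymForm) :
    tripleDet (congrForm A b) (congrForm A c) (congrForm A d) = A.det ^ 3 * tripleDet b c d := by
  simp only [tripleDet, congrForm_mk, Fin.sum_univ_two, swap_eq, Matrix.det_fin_two]
  ring

theorem discPair_comm (b c : SymForm) : discPair b c = discPair c b := by
  simp only [discPair]
  ring

theorem discPair_add_smul (b c d : SymForm) (x y : ℝ) :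
    discPair b (x • c + y • d) = x * discPair b c + y * discPair b d := by
  simp only [discPair, Pi.add_apply, Pi.smul_apply, smul_eq_mul]
  ring

theorem tripleDet_add_smul (b c d : SymForm) (x y z w : ℝ) :
    tripleDet b (x • c + y • d) (z • c + w • d) = (x * w - y * z) * tripleDet b c d := by
  simp only [tripleDet, Pi.add_apply, Pi.smul_apply, smul_eq_mul]
  ring

theorem tripleDet_cramer (b c d v : SymForm) (s : Sym2 (Fin 2)) :
    tripleDet b c d * v s =
      tripleDet v c d * b s + tripleDet b v d * c s + tripleDet b c v * d s := by
  induction s using Sym2.ind with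
  | _ k l =>
    simp only [tripleDet]
    fin_cases k <;> fin_cases l <;> simp only [Fin.zero_eta, Fin.mk_one, swap_eq] <;> ring

/-- The transformation law of the data `(g, h, ∂h)`. -/
structure DataLaw (J A : Matrix (Fin 2) (Fin 2) ℝ) (g h : SymForm) (d : Fin 2 → SymForm)
    (g' h' : SymForm) (d' : Fin 2 → SymForm) : Prop where
  metric : g = congrForm J g'
  form : h = congrForm A h'
  deriv : ∀ i, d i = J 0 i • congrForm A (d' 0) + J 1 i • congrForm A (d' 1)

/-- The nondegeneracy condition on the data `(g, h, ∂h)`. -/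
structure GenericData (g h : SymForm) (d : Fin 2 → SymForm) : Prop where
  metric : discPair g g ≠ 0
  form : discPair h h ≠ 0
  triple : tripleDet h (d 0) (d 1) ≠ 0
  frame : discPair h (d 0) * secondCovector g h d 1 - discPair h (d 1) * secondCovector g h d 0 ≠ 0

variable {J A : Matrix (Fin 2) (Fin 2) ℝ} {g h g' h' : SymForm} {d d' : Fin 2 → SymForm}

theorem DataLaw.discPair_metric (H : DataLaw J A g h d g' h' d') :
    discPair g g = J.det ^ 2 * discPair g' g' := by
  rw [H.metric, discPair_congrForm]

theorem DataLaw.discPair_form (H : DataLaw J A g h d g' h' d') :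
    discPair h h = A.det ^ 2 * discPair h' h' := by
  rw [H.form, discPair_congrForm]

theorem DataLaw.discPair_form_deriv (H : DataLaw J A g h d g' h' d') (i : Fin 2) :
    discPair h (d i) =
      A.det ^ 2 * (J 0 i * discPair h' (d' 0) + J 1 i * discPair h' (d' 1)) := by
  rw [H.form, H.deriv, discPair_add_smul, discPair_congrForm, discPair_congrForm]
  ring

theorem DataLaw.discPair_deriv_deriv (H : DataLaw J A g h d g' h' d') (i j : Fin 2) :
    discPair (d i) (d j) = A.det ^ 2 *
      (J 0 i * (J 0 j * discPair (d' 0) (d' 0) + J 1 j * discPair (d' 0) (d' 1)) +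
        J 1 i * (J 0 j * discPair (d' 1) (d' 0) + J 1 j * discPair (d' 1) (d' 1))) := by
  rw [H.deriv i, discPair_comm, discPair_add_smul, H.deriv j, discPair_comm _ (congrForm A (d' 0)),
    discPair_comm _ (congrForm A (d' 1)), discPair_add_smul, discPair_add_smul]
  simp only [discPair_congrForm]
  ring

/-- Both α and β carry the factor det(A)², and the adjugate of g contributes det(J)²; division by
disc(h, h)² disc(g, g) will remove these weights. -/
theorem DataLaw.secondCovector (H : DataLaw J A g h d g' h' d') (i : Fin 2) :
    secondCovector g h d i = (A.det ^ 2) ^ 2 * J.det ^ 2 *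
      (J 0 i * secondCovector g' h' d' 0 + J 1 i * secondCovector g' h' d' 1) := by
  have hg : ∀ k l, g s(k, l) = ∑ i, ∑ j, J i k * J j l * g' s(i, j) := by
    intro k l
    rw [H.metric, congrForm_mk]
  simp only [_root_.secondCovector, H.discPair_deriv_deriv, H.discPair_form_deriv, hg,
    Fin.sum_univ_two, swap_eq, Matrix.det_fin_two J]
  generalize A.det ^ 2 = δ
  rw [discPair_comm (d' 1) (d' 0)]
  generalize discPair (d' 0) (d' 0) = β₀
  generalize discPair (d' 0) (d' 1) = β₁
  generalize discPair (d' 1) (d' 1) = β₂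
  generalize discPair h' (d' 0) = α₀
  generalize discPair h' (d' 1) = α₁
  ring

theorem DataLaw.tripleDet (H : DataLaw J A g h d g' h' d') :
    tripleDet h (d 0) (d 1) = A.det ^ 3 * J.det * tripleDet h' (d' 0) (d' 1) := by
  rw [H.form, H.deriv, H.deriv, tripleDet_add_smul, tripleDet_congrForm, Matrix.det_fin_two J]
  ring

theorem DataLaw.generic (H : DataLaw J A g h d g' h' d') (hJ : J.det ≠ 0) (hA : A.det ≠ 0)
    (hG : GenericData g' h' d') : GenericData g h d where
  metric := by
    rw [H.discPair_metric]
    exact mul_ne_zero (pow_ne_zero _ hJ) hG.metric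
  form := by
    rw [H.discPair_form]
    exact mul_ne_zero (pow_ne_zero _ hA) hG.form
  triple := by
    rw [H.tripleDet]
    exact mul_ne_zero (mul_ne_zero (pow_ne_zero _ hA) hJ) hG.triple
  frame := by
    have h1 : discPair h (d 0) * _root_.secondCovector g h d 1 -
        discPair h (d 1) * _root_.secondCovector g h d 0 =
        (A.det ^ 2) ^ 3 * J.det ^ 3 * (discPair h' (d' 0) * _root_.secondCovector g' h' d' 1 -
          discPair h' (d' 1) * _root_.secondCovector g' h' d' 0) := by
      rw [H.secondCovector, H.secondCovector, H.discPair_form_deriv, H.discPair_form_deriv]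
      rw [show J.det ^ 3 = J.det ^ 2 * (J 0 0 * J 1 1 - J 0 1 * J 1 0) by
        rw [← Matrix.det_fin_two]; ring]
      ring
    rw [h1]
    exact mul_ne_zero (mul_ne_zero (pow_ne_zero _ (pow_ne_zero _ hA)) (pow_ne_zero _ hJ)) hG.frame

variable {r : ℕ}

noncomputable def gAt (θ : JetFibre r) : SymForm := (polySec θ 0).1

noncomputable def hAt (θ : JetFibre r) : SymForm := (polySec θ 0).2

/-- Reading the derivative off the polynomial section avoids an index of order one, which is absent
when r = 0; the value is then 0, and statements on first order data assume 1 ≤ r. -/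
noncomputable def dAt (θ : JetFibre r) (i : Fin 2) : SymForm := (pd i (polySec θ) 0).2

/-- The generic jet fibres. -/
def Generic (θ : JetFibre r) : Prop := GenericData (gAt θ) (hAt θ) (dAt θ)

theorem contDiff_polySec_param : ContDiff ℝ ∞ fun q : JetFibre r × Base => polySec q.1 q.2 :=
  contDiff_polyMap_param _ contDiff_fst contDiff_snd

theorem contDiff_gAt (s : Sym2 (Fin 2)) : ContDiff ℝ ∞ fun θ : JetFibre r => gAt θ s :=
  (gComp s).contDiff.comp (contDiff_mpd_const contDiff_polySec_param 0 0 0)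

theorem contDiff_hAt (s : Sym2 (Fin 2)) : ContDiff ℝ ∞ fun θ : JetFibre r => hAt θ s :=
  (hComp s).contDiff.comp (contDiff_mpd_const contDiff_polySec_param 0 0 0)

theorem contDiff_dAt (i : Fin 2) (s : Sym2 (Fin 2)) :
    ContDiff ℝ ∞ fun θ : JetFibre r => dAt θ i s := by
  fin_cases i
  · exact (hComp s).contDiff.comp (contDiff_mpd_const contDiff_polySec_param 1 0 0)
  · exact (hComp s).contDiff.comp (contDiff_mpd_const contDiff_polySec_param 0 1 0)

theorem contDiff_discPair {E : Type*} [NormedAddCommGroup E] [NormedSpace ℝ E] {b c : E → SymForm}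
    (hb : ∀ s, ContDiff ℝ ∞ fun x => b x s) (hc : ∀ s, ContDiff ℝ ∞ fun x => c x s) :
    ContDiff ℝ ∞ fun x => discPair (b x) (c x) := by
  unfold discPair
  exact (((hb _).mul (hc _)).add ((hb _).mul (hc _))).sub (contDiff_const.mul ((hb _).mul (hc _)))

theorem contDiff_discPair_hh : ContDiff ℝ ∞ fun θ : JetFibre r => discPair (hAt θ) (hAt θ) :=
  contDiff_discPair contDiff_hAt contDiff_hAt

theorem contDiff_discPair_gg : ContDiff ℝ ∞ fun θ : JetFibre r => discPair (gAt θ) (gAt θ) :=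
  contDiff_discPair contDiff_gAt contDiff_gAt

theorem contDiff_discPair_hd (i : Fin 2) :
    ContDiff ℝ ∞ fun θ : JetFibre r => discPair (hAt θ) (dAt θ i) :=
  contDiff_discPair contDiff_hAt (contDiff_dAt i)

theorem contDiff_secondCovector (i : Fin 2) :
    ContDiff ℝ ∞ fun θ : JetFibre r => secondCovector (gAt θ) (hAt θ) (dAt θ) i := by
  unfold secondCovector
  have hb := fun i j => contDiff_discPair (contDiff_dAt (r := r) i) (contDiff_dAt (r := r) j)
  exact ((hb _ _).mul (((contDiff_gAt _).mul (contDiff_discPair_hd _)).sub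
    ((contDiff_gAt _).mul (contDiff_discPair_hd _)))).add
    ((hb _ _).mul (((contDiff_gAt _).mul (contDiff_discPair_hd _)).sub
    ((contDiff_gAt _).mul (contDiff_discPair_hd _))))

theorem contDiff_tripleDet :
    ContDiff ℝ ∞ fun θ : JetFibre r => tripleDet (hAt θ) (dAt θ 0) (dAt θ 1) := by
  unfold tripleDet
  have h1 := fun s => contDiff_hAt (r := r) s
  have h2 := fun i s => contDiff_dAt (r := r) i s
  exact (((h1 _).mul (((h2 _ _).mul (h2 _ _)).sub ((h2 _ _).mul (h2 _ _)))).sub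
    ((h1 _).mul (((h2 _ _).mul (h2 _ _)).sub ((h2 _ _).mul (h2 _ _))))).add
    ((h1 _).mul (((h2 _ _).mul (h2 _ _)).sub ((h2 _ _).mul (h2 _ _))))

theorem isOpen_generic : IsOpen {θ : JetFibre r | Generic θ} := by
  have : {θ : JetFibre r | Generic θ} = {θ | discPair (gAt θ) (gAt θ) ≠ 0} ∩
      {θ | discPair (hAt θ) (hAt θ) ≠ 0} ∩ {θ | tripleDet (hAt θ) (dAt θ 0) (dAt θ 1) ≠ 0} ∩
      {θ | discPair (hAt θ) (dAt θ 0) * secondCovector (gAt θ) (hAt θ) (dAt θ) 1 -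
        discPair (hAt θ) (dAt θ 1) * secondCovector (gAt θ) (hAt θ) (dAt θ) 0 ≠ 0} := by
    ext θ
    exact ⟨fun h => ⟨⟨⟨h.1, h.2⟩, h.3⟩, h.4⟩, fun h => ⟨h.1.1.1, h.1.1.2, h.1.2, h.2⟩⟩
  rw [this]
  refine (((isOpen_ne.preimage contDiff_discPair_gg.continuous).inter
    (isOpen_ne.preimage contDiff_discPair_hh.continuous)).inter
    (isOpen_ne.preimage contDiff_tripleDet.continuous)).inter (isOpen_ne.preimage ?_)
  exact (((contDiff_discPair_hd 0).mul (contDiff_secondCovector 1)).sub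
    ((contDiff_discPair_hd 1).mul (contDiff_secondCovector 0))).continuous

theorem mpd_polySec (θ : JetFibre r) (τ : Base → Fibre) (h : jetAt r τ 0 = θ) {a b : ℕ}
    (hab : a + b ≤ r) : mpd a b (polySec θ) 0 = mpd a b τ 0 := by
  obtain ⟨J, hJ⟩ := exists_idxPair hab
  have h1 := congrFun (h.trans (jetAt_polySec θ).symm) J
  simp only [idxPair, Prod.mk.injEq] at hJ
  simp only [jetAt, hJ.1, hJ.2] at h1
  exact h1.symm

/-- Congruence by a matrix as a continuous linear map on the second forms. -/
noncomputable def congrSnd (A : Matrix (Fin 2) (Fin 2) ℝ) : Fibre →L[ℝ] SymForm :=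
  LinearMap.toContinuousLinearMap
    { toFun := fun v => congrForm A v.2
      map_add' := fun v w => by simpa using congrForm_add_smul A v.2 w.2 1 1
      map_smul' := fun c v => by simpa using congrForm_add_smul A v.2 v.2 c 0 }

theorem congrSnd_apply (A : Matrix (Fin 2) (Fin 2) ℝ) (v : Fibre) :
    congrSnd A v = congrForm A v.2 := rfl

theorem dataLaw_act_zero (m : Param r) (θ : JetFibre r) :
    gAt (act m θ) = congrForm (jacobian (paramMap m) 0) (gAt θ) ∧
      hAt (act m θ) = congrForm (paramMatrix m) (hAt θ) := by
  have h0 : polySec (act m θ) 0 = tS (paramMap m) (paramMatrix m) (polySec θ) 0 :=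
    mpd_polySec (act m θ) _ rfl (a := 0) (b := 0) (by omega)
  constructor
  · rw [gAt, h0, tS, paramMap_zero]
    rfl
  · rw [hAt, h0, tS, paramMap_zero]
    rfl

theorem dataLaw_act (hr : 1 ≤ r) (m : Param r) (θ : JetFibre r) :
    DataLaw (jacobian (paramMap m) 0) (paramMatrix m) (gAt (act m θ)) (hAt (act m θ))
      (dAt (act m θ)) (gAt θ) (hAt θ) (dAt θ) where
  metric := (dataLaw_act_zero m θ).1
  form := (dataLaw_act_zero m θ).2
  deriv i := by
    set τ := tS (paramMap m) (paramMatrix m) (polySec θ) with hτ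
    have sM := contDiff_paramMap m
    have sσ := contDiff_polySec θ
    have sτ : ContDiffAt ℝ ∞ τ 0 := contDiffAt_tS sM.contDiffAt sσ.contDiffAt
    have h1 : pd i (polySec (act m θ)) 0 = pd i τ 0 := by
      fin_cases i
      · exact mpd_polySec (act m θ) τ rfl (a := 1) (b := 0) (by omega)
      · exact mpd_polySec (act m θ) τ rfl (a := 0) (b := 1) (by omega)
    have h2 := (pd_clm (ContinuousLinearMap.snd ℝ SymForm SymForm) sτ i).self_of_nhds
    have h3 := (pd_clm (congrSnd (paramMatrix m)) (sσ.comp sM).contDiffAt (t := 0) i).self_of_nhds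
    have h4 := (pd_comp (t := 0) (sσ.contDiffAt (x := paramMap m 0)) sM.contDiffAt
      i).self_of_nhds
    have h5 : (fun y => ContinuousLinearMap.snd ℝ SymForm SymForm (τ y)) =
        fun y => congrSnd (paramMatrix m) ((polySec θ ∘ paramMap m) y) := rfl
    have h6 : ∀ s, pd i (fun z => paramMap m z s) 0 = jacobian (paramMap m) 0 s i := fun s =>
      (pd_coord sM.contDiffAt i s).self_of_nhds.symm
    rw [h5] at h2
    have h7 := h2.symm.trans h3
    simp only [Function.comp_def, h4, h6, paramMap_zero, Fin.sum_univ_two, congrSnd_apply,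
      ContinuousLinearMap.coe_snd', ← h1] at h7
    simp only [dAt, ← congrForm_add_smul]
    exact h7

theorem JetRel.generic (hr : 1 ≤ r) {θ θ' : JetFibre r} (h : JetRel θ θ') (hG : Generic θ') :
    Generic θ := by
  obtain ⟨m, hJ, hA, rfl⟩ := h
  exact (dataLaw_act hr m θ').generic hJ hA hG

end FirstOrder

/-! ### Asymptotic control of the Jacobian and of the matrix. -/

section Asymptotic

variable {ι : Type*} {l : Filter ι} {e : ι → ℝ}

/-- The bounded families of numbers. -/
def bigO (l : Filter ι) : AddSubgroup (ι → ℝ) where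
  carrier := {f | f =O[l] fun _ => (1 : ℝ)}
  add_mem' h h' := h.add h'
  zero_mem' := isBigO_zero _ _
  neg_mem' h := h.neg_left

/-- The families of numbers negligible with respect to `e`. -/
def littleO (l : Filter ι) (e : ι → ℝ) : AddSubgroup (ι → ℝ) where
  carrier := {f | f =o[l] e}
  add_mem' h h' := h.add h'
  zero_mem' := isLittleO_zero _ _
  neg_mem' h := h.neg_left

theorem mem_bigO {f : ι → ℝ} : f ∈ bigO l ↔ f =O[l] fun _ => (1 : ℝ) := Iff.rfl

theorem mem_littleO {f : ι → ℝ} : f ∈ littleO l e ↔ f =o[l] e := Iff.rfl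

theorem idealPair_asymptotic (he : e =O[l] fun _ => (1 : ℝ)) :
    IdealPair (bigO l) (littleO l e) where
  le _ h := (mem_littleO.1 h).isBigO.trans he
  one := isBigO_refl _ _
  mul_base h h' := by simpa only [mem_bigO, mul_one] using (mem_bigO.1 h).mul (mem_bigO.1 h')
  mul h h' := by
    simpa only [mem_littleO, one_mul] using (mem_bigO.1 h).mul_isLittleO (mem_littleO.1 h')

theorem const_mem_bigO (c : ℝ) : (fun _ => c) ∈ bigO l := isBigO_const_const c one_ne_zero l

theorem Filter.Tendsto.mem_bigO {f : ι → ℝ} {c : ℝ} (h : Tendsto f l (𝓝 c)) : f ∈ bigO l :=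
  h.isBigO_one ℝ

theorem tendsto_of_sub_mem (he : e =O[l] fun _ => (1 : ℝ)) {f g : ι → ℝ} {c : ℝ}
    (h : (fun n => f n - g n) ∈ littleO l e) (hg : Tendsto g l (𝓝 c)) : Tendsto f l (𝓝 c) := by
  have h1 : Tendsto (fun n => f n - g n) l (𝓝 0) :=
    (isLittleO_one_iff ℝ).1 ((mem_littleO.1 h).trans_isBigO he)
  simpa using h1.add hg

theorem mem_littleO_of_mul {D u : ι → ℝ} {c : ℝ} (hD : Tendsto D l (𝓝 c)) (hc : c ≠ 0)
    (h : (fun n => D n * u n) ∈ littleO l e) : u ∈ littleO l e := by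
  have h1 := ((hD.inv₀ hc).isBigO_one ℝ).mul_isLittleO (mem_littleO.1 h)
  refine mem_littleO.2 (IsLittleO.congr' h1 ?_ (Eventually.of_forall fun n => one_mul _))
  filter_upwards [hD.eventually_ne hc] with n hn
  field_simp

theorem mem_bigO_of_mul {D u : ι → ℝ} {c : ℝ} (hD : Tendsto D l (𝓝 c)) (hc : c ≠ 0)
    (h : (fun n => D n * u n) ∈ bigO l) : u ∈ bigO l := by
  have h1 := ((hD.inv₀ hc).isBigO_one ℝ).mul (mem_bigO.1 h)
  refine mem_bigO.2 (IsBigO.congr' h1 ?_ (Eventually.of_forall fun n => one_mul _))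
  filter_upwards [hD.eventually_ne hc] with n hn
  field_simp

theorem mem_littleO_congr {u v : ι → ℝ} (h : u ∈ littleO l e) (huv : ∀ᶠ n in l, u n = v n) :
    v ∈ littleO l e :=
  mem_littleO.2 (IsLittleO.congr' (mem_littleO.1 h) huv EventuallyEq.rfl)

theorem sub_mem_littleO {E : Type*} [NormedAddCommGroup E] [NormedSpace ℝ E] {F : E → ℝ}
    {x y : ι → E} {c : E} (hF : ContDiffAt ℝ ∞ F c) (hx : Tendsto x l (𝓝 c))
    (hy : Tendsto y l (𝓝 c)) (hxy : (fun n => x n - y n) =o[l] e) :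
    (fun n => F (x n) - F (y n)) ∈ littleO l e := by
  have h1 := (hF.hasStrictFDerivAt (by simp)).isBigO_sub
  have h2 : Tendsto (fun n => (x n, y n)) l (𝓝 (c, c)) := hx.prodMk_nhds hy
  exact (h1.comp_tendsto h2).trans_isLittleO hxy

variable {r : ℕ} {θ θ' : ι → JetFibre r} {θ₀ : JetFibre r} {m : ι → Param r}

/-- Convergent families of related jets, close to each other at the rate `e`. -/
structure NearbyJets (l : Filter ι) (e : ι → ℝ) (θ₀ : JetFibre r) (θ θ' : ι → JetFibre r)
    (m : ι → Param r) : Prop where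
  one_le : 1 ≤ r
  gauge : e =O[l] fun _ => (1 : ℝ)
  generic : Generic θ₀
  act : ∀ n, act (m n) (θ' n) = θ n
  tendsto_left : Tendsto θ l (𝓝 θ₀)
  tendsto_right : Tendsto θ' l (𝓝 θ₀)
  sub : (fun n => θ n - θ' n) =o[l] e
  nonneg : ∀ n, 0 ≤ paramMatrix (m n) 0 0

namespace NearbyJets

variable (H : NearbyJets l e θ₀ θ θ' m)

include H

theorem law (n : ι) : DataLaw (jacobian (paramMap (m n)) 0) (paramMatrix (m n)) (gAt (θ n))
    (hAt (θ n)) (dAt (θ n)) (gAt (θ' n)) (hAt (θ' n)) (dAt (θ' n)) := by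
  have := dataLaw_act H.one_le (m n) (θ' n)
  rwa [H.act n] at this

theorem pair : IdealPair (bigO l) (littleO l e) := idealPair_asymptotic H.gauge

theorem eventually_generic : ∀ᶠ n in l, Generic (θ n) ∧ Generic (θ' n) :=
  (H.tendsto_left.eventually (isOpen_generic.mem_nhds H.generic)).and
    (H.tendsto_right.eventually (isOpen_generic.mem_nhds H.generic))

theorem tendsto_comp {F : JetFibre r → ℝ} (hF : ContDiffAt ℝ ∞ F θ₀) :
    Tendsto (fun n => F (θ' n)) l (𝓝 (F θ₀)) := hF.continuousAt.tendsto.comp H.tendsto_right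

/-- The weight-free covectors α and γ satisfy α(θ) = Jᵀ α(θ') and γ(θ) = Jᵀ γ(θ'). As α and γ are
smooth near θ₀, the vectors (Jᵀ - 1)α(θ') and (Jᵀ - 1)γ(θ') are o(e); the covectors being
independent in the limit, J - 1 is o(e). -/
theorem jacobian_sub_one (s i : Fin 2) :
    (fun n => jacobian (paramMap (m n)) 0 s i - (1 : Matrix (Fin 2) (Fin 2) ℝ) s i) ∈
      littleO l e := by
  have hb0 : discPair (hAt θ₀) (hAt θ₀) ≠ 0 := H.generic.form
  have hg0 : discPair (gAt θ₀) (gAt θ₀) ≠ 0 := H.generic.metric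
  let α : Fin 2 → JetFibre r → ℝ := fun i θ =>
    discPair (hAt θ) (dAt θ i) * (discPair (hAt θ) (hAt θ))⁻¹
  let γ : Fin 2 → JetFibre r → ℝ := fun i θ => secondCovector (gAt θ) (hAt θ) (dAt θ) i *
    ((discPair (hAt θ) (hAt θ)) ^ 2 * discPair (gAt θ) (gAt θ))⁻¹
  have cα : ∀ i, ContDiffAt ℝ ∞ (α i) θ₀ := fun i =>
    (contDiff_discPair_hd i).contDiffAt.mul (contDiff_discPair_hh.contDiffAt.inv hb0)
  have cγ : ∀ i, ContDiffAt ℝ ∞ (γ i) θ₀ := fun i =>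
    (contDiff_secondCovector i).contDiffAt.mul (((contDiff_discPair_hh.contDiffAt.pow 2).mul
      contDiff_discPair_gg.contDiffAt).inv (mul_ne_zero (pow_ne_zero _ hb0) hg0))
  have lα : ∀ᶠ n in l, ∀ i, α i (θ n) = jacobian (paramMap (m n)) 0 0 i * α 0 (θ' n) +
      jacobian (paramMap (m n)) 0 1 i * α 1 (θ' n) := by
    filter_upwards [H.eventually_generic] with n hn i
    have h1 := hn.1.form
    have h2 := hn.2.form
    have hl := (H.law n).discPair_form
    have hA : (paramMatrix (m n)).det ≠ 0 := by
      intro h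
      rw [hl, h] at h1
      simp at h1
    simp only [α, (H.law n).discPair_form_deriv, hl]
    field_simp
  have lγ : ∀ᶠ n in l, ∀ i, γ i (θ n) = jacobian (paramMap (m n)) 0 0 i * γ 0 (θ' n) +
      jacobian (paramMap (m n)) 0 1 i * γ 1 (θ' n) := by
    filter_upwards [H.eventually_generic] with n hn i
    have h1 := hn.1.form
    have h2 := hn.2.form
    have h3 := hn.1.metric
    have h4 := hn.2.metric
    have hl := (H.law n).discPair_form
    have hl' := (H.law n).discPair_metric
    have hA : (paramMatrix (m n)).det ≠ 0 := by
      intro h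
      rw [hl, h] at h1
      simp at h1
    have hJ : (jacobian (paramMap (m n)) 0).det ≠ 0 := by
      intro h
      rw [hl', h] at h3
      simp at h3
    simp only [γ, (H.law n).secondCovector, hl, hl']
    field_simp
  have hdet : α 0 θ₀ * γ 1 θ₀ - α 1 θ₀ * γ 0 θ₀ ≠ 0 := by
    have h : α 0 θ₀ * γ 1 θ₀ - α 1 θ₀ * γ 0 θ₀ = (discPair (hAt θ₀) (dAt θ₀ 0) *
        secondCovector (gAt θ₀) (hAt θ₀) (dAt θ₀) 1 - discPair (hAt θ₀) (dAt θ₀ 1) *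
        secondCovector (gAt θ₀) (hAt θ₀) (dAt θ₀) 0) * ((discPair (hAt θ₀) (hAt θ₀))⁻¹ *
        ((discPair (hAt θ₀) (hAt θ₀)) ^ 2 * discPair (gAt θ₀) (gAt θ₀))⁻¹) := by
      simp only [α, γ]
      ring
    rw [h]
    exact mul_ne_zero H.generic.frame (mul_ne_zero (inv_ne_zero hb0)
      (inv_ne_zero (mul_ne_zero (pow_ne_zero _ hb0) hg0)))
  have tα := fun i => H.tendsto_comp (cα i)
  have tγ := fun i => H.tendsto_comp (cγ i)
  have dα := fun i => sub_mem_littleO (cα i) H.tendsto_left H.tendsto_right H.sub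
  have dγ := fun i => sub_mem_littleO (cγ i) H.tendsto_left H.tendsto_right H.sub
  have tdet := ((tα 0).mul (tγ 1)).sub ((tα 1).mul (tγ 0))
  -- Cramer's rule for the 2 × 2 system with rows α(θ') and γ(θ').
  refine mem_littleO_of_mul tdet hdet ?_
  fin_cases s
  · refine mem_littleO_congr ((littleO l e).sub_mem (H.pair.mul (tγ 1).mem_bigO (dα i))
      (H.pair.mul (tα 1).mem_bigO (dγ i))) ?_
    filter_upwards [lα, lγ] with n h1 h2
    simp only [Pi.sub_apply, h1 i, h2 i]
    fin_cases i <;> simp <;> ring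
  · refine mem_littleO_congr ((littleO l e).sub_mem (H.pair.mul (tα 0).mem_bigO (dγ i))
      (H.pair.mul (tγ 0).mem_bigO (dα i))) ?_
    filter_upwards [lα, lγ] with n h1 h2
    simp only [Pi.sub_apply, h1 i, h2 i]
    fin_cases i <;> simp <;> ring

theorem jacobian_tendsto (s i : Fin 2) : Tendsto (fun n => jacobian (paramMap (m n)) 0 s i) l
    (𝓝 ((1 : Matrix (Fin 2) (Fin 2) ℝ) s i)) :=
  tendsto_of_sub_mem H.gauge (H.jacobian_sub_one s i) tendsto_const_nhds

/-- No bound on the matrix is known yet. The forms A·∂h(θ') are bounded because they arise from the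
convergent ∂h(θ) by inverting the Jacobian, which tends to 1. -/
theorem congr_deriv_mem_bigO (s : Fin 2) (w : Sym2 (Fin 2)) :
    (fun n => congrForm (paramMatrix (m n)) (dAt (θ' n) s) w) ∈ bigO l := by
  have t := H.jacobian_tendsto
  have tdet := ((t 0 0).mul (t 1 1)).sub ((t 0 1).mul (t 1 0))
  have hd : ∀ i, (fun n => dAt (θ n) i w) ∈ bigO l := fun i =>
    ((contDiff_dAt i w).continuous.continuousAt.tendsto.comp H.tendsto_left).mem_bigO
  refine mem_bigO_of_mul tdet (by simp) ?_
  have hl := fun n i => congrFun ((H.law n).deriv i) w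
  simp only [Pi.add_apply, Pi.smul_apply, smul_eq_mul] at hl
  fin_cases s
  · convert (bigO l).sub_mem (H.pair.mul_base (t 1 1).mem_bigO (hd 0))
      (H.pair.mul_base (t 1 0).mem_bigO (hd 1)) using 1
    funext n
    simp only [Pi.sub_apply, hl]
    simp
    ring
  · convert (bigO l).sub_mem (H.pair.mul_base (t 0 0).mem_bigO (hd 1))
      (H.pair.mul_base (t 0 1).mem_bigO (hd 0)) using 1
    funext n
    simp only [Pi.sub_apply, hl]
    simp
    ring

theorem congr_deriv_sub (i : Fin 2) (w : Sym2 (Fin 2)) :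
    (fun n => congrForm (paramMatrix (m n)) (dAt (θ' n) i) w - dAt (θ' n) i w) ∈ littleO l e := by
  have h1 := sub_mem_littleO (contDiff_dAt i w).contDiffAt H.tendsto_left H.tendsto_right H.sub
  have h2 := fun s => H.pair.mul (H.congr_deriv_mem_bigO s w) (H.jacobian_sub_one s i)
  convert (littleO l e).sub_mem h1 ((littleO l e).add_mem (h2 0) (h2 1)) using 1
  funext n
  have hl := congrFun ((H.law n).deriv i) w
  simp only [Pi.add_apply, Pi.smul_apply, smul_eq_mul] at hl
  simp only [Pi.sub_apply, Pi.add_apply, hl]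
  obtain rfl | rfl : i = 0 ∨ i = 1 := by fin_cases i <;> simp
  all_goals simp; ring

theorem congr_form_sub (w : Sym2 (Fin 2)) :
    (fun n => congrForm (paramMatrix (m n)) (hAt (θ' n)) w - hAt (θ' n) w) ∈ littleO l e := by
  simp only [← (H.law _).form]
  exact sub_mem_littleO (contDiff_hAt w).contDiffAt H.tendsto_left H.tendsto_right H.sub

/-- The action of A on forms is linear and nearly fixes h, ∂₁h, ∂₂h; these form a basis in the
limit, in which v is expanded by Cramer's rule. -/
theorem congr_sub (v : SymForm) (w : Sym2 (Fin 2)) :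
    (fun n => congrForm (paramMatrix (m n)) v w - v w) ∈ littleO l e := by
  have th := fun w => H.tendsto_comp (contDiff_hAt w).contDiffAt
  have td := fun i w => H.tendsto_comp (contDiff_dAt i w).contDiffAt
  have tc := fun w : Sym2 (Fin 2) => (tendsto_const_nhds : Tendsto (fun _ : ι => v w) l (𝓝 (v w)))
  have tdet : ∀ {a b c : ι → SymForm} {a₀ b₀ c₀ : SymForm},
      (∀ w, Tendsto (fun n => a n w) l (𝓝 (a₀ w))) → (∀ w, Tendsto (fun n => b n w) l (𝓝 (b₀ w))) →
      (∀ w, Tendsto (fun n => c n w) l (𝓝 (c₀ w))) →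
      Tendsto (fun n => tripleDet (a n) (b n) (c n)) l (𝓝 (tripleDet a₀ b₀ c₀)) := by
    intro a b c a₀ b₀ c₀ ha hb hc
    exact (((ha _).mul (((hb _).mul (hc _)).sub ((hb _).mul (hc _)))).sub
      ((ha _).mul (((hb _).mul (hc _)).sub ((hb _).mul (hc _))))).add
      ((ha _).mul (((hb _).mul (hc _)).sub ((hb _).mul (hc _))))
  refine mem_littleO_of_mul (tdet th (td 0) (td 1)) H.generic.triple ?_
  have k1 := H.pair.mul (tdet tc (td 0) (td 1)).mem_bigO (H.congr_form_sub w)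
  have k2 := H.pair.mul (tdet th tc (td 1)).mem_bigO (H.congr_deriv_sub 0 w)
  have k3 := H.pair.mul (tdet th (td 0) tc).mem_bigO (H.congr_deriv_sub 1 w)
  convert (littleO l e).add_mem ((littleO l e).add_mem k1 k2) k3 using 1
  funext n
  have e1 := tripleDet_cramer (hAt (θ' n)) (dAt (θ' n) 0) (dAt (θ' n) 1) v
  have e2 : tripleDet (hAt (θ' n)) (dAt (θ' n) 0) (dAt (θ' n) 1) •
      congrForm (paramMatrix (m n)) v =
      tripleDet v (dAt (θ' n) 0) (dAt (θ' n) 1) • congrForm (paramMatrix (m n)) (hAt (θ' n)) +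
      (tripleDet (hAt (θ' n)) v (dAt (θ' n) 1) • congrForm (paramMatrix (m n)) (dAt (θ' n) 0) +
      tripleDet (hAt (θ' n)) (dAt (θ' n) 0) v • congrForm (paramMatrix (m n)) (dAt (θ' n) 1)) := by
    have e3 : tripleDet (hAt (θ' n)) (dAt (θ' n) 0) (dAt (θ' n) 1) • v =
        tripleDet v (dAt (θ' n) 0) (dAt (θ' n) 1) • hAt (θ' n) +
        (1 : ℝ) • (tripleDet (hAt (θ' n)) v (dAt (θ' n) 1) • dAt (θ' n) 0 +
          tripleDet (hAt (θ' n)) (dAt (θ' n) 0) v • dAt (θ' n) 1) := by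
      funext s
      simp only [Pi.add_apply, Pi.smul_apply, smul_eq_mul, e1]
      ring
    have e4 := congrArg (congrForm (paramMatrix (m n))) e3
    rw [congrForm_add_smul, congrForm_add_smul, one_smul] at e4
    rw [← e4]
    simpa using (congrForm_add_smul (paramMatrix (m n)) v 0
      (tripleDet (hAt (θ' n)) (dAt (θ' n) 0) (dAt (θ' n) 1)) 0).symm
  have e5 := congrFun e2 w
  simp only [Pi.add_apply, Pi.smul_apply, smul_eq_mul] at e5
  simp only [Pi.add_apply, mul_sub, e5, e1]
  ring

/-- Testing the action on two coordinate forms gives A₀₀² - 1, A₀₀A₀₁, 2A₀₀A₁₀ and A₀₀A₁₁ + A₁₀A₀₁ -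
1, all o(e). -/
theorem paramMatrix_sub_one (i k : Fin 2) :
    (fun n => paramMatrix (m n) i k - (1 : Matrix (Fin 2) (Fin 2) ℝ) i k) ∈ littleO l e := by
  let E : Sym2 (Fin 2) → SymForm := fun s => Pi.single s 1
  have hne : (s(0, 0) : Sym2 (Fin 2)) ≠ s(0, 1) := by decide
  have hne1 : (s(1, 1) : Sym2 (Fin 2)) ≠ s(0, 1) := by decide
  have hne2 : (s(0, 0) : Sym2 (Fin 2)) ≠ s(1, 1) := by decide
  have E00 := fun k l => H.congr_sub (E s(0, 0)) s(k, l)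
  have E01 := fun k l => H.congr_sub (E s(0, 1)) s(k, l)
  simp only [congrForm_mk, E, Fin.sum_univ_two, swap_eq, Pi.single_apply, hne, hne.symm, hne1,
    hne2.symm, if_true, if_false, mul_one, mul_zero, add_zero, zero_add] at E00 E01
  have sq := E00 0 0
  have h01 := E00 0 1
  have h10 := E01 0 0
  have h11 := E01 0 1
  simp only [hne, hne.symm, if_false, if_true, sub_zero] at sq h01 h10 h11
  have tsq : Tendsto (fun n => paramMatrix (m n) 0 0 * paramMatrix (m n) 0 0) l (𝓝 1) :=
    tendsto_of_sub_mem H.gauge sq tendsto_const_nhds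
  -- The sign normalization enters here: A₀₀² → 1 with A₀₀ ≥ 0 excludes the limit -1.
  have t00 : Tendsto (fun n => paramMatrix (m n) 0 0) l (𝓝 1) := by
    have := tsq.sqrt
    rw [Real.sqrt_one] at this
    refine this.congr' ?_
    exact Eventually.of_forall fun n => Real.sqrt_mul_self (H.nonneg n)
  have k00 : (fun n => paramMatrix (m n) 0 0 - 1) ∈ littleO l e := by
    refine mem_littleO_of_mul (t00.add_const 1) (by norm_num) ?_
    convert sq using 2
    ring
  have k01 : (fun n => paramMatrix (m n) 0 1) ∈ littleO l e :=
    mem_littleO_of_mul t00 one_ne_zero h01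
  have k10 : (fun n => paramMatrix (m n) 1 0) ∈ littleO l e := by
    refine mem_littleO_of_mul (t00.const_mul 2) (by norm_num) ?_
    convert h10 using 2
    ring
  have t01 : Tendsto (fun n => paramMatrix (m n) 0 1) l (𝓝 0) :=
    tendsto_of_sub_mem (g := fun _ => 0) H.gauge (by simpa using k01) tendsto_const_nhds
  have k11 : (fun n => paramMatrix (m n) 1 1 - 1) ∈ littleO l e := by
    refine mem_littleO_of_mul t00 one_ne_zero ?_
    convert (littleO l e).sub_mem ((littleO l e).sub_mem h11 (H.pair.mul t01.mem_bigO k10)) k00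
      using 1
    funext n
    simp only [Pi.sub_apply]
    ring
  fin_cases i <;> fin_cases k <;> simpa

end NearbyJets

end Asymptotic

/-! ### Jet conditions bundled with smoothness. -/

section SmoothJets

variable {ι : Type*} {b p : AddSubgroup (ι → ℝ)} {x y : ι → Base} {k : ℕ}
  {f f' g g' : ι → Base → ℝ}

/-- Smooth families satisfying `Jetwise`. -/
structure SJet (p : AddSubgroup (ι → ℝ)) (x : ι → Base) (k : ℕ) (f : ι → Base → ℝ) : Prop where
  smooth : SmoothFamily x f
  jet : Jetwise p x k f

/-- Smooth families satisfying `Close`. -/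
structure SClose (p : AddSubgroup (ι → ℝ)) (x : ι → Base) (k : ℕ) (f g : ι → Base → ℝ) :
    Prop where
  left : SmoothFamily x f
  right : SmoothFamily x g
  close : Close p x k f g

theorem SJet.add (hf : SJet p x k f) (hg : SJet p x k g) : SJet p x k fun n z => f n z + g n z :=
  ⟨hf.1.add hg.1, hf.2.add hg.2 hf.1 hg.1⟩

theorem SJet.sub (hf : SJet p x k f) (hg : SJet p x k g) : SJet p x k fun n z => f n z - g n z :=
  ⟨hf.1.sub hg.1, hf.2.sub hg.2 hf.1 hg.1⟩

theorem SJet.mul (hbp : IdealPair b p) (hf : SJet b x k f) (hg : SJet p x k g) :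
    SJet p x k fun n z => f n z * g n z :=
  ⟨hf.1.mul hg.1, hf.2.mul hbp hg.2 hf.1 hg.1⟩

theorem SJet.mul' (hbp : IdealPair b p) (hf : SJet p x k f) (hg : SJet b x k g) :
    SJet p x k fun n z => f n z * g n z :=
  ⟨hf.1.mul hg.1, hf.2.mul' hbp hg.2 hf.1 hg.1⟩

theorem SJet.const {c : ι → ℝ} (h : c ∈ p) : SJet p x k fun n _ => c n :=
  ⟨SmoothFamily.const c, Jetwise.const h⟩

theorem SJet.of_le (hf : SJet p x k f) {j : ℕ} (h : j ≤ k) : SJet p x j f :=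
  ⟨hf.1, hf.2.of_le h⟩

theorem SJet.sum {κ : Type*} {s : Finset κ} {F : κ → ι → Base → ℝ}
    (h : ∀ j ∈ s, SJet p x k (F j)) : SJet p x k fun n z => ∑ j ∈ s, F j n z :=
  ⟨SmoothFamily.sum fun j hj => (h j hj).1, Jetwise.sum (fun j hj => (h j hj).2)
    fun j hj => (h j hj).1⟩

theorem SJet.congr (hf : SJet p x k f) (h : ∀ n, f n =ᶠ[𝓝 (x n)] g n) : SJet p x k g :=
  ⟨fun n => (hf.1 n).congr_of_eventuallyEq (h n).symm, hf.2.congr h⟩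

theorem SJet.pd (hf : SJet p x (k + 1) f) (i : Fin 2) : SJet p x k fun n => pd i (f n) :=
  ⟨hf.1.pd i, hf.2.2 i⟩

theorem SClose.sub (h : SClose p x k f g) : SJet p x k fun n z => f n z - g n z :=
  ⟨h.1.sub h.2, h.3⟩

theorem SClose.of_le (h : SClose p x k f g) {j : ℕ} (hj : j ≤ k) : SClose p x j f g :=
  ⟨h.1, h.2, h.3.of_le hj⟩

theorem SClose.pd (h : SClose p x (k + 1) f g) (i : Fin 2) :
    SClose p x k (fun n => pd i (f n)) fun n => pd i (g n) :=
  ⟨h.1.pd i, h.2.pd i, h.3.pd h.1 h.2 i⟩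

theorem SClose.congr (h : SClose p x k f g) (hf : ∀ n, f n =ᶠ[𝓝 (x n)] f' n)
    (hg : ∀ n, g n =ᶠ[𝓝 (x n)] g' n) : SClose p x k f' g' :=
  ⟨fun n => (h.1 n).congr_of_eventuallyEq (hf n).symm,
    fun n => (h.2 n).congr_of_eventuallyEq (hg n).symm, h.3.congr hf hg⟩

theorem SClose.sum {κ : Type*} {s : Finset κ} {F G : κ → ι → Base → ℝ}
    (h : ∀ j ∈ s, SClose p x k (F j) (G j)) :
    SClose p x k (fun n z => ∑ j ∈ s, F j n z) fun n z => ∑ j ∈ s, G j n z :=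
  ⟨SmoothFamily.sum fun j hj => (h j hj).1, SmoothFamily.sum fun j hj => (h j hj).2,
    Close.sum (fun j hj => (h j hj).3) (fun j hj => (h j hj).1) fun j hj => (h j hj).2⟩

/-- The family `f` is bounded when `g` is. -/
theorem SClose.bounded (hbp : IdealPair b p) (h : SClose p x k f g) (hg : SJet b x k g) :
    SJet b x k f :=
  ⟨h.1, by
    have := (h.sub.2.mono hbp.le).add hg.2 h.sub.1 hg.1
    simpa using this⟩

theorem SClose.mul (hbp : IdealPair b p) (hf : SClose p x k f f') (hg : SClose p x k g g')
    (bf : SJet b x k f') (bg : SJet b x k g') :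
    SClose p x k (fun n z => f n z * g n z) fun n z => f' n z * g' n z :=
  ⟨hf.1.mul hg.1, hf.2.mul hg.2, hf.3.mul hbp hg.3 (hf.bounded hbp bf).2 bg.2 hf.1 hf.2 hg.1 hg.2⟩

theorem jetwise_bigO_const {l : Filter ι} (t : Base) (f : Base → ℝ) :
    Jetwise (bigO l) (fun _ => t) k fun _ => f := by
  induction k generalizing f with
  | zero => trivial
  | succ k ih => exact ⟨const_mem_bigO _, fun i => ih _⟩

theorem pd_apply_coord (i s : Fin 2) :
    pd i (fun z : Base => z s) = fun _ => (1 : Matrix (Fin 2) (Fin 2) ℝ) s i := by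
  funext z
  have h1 : HasFDerivAt (fun z : Base => z s)
      (ContinuousLinearMap.proj (R := ℝ) (φ := fun _ : Fin 2 => ℝ) s) z := hasFDerivAt_apply s z
  simp [pd, h1.fderiv, Matrix.one_apply, Pi.single_apply]

end SmoothJets

/-! ### Asymptotic control of all derivatives of the map. -/

section Separation

variable {ι : Type*} {l : Filter ι} {e : ι → ℝ} {r : ℕ} {θ θ' : ι → JetFibre r}
  {θ₀ : JetFibre r} {m : ι → Param r}

namespace NearbyJets

variable (H : NearbyJets l e θ₀ θ θ' m)

include H

theorem sjet_section (L : Fibre →L[ℝ] ℝ) :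
    SJet (bigO l) (fun _ => 0) (r + 1) fun n z => L (polySec (θ' n) z) := by
  have s : SmoothFamily (fun _ => 0) fun n z => L (polySec (θ' n) z) := fun _ =>
    (L.contDiff.comp (contDiff_polySec _)).contDiffAt
  refine ⟨s, (jetwise_iff_mpd s).2 fun a b hab => ?_⟩
  obtain ⟨J, hJ⟩ := exists_idxPair (r := r) (a := a) (b := b) (by omega)
  have h1 : ∀ n, mpd a b (fun z => L (polySec (θ' n) z)) 0 = L (θ' n J) := by
    intro n
    rw [(mpd_clm L (contDiff_polySec (θ' n)).contDiffAt a b).self_of_nhds]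
    have := mpd_polyMap idxPair_injective (θ' n) J
    rw [hJ] at this
    exact congrArg L this
  simp only [h1]
  have h2 : Continuous fun η : JetFibre r => L (η J) := L.continuous.comp (continuous_apply J)
  exact (h2.continuousAt.tendsto.comp H.tendsto_right).mem_bigO

theorem sjet_deriv_section (L : Fibre →L[ℝ] ℝ) (i : Fin 2) :
    SJet (bigO l) (fun _ => 0) r fun n z => L (pd i (polySec (θ' n)) z) :=
  ((H.sjet_section L).pd i).congr fun _ => pd_clm L (contDiff_polySec _).contDiffAt i

omit H in
theorem smooth_transform (L : Fibre →L[ℝ] ℝ) : SmoothFamily (fun _ => 0) fun n z =>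
    L (tS (paramMap (m n)) (paramMatrix (m n)) (polySec (θ' n)) z) := fun _ =>
  L.contDiff.contDiffAt.comp 0 (contDiffAt_tS (contDiff_paramMap _).contDiffAt
    (contDiff_polySec _).contDiffAt)

theorem close_transform (L : Fibre →L[ℝ] ℝ) : SClose (littleO l e) (fun _ => 0) (r + 1)
    (fun n z => L (tS (paramMap (m n)) (paramMatrix (m n)) (polySec (θ' n)) z))
    fun n z => L (polySec (θ' n) z) := by
  refine ⟨smooth_transform L, (H.sjet_section L).1, ?_⟩
  refine (close_comp_iff (fun n => contDiffAt_tS (contDiff_paramMap _).contDiffAt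
    (contDiff_polySec _).contDiffAt) fun n => (contDiff_polySec _).contDiffAt).2 fun J => ?_
  have h1 : ∀ n, jetAt r (tS (paramMap (m n)) (paramMatrix (m n)) (polySec (θ' n))) 0 = θ n :=
    H.act
  simp only [h1, jetAt_polySec]
  have h2 : ContDiff ℝ ∞ fun η : JetFibre r => L (η J) := L.contDiff.comp (contDiff_apply ℝ Fibre J)
  exact sub_mem_littleO (F := fun η : JetFibre r => L (η J)) h2.contDiffAt H.tendsto_left H.tendsto_right H.sub

omit H in
theorem smooth_map : SmoothFamily (fun _ => 0) fun n => paramMap (m n) :=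
  fun n => (contDiff_paramMap (m n)).contDiffAt

omit H in
theorem sjet_coord {k : ℕ} (s : Fin 2) : SJet (bigO l) (fun _ => 0) k fun _ z => z s :=
  ⟨fun _ => contDiffAt_pi.1 contDiffAt_id s, jetwise_bigO_const 0 fun z => z s⟩

-- All maps fix the origin, so the condition of order zero is free and closeness of the Jacobian
-- gains one order for the map.
omit H in
theorem close_map_succ {k : ℕ} (h : ∀ s i, Jetwise (littleO l e) (fun _ => 0) k fun n z =>
      pd i (fun z => paramMap (m n) z s) z - (1 : Matrix (Fin 2) (Fin 2) ℝ) s i) (s : Fin 2) :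
    SClose (littleO l e) (fun _ => 0) (k + 1) (fun n z => paramMap (m n) z s) fun _ z => z s := by
  refine ⟨smooth_map.coord s, (sjet_coord (l := l) (k := 0) s).1, ?_, fun i => (h s i).congr
    fun n => ?_⟩
  · simp only [paramMap_zero, Pi.zero_apply, sub_zero]
    exact (littleO l e).zero_mem
  · have h1 := pd_add ((smooth_map (m := m)).coord s n)
      (((sjet_coord (l := l) (k := 0) s).1) n).neg i
    simp only [pd_neg, pd_apply_coord, ← sub_eq_add_neg] at h1
    exact h1.symm

theorem close_map_two (s : Fin 2) :
    SClose (littleO l e) (fun _ => 0) 2 (fun n z => paramMap (m n) z s) fun _ z => z s := by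
  refine close_map_succ (k := 1) (fun s i => ⟨?_, fun j => trivial⟩) s
  have h1 : ∀ n, pd i (fun z => paramMap (m n) z s) 0 = jacobian (paramMap (m n)) 0 s i := fun n =>
    (pd_coord (contDiff_paramMap (m n)).contDiffAt i s).self_of_nhds.symm
  simpa only [h1] using H.jacobian_sub_one s i

theorem close_comp_map {k : ℕ}
    (hM : ∀ s, SClose (littleO l e) (fun _ => 0) k (fun n z => paramMap (m n) z s) fun _ z => z s)
    {f : ι → Base → ℝ} (hf : SJet (bigO l) (fun _ => 0) k f) :
    SClose (littleO l e) (fun _ => 0) k (fun n z => f n (paramMap (m n) z)) f :=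
  ⟨SmoothFamily.comp (y := fun _ => 0) hf.1 smooth_map fun _ => paramMap_zero _, hf.1,
    Jetwise.comp_sub_comp (φ := fun n => paramMap (m n)) (φ' := fun _ z => z) (y := fun _ => 0)
      H.pair (fun _ => paramMap_zero _) (fun _ => rfl) hf.2
      (fun s => ((hM s).bounded H.pair (sjet_coord s)).2) (fun s => (sjet_coord s).2)
      (fun s => (hM s).3) hf.1 smooth_map fun _ => contDiffAt_id⟩

theorem close_matrix {k : ℕ} (i j : Fin 2) : SClose (littleO l e) (fun _ => 0) k
    (fun n _ => paramMatrix (m n) i j) fun _ _ => (1 : Matrix (Fin 2) (Fin 2) ℝ) i j :=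
  ⟨SmoothFamily.const _, SmoothFamily.const _, Jetwise.const (H.paramMatrix_sub_one i j)⟩

theorem close_congr_deriv {k : ℕ} (hk : k ≤ r)
    (hM : ∀ s, SClose (littleO l e) (fun _ => 0) k (fun n z => paramMap (m n) z s) fun _ z => z s)
    (s : Fin 2) (w : Sym2 (Fin 2)) : SClose (littleO l e) (fun _ => 0) k
      (fun n z => congrForm (paramMatrix (m n)) (pd s (polySec (θ' n)) (paramMap (m n) z)).2 w)
      fun n z => (pd s (polySec (θ' n)) z).2 w := by
  have hb := H.pair.base
  have hc : ∀ c : ℝ, SJet (bigO l) (fun _ : ι => 0) k fun _ _ => c := fun c =>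
    SJet.const (const_mem_bigO c)
  induction w using Sym2.ind with
  | _ u v =>
    have hd := fun i j => ((H.sjet_deriv_section (hComp s(i, j)) s).of_le hk)
    have key := SClose.sum (s := Finset.univ) fun i _ => SClose.sum (s := Finset.univ) fun j _ =>
      ((H.close_matrix i u).mul H.pair (H.close_matrix j v) (hc _) (hc _)).mul H.pair
        (H.close_comp_map hM (hd i j)) ((hc _).mul hb (hc _)) (hd i j)
    refine key.congr (fun n => EventuallyEq.rfl) fun n => Eventually.of_forall fun z => ?_
    exact congrFun (congrForm_one (pd s (polySec (θ' n)) z).2) s(u, v)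

omit H in
theorem pd_transform_snd (i : Fin 2) (w : Sym2 (Fin 2)) (n : ι) :
    (pd i fun z => (tS (paramMap (m n)) (paramMatrix (m n)) (polySec (θ' n)) z).2 w) =ᶠ[𝓝 0]
      fun z => ∑ s, pd i (fun z => paramMap (m n) z s) z *
        congrForm (paramMatrix (m n)) (pd s (polySec (θ' n)) (paramMap (m n) z)).2 w := by
  let L : Fibre →L[ℝ] ℝ := (ContinuousLinearMap.proj (R := ℝ)
    (φ := fun _ : Sym2 (Fin 2) => ℝ) w).comp (congrSnd (paramMatrix (m n)))
  have h1 := pd_clm L (((contDiff_polySec (θ' n)).comp (contDiff_paramMap (m n))).contDiffAt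
    (x := 0)) i
  have h2 := pd_comp (t := 0) ((contDiff_polySec (θ' n)).contDiffAt (x := paramMap (m n) 0))
    (contDiff_paramMap (m n)).contDiffAt i
  refine h1.trans ?_
  filter_upwards [h2] with z hz
  refine (congrArg L hz).trans ?_
  simp only [map_sum, map_smul, smul_eq_mul]
  rfl

/-- Write c_s = A·(∂ₛh∘φ). Differentiating the transformed h in direction i gives Σ ∂ᵢφˢ c_s, close
to ∂ᵢh; by the inductive hypothesis c_i is close to ∂ᵢh too. Hence Σ (∂ᵢφˢ - δˢᵢ) c_s is small to
order k, and independence of the c_s isolates each coefficient. -/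
theorem close_map_step {k : ℕ} (hk : k ≤ r)
    (hM : ∀ s, SClose (littleO l e) (fun _ => 0) k (fun n z => paramMap (m n) z s) fun _ z => z s)
    (s : Fin 2) :
    SClose (littleO l e) (fun _ => 0) (k + 1) (fun n z => paramMap (m n) z s) fun _ z => z s := by
  have hbp := H.pair
  refine close_map_succ (fun s i => ?_) s
  set c : Fin 2 → Sym2 (Fin 2) → ι → Base → ℝ := fun s w n z =>
    congrForm (paramMatrix (m n)) (pd s (polySec (θ' n)) (paramMap (m n) z)).2 w with hc
  set D : Fin 2 → ι → Base → ℝ := fun s n z =>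
    pd i (fun z => paramMap (m n) z s) z - (1 : Matrix (Fin 2) (Fin 2) ℝ) s i with hD
  have cl : ∀ s w, SClose (littleO l e) (fun _ => 0) k (c s w)
      fun n z => hComp w (pd s (polySec (θ' n)) z) := fun s w => H.close_congr_deriv hk hM s w
  have cb : ∀ s w, SJet (bigO l) (fun _ => 0) k (c s w) := fun s w =>
    (cl s w).bounded hbp ((H.sjet_deriv_section (hComp w) s).of_le hk)
  have sD : ∀ s, SmoothFamily (fun _ => 0) (D s) := fun s =>
    (((smooth_map (m := m)).coord s).pd i).sub (SmoothFamily.const _)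
  have hR : ∀ w, SJet (littleO l e) (fun _ => 0) k fun n z =>
      D 0 n z * c 0 w n z + D 1 n z * c 1 w n z := by
    intro w
    have h1 := ((H.close_transform (hComp w)).pd i).of_le hk
    have h2 := h1.congr (fun n => pd_transform_snd i w n)
      fun n => pd_clm (hComp w) (contDiff_polySec _).contDiffAt i
    refine (h2.sub.sub (cl i w).sub).congr fun n => Eventually.of_forall fun z => ?_
    simp only [hD, hc, Fin.sum_univ_two]
    obtain rfl | rfl : i = 0 ∨ i = 1 := by fin_cases i <;> simp
    all_goals simp; ring
  set R : Sym2 (Fin 2) → ι → Base → ℝ := fun w n z =>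
    D 0 n z * c 0 w n z + D 1 n z * c 1 w n z with hRdef
  have ct : ∀ s w, Tendsto (fun n => c s w n 0) l (𝓝 (dAt θ₀ s w)) := by
    intro s w
    simp only [hc, paramMap_zero]
    exact tendsto_of_sub_mem H.gauge (H.congr_deriv_sub s w)
      (H.tendsto_comp (contDiff_dAt s w).contDiffAt)
  have ck : ∀ w, SJet (bigO l) (fun _ : ι => 0) k fun _ _ => hAt θ₀ w := fun w =>
    SJet.const (const_mem_bigO _)
  have hb := hbp.base
  -- The fixed form h(θ₀) completes the pair to a triple: pairing the relation R with c₁ or c₀ in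
  -- the determinant is Cramer's rule, with denominator det(h(θ₀), c₀, c₁), nonzero in the limit.
  have minor : ∀ {p : AddSubgroup (ι → ℝ)} (_ : IdealPair (bigO l) p)
      {a b : Sym2 (Fin 2) → ι → Base → ℝ} (_ : ∀ w, SJet p (fun _ => 0) k (a w))
      (_ : ∀ w, SJet (bigO l) (fun _ => 0) k (b w)), SJet p (fun _ => 0) k fun n z =>
        tripleDet (hAt θ₀) (fun w => a w n z) fun w => b w n z := by
    intro p hp a b ha hb
    unfold tripleDet
    have hm := fun u v => ((ha u).mul' hp (hb v)).sub ((ha v).mul' hp (hb u))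
    exact (((ck s(0, 0)).mul hp (hm s(0, 1) s(1, 1))).sub
      ((ck s(0, 1)).mul hp (hm s(0, 0) s(1, 1)))).add
      ((ck s(1, 1)).mul hp (hm s(0, 0) s(0, 1)))
  have hdet := minor hb (cb 0) (cb 1)
  have tdet : Tendsto (fun n => tripleDet (hAt θ₀) (fun w => c 0 w n 0) fun w => c 1 w n 0) l
      (𝓝 (tripleDet (hAt θ₀) (dAt θ₀ 0) (dAt θ₀ 1))) := by
    unfold tripleDet
    have t0 := ct 0
    have t1 := ct 1
    exact ((((t0 _).mul (t1 _)).sub ((t0 _).mul (t1 _))).const_mul _ |>.sub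
      ((((t0 _).mul (t1 _)).sub ((t0 _).mul (t1 _))).const_mul _)).add
      ((((t0 _).mul (t1 _)).sub ((t0 _).mul (t1 _))).const_mul _)
  refine Jetwise.of_mul hbp hdet.2 (fun u hu => mem_littleO_of_mul tdet H.generic.triple hu) ?_
    hdet.1 (sD s)
  obtain rfl | rfl : s = 0 ∨ s = 1 := by fin_cases s <;> simp
  · refine (minor hbp hR (cb 1)).2.congr fun n => Eventually.of_forall fun z => ?_
    simp only [tripleDet]
    ring
  · have h1 := minor hbp hR (cb 0)
    have h2 := h1.2.neg
    refine h2.congr fun n => Eventually.of_forall fun z => ?_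
    simp only [tripleDet]
    ring

/-- The index bounds orders strictly: index r + 1 means derivatives of order at most r. This is all
that h provides, since ∂h is known only to order r - 1. -/
theorem close_map (s : Fin 2) :
    SClose (littleO l e) (fun _ => 0) (r + 1) (fun n z => paramMap (m n) z s) fun _ z => z s := by
  have h : ∀ k, k + 1 ≤ r → ∀ s, SClose (littleO l e) (fun _ => 0) (k + 2)
      (fun n z => paramMap (m n) z s) fun _ z => z s := by
    intro k
    induction k with
    | zero => exact fun _ => H.close_map_two
    | succ k ih => exact fun hk => H.close_map_step (by omega) (ih (by omega))
  obtain ⟨k, rfl⟩ : ∃ k, r = k + 1 := ⟨r - 1, by have := H.one_le; omega⟩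
  exact h k le_rfl s

/-- The Jacobian of φ occurs undifferentiated in the transformed metric, so g carries one more order
than h. Differentiating it once, the terms without second derivatives of φ are close to ∂g, so the
combinations of second derivatives that remain are small. -/
theorem close_map_last (s : Fin 2) :
    SClose (littleO l e) (fun _ => 0) (r + 2) (fun n z => paramMap (m n) z s) fun _ z => z s := by
  have hbp := H.pair
  have hb := hbp.base
  have hM := H.close_map
  have hc : ∀ {k : ℕ} (c : ℝ), SJet (bigO l) (fun _ : ι => 0) k fun _ _ => c := fun c =>
    SJet.const (const_mem_bigO c)
  set P : Fin 2 → Fin 2 → ι → Base → ℝ := fun a i n => pd i (fun z => paramMap (m n) z a) with hP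
  set Q : Fin 2 → Fin 2 → Fin 2 → ι → Base → ℝ := fun a i j n => pd j (P a i n) with hQ
  set G : Fin 2 → Fin 2 → ι → Base → ℝ := fun a b n z =>
    gComp s(a, b) (polySec (θ' n) (paramMap (m n) z)) with hG
  set G' : Fin 2 → Fin 2 → Fin 2 → ι → Base → ℝ := fun a b c n z =>
    gComp s(a, b) (pd c (polySec (θ' n)) (paramMap (m n) z)) with hG'
  have sP : ∀ a i, SmoothFamily (fun _ => 0) (P a i) := fun a i =>
    ((smooth_map (m := m)).coord a).pd i
  have clP : ∀ a i, SClose (littleO l e) (fun _ => 0) r (P a i)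
      fun _ _ => (1 : Matrix (Fin 2) (Fin 2) ℝ) a i := fun a i =>
    ((hM a).pd i).congr (fun n => EventuallyEq.rfl) fun n => by rw [pd_apply_coord]
  have bP : ∀ a i, SJet (bigO l) (fun _ => 0) r (P a i) := fun a i => (clP a i).bounded hbp (hc _)
  have clG : ∀ a b, SClose (littleO l e) (fun _ => 0) (r + 1) (G a b)
      fun n z => gComp s(a, b) (polySec (θ' n) z) := fun a b =>
    H.close_comp_map hM (H.sjet_section (gComp s(a, b)))
  have bG : ∀ a b, SJet (bigO l) (fun _ => 0) r (G a b) := fun a b =>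
    ((clG a b).bounded hbp (H.sjet_section (gComp s(a, b)))).of_le (by omega)
  have clG' : ∀ a b c, SClose (littleO l e) (fun _ => 0) r (G' a b c)
      fun n z => gComp s(a, b) (pd c (polySec (θ' n)) z) := fun a b c =>
    H.close_comp_map (fun s => (hM s).of_le (by omega)) (H.sjet_deriv_section (gComp s(a, b)) c)
  have symG : ∀ n z, G 1 0 n z = G 0 1 n z := fun n z => by simp only [hG, swap_eq]
  have symQ : ∀ a n, Q a 1 0 n =ᶠ[𝓝 0] Q a 0 1 n := fun a n =>
    pd_comm ((smooth_map (m := m)).coord a n) 0 1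
  -- the terms of the derivative of the transformed metric without second derivatives of the map
  have clT : ∀ i j k, SClose (littleO l e) (fun _ => 0) r (fun n z => ∑ a, ∑ b, ∑ c,
      P a i n z * P b j n z * (P c k n z * G' a b c n z))
      fun n z => gComp s(i, j) (pd k (polySec (θ' n)) z) := by
    intro i j k
    have hd := fun a b c => H.sjet_deriv_section (gComp s(a, b)) c
    have key := SClose.sum (s := Finset.univ) fun a _ => SClose.sum (s := Finset.univ) fun b _ =>
      SClose.sum (s := Finset.univ) fun c _ =>
        ((clP a i).mul hbp (clP b j) (hc _) (hc _)).mul hbp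
          ((clP c k).mul hbp (clG' a b c) (hc _) (hd a b c)) ((hc _).mul hb (hc _))
          ((hc _).mul hb (hd a b c))
    refine key.congr (fun n => EventuallyEq.rfl) fun n => Eventually.of_forall fun z => ?_
    simp only [Matrix.one_apply, ite_mul, one_mul, zero_mul, Finset.sum_ite_eq', mul_ite,
      mul_zero, mul_one, Finset.mem_univ, if_true]
  have pdG : ∀ a b k n, pd k (G a b n) =ᶠ[𝓝 0] fun z => ∑ c, P c k n z * G' a b c n z := by
    intro a b k n
    have h1 := pd_clm (gComp s(a, b)) (((contDiff_polySec (θ' n)).comp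
      (contDiff_paramMap (m n))).contDiffAt (x := 0)) k
    have h2 := pd_comp (t := 0) ((contDiff_polySec (θ' n)).contDiffAt (x := paramMap (m n) 0))
      (contDiff_paramMap (m n)).contDiffAt k
    refine h1.trans ?_
    filter_upwards [h2] with z hz
    refine (congrArg (gComp s(a, b)) hz).trans ?_
    simp only [map_sum, map_smul, smul_eq_mul, hP, hG']
  have hR : ∀ i j k, SJet (littleO l e) (fun _ => 0) r fun n z => ∑ a, ∑ b,
      (Q a i k n z * P b j n z + P a i n z * Q b j k n z) * G a b n z := by
    intro i j k
    have h1 := (H.close_transform (gComp s(i, j))).pd k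
    have e1 : ∀ n, (fun z => gComp s(i, j)
        (tS (paramMap (m n)) (paramMatrix (m n)) (polySec (θ' n)) z)) =ᶠ[𝓝 0]
        fun z => ∑ a, ∑ b, P a i n z * P b j n z * G a b n z := by
      intro n
      have q := fun k a => pd_coord (contDiff_paramMap (m n)).contDiffAt (t := 0) k a
      filter_upwards [q i 0, q i 1, q j 0, q j 1] with z h1 h2 h3 h4
      simp only [gComp_apply, tS_fst, Fin.sum_univ_two, h1, h2, h3, h4, hP, hG]
    have e2 : ∀ n, pd k (fun z => ∑ a, ∑ b, P a i n z * P b j n z * G a b n z) =ᶠ[𝓝 0]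
        fun z => ∑ a, ∑ b, ((Q a i k n z * P b j n z + P a i n z * Q b j k n z) * G a b n z +
          P a i n z * P b j n z * pd k (G a b n) z) := by
      intro n
      have s1 := fun a b => (sP a i n).mul (sP b j n)
      have s2 := fun a b => (s1 a b).mul ((clG a b).1 n)
      have d1 := fun a b => pd_mul (sP a i n) (sP b j n) k
      have d2 := fun a b => pd_mul (s1 a b) ((clG a b).1 n) k
      have d3 := fun a => pd_add (s2 a 0) (s2 a 1) k
      have d4 := pd_add ((s2 0 0).add (s2 0 1)) ((s2 1 0).add (s2 1 1)) k
      simp only [Fin.sum_univ_two]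
      filter_upwards [d1 0 0, d1 0 1, d1 1 0, d1 1 1, d2 0 0, d2 0 1, d2 1 0, d2 1 1, d3 0, d3 1,
        d4] with z a1 a2 a3 a4 b1 b2 b3 b4 c1 c2 c3
      refine c3.trans ?_
      rw [c1, c2, b1, b2, b3, b4, a1, a2, a3, a4]
    have h2 := h1.congr (fun n => (pd_congr (e1 n) k).trans (e2 n))
      fun n => pd_clm (gComp s(i, j)) (contDiff_polySec _).contDiffAt k
    refine (h2.sub.sub (clT i j k).sub).congr fun n => ?_
    filter_upwards [pdG 0 0 k n, pdG 0 1 k n, pdG 1 0 k n, pdG 1 1 k n] with z g1 g2 g3 g4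
    simp only [Fin.sum_univ_two] at g1 g2 g3 g4 ⊢
    rw [g1, g2, g3, g4]
    ring
  set E : Fin 2 → Fin 2 → ι → Base → ℝ := fun a j n z => ∑ b, G a b n z * P b j n z with hE
  have bE : ∀ a j, SJet (bigO l) (fun _ => 0) r (E a j) := fun a j =>
    SJet.sum fun b _ => (bG a b).mul hb (bP b j)
  -- Koszul's trick: with R_{ijk} = g(∂ᵢ∂ₖφ, ∂ⱼφ) + g(∂ᵢφ, ∂ⱼ∂ₖφ), symmetry of second derivatives
  -- gives ½(R_{ikj} + R_{jki} - R_{ijk}) = g(∂ᵢ∂ⱼφ, ∂ₖφ).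
  have hK : ∀ i j k, SJet (littleO l e) (fun _ => 0) r fun n z =>
      Q 0 i j n z * E 0 k n z + Q 1 i j n z * E 1 k n z := by
    intro i j k
    have h1 := ((hc (1 / 2)).mul hbp (((hR i k j).add (hR j k i)).sub (hR i j k)))
    refine h1.congr fun n => ?_
    filter_upwards [symQ 0 n, symQ 1 n] with z h0 h1
    have hs : ∀ a i j, Q a i j n z = Q a j i n z := by
      intro a i j
      fin_cases a <;> fin_cases i <;> fin_cases j <;> first | rfl | exact h0 | exact h1 | exact h0.symm | exact h1.symm
    simp only [Fin.sum_univ_two, hE, symG]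
    rw [hs 0 k j, hs 1 k j, hs 0 k i, hs 1 k i, hs 0 j i, hs 1 j i]
    ring
  have hdet : SJet (bigO l) (fun _ => 0) r fun n z => E 0 0 n z * E 1 1 n z - E 0 1 n z * E 1 0 n z :=
    ((bE 0 0).mul hb (bE 1 1)).sub ((bE 0 1).mul hb (bE 1 0))
  have tE : ∀ a j, Tendsto (fun n => E a j n 0) l (𝓝 (gAt θ₀ s(a, j))) := by
    intro a j
    have t1 : ∀ b, Tendsto (fun n => G a b n 0) l (𝓝 (gAt θ₀ s(a, b))) := by
      intro b
      simp only [hG, paramMap_zero]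
      exact H.tendsto_comp (contDiff_gAt s(a, b)).contDiffAt
    have t2 : ∀ b, Tendsto (fun n => P b j n 0) l (𝓝 ((1 : Matrix (Fin 2) (Fin 2) ℝ) b j)) := by
      intro b
      refine (H.jacobian_tendsto b j).congr fun n => ?_
      exact (pd_coord (contDiff_paramMap (m n)).contDiffAt j b).self_of_nhds
    have := tendsto_finsetSum Finset.univ fun b _ => (t1 b).mul (t2 b)
    simpa only [hE, Matrix.one_apply, mul_ite, mul_one, mul_zero, Finset.sum_ite_eq',
      Finset.mem_univ, if_true] using this
  have tdet := ((tE 0 0).mul (tE 1 1)).sub ((tE 0 1).mul (tE 1 0))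
  have hne : gAt θ₀ s(0, 0) * gAt θ₀ s(1, 1) - gAt θ₀ s(0, 1) * gAt θ₀ s(1, 0) ≠ 0 := by
    have := H.generic.metric
    simp only [discPair] at this
    rw [swap_eq]
    intro h
    apply this
    linear_combination 2 * h
  have sQ : ∀ a i j, SmoothFamily (fun _ => 0) (Q a i j) := fun a i j => (sP a i).pd j
  -- The matrix E tends to g(θ₀), which is nondegenerate, so Cramer's rule solves for the second
  -- derivatives.
  have hQ' : ∀ a i j, Jetwise (littleO l e) (fun _ => 0) r (Q a i j) := by
    intro a i j
    refine Jetwise.of_mul hbp hdet.2 (fun u hu => mem_littleO_of_mul tdet hne hu) ?_ hdet.1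
      (sQ a i j)
    obtain rfl | rfl : a = 0 ∨ a = 1 := by fin_cases a <;> simp
    · refine (((hK i j 0).mul' hbp (bE 1 1)).sub ((hK i j 1).mul' hbp (bE 1 0))).2.congr fun n =>
        Eventually.of_forall fun z => ?_
      ring
    · refine (((hK i j 1).mul' hbp (bE 0 0)).sub ((hK i j 0).mul' hbp (bE 0 1))).2.congr fun n =>
        Eventually.of_forall fun z => ?_
      ring
  refine close_map_succ (k := r + 1) (fun a i => ⟨?_, fun j => (hQ' a i j).congr fun n => ?_⟩) s
  · exact ((clP a i).3.of_le H.one_le).1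
  · have h1 := pd_add (sP a i n) (contDiffAt_const (c := -(1 : Matrix (Fin 2) (Fin 2) ℝ) a i)) j
    simp only [pd_const, add_zero, ← sub_eq_add_neg] at h1
    exact h1.symm

theorem param_isLittleO : m =o[l] e := by
  have h1 : ∀ J s, (fun n => (m n).1 J s) ∈ littleO l e := by
    intro J s
    have h2 := (close_iff_mpd (H.close_map_last s).1 (H.close_map_last s).2).1
      (H.close_map_last s).3 (posPair J).1 (posPair J).2 (Nat.lt_succ_of_le J.1.2)
    convert h2 using 2 with n
    have h3 := (mpd_clm (ContinuousLinearMap.proj (R := ℝ) (φ := fun _ : Fin 2 => ℝ) s)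
      (contDiff_paramMap (m n)).contDiffAt (t := 0) (posPair J).1 (posPair J).2).self_of_nhds
    have h4 := (mpd_clm (ContinuousLinearMap.proj (R := ℝ) (φ := fun _ : Fin 2 => ℝ) s)
      (contDiff_id (𝕜 := ℝ) (n := ∞)).contDiffAt (t := (0 : Base)) (posPair J).1
      (posPair J).2).self_of_nhds
    have h5 := (mpd_add (contDiff_id (𝕜 := ℝ) (n := ∞)).contDiffAt
      (contDiff_polyMap posPair (m n).1).contDiffAt (t := (0 : Base)) (posPair J).1
      (posPair J).2).self_of_nhds
    have h6 := mpd_polyMap posPair_injective (m n).1 J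
    simp only [ContinuousLinearMap.proj_apply, id] at h3 h4 h5
    rw [h3, h4]
    unfold paramMap
    rw [h5]
    simp [h6]
  have h2 : ∀ i k, (fun n => (m n).2 i k) ∈ littleO l e := by
    intro i k
    convert H.paramMatrix_sub_one i k using 2 with n
    simp [paramMatrix]
  exact IsLittleO.prod_left (isLittleO_pi.2 fun J => isLittleO_pi.2 fun s => h1 J s)
    (isLittleO_pi.2 fun i => isLittleO_pi.2 fun k => h2 i k)

end NearbyJets

end Separation

/-! ### Properness, infinitesimal freeness and density of generic jets. -/

section Consequences

variable {r : ℕ}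

theorem congrForm_neg (A : Matrix (Fin 2) (Fin 2) ℝ) (b : SymForm) :
    congrForm (-A) b = congrForm A b := by
  refine symForm_ext fun k l => ?_
  simp [congrForm_mk]

/-- Transformations with opposite matrices act in the same way. -/
theorem exists_act_eq_nonneg (m : Param r) (θ : JetFibre r) :
    ∃ m' : Param r, 0 ≤ paramMatrix m' 0 0 ∧ act m' θ = act m θ := by
  by_cases h : 0 ≤ paramMatrix m 0 0
  · exact ⟨m, h, rfl⟩
  · let m' : Param r := (m.1, fun i j => (-paramMatrix m - 1) i j)
    have h1 : paramMatrix m' = -paramMatrix m := by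
      ext i j
      simp [paramMatrix, m']
    refine ⟨m', by rw [h1, Matrix.neg_apply]; linarith, ?_⟩
    have h2 : paramMap m' = paramMap m := rfl
    have h3 : tS (paramMap m') (paramMatrix m') (polySec θ) =
        tS (paramMap m) (paramMatrix m) (polySec θ) := by
      funext z
      simp only [tS, h1, h2, congrForm_neg]
    rw [act, h3, act]

/-- Jets near a generic one that are related are so by a transformation near the identity. -/
theorem exists_near_param (hr : 1 ≤ r) {θ₀ : JetFibre r} (hG : Generic θ₀) {V : Set (Param r)}
    (hV : V ∈ 𝓝 0) : ∃ W ∈ 𝓝 θ₀, ∀ y ∈ W, ∀ y' ∈ W, JetRel y y' → ∃ m ∈ V, act m y' = y := by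
  -- Indexing by all triples (y, y', m) with m carrying y' to y, filtered by (y, y') → (θ₀, θ₀),
  -- turns convergence of m to 0 into a statement uniform in y and y'.
  let ι := {q : (JetFibre r × JetFibre r) × Param r //
    act q.2 q.1.2 = q.1.1 ∧ 0 ≤ paramMatrix q.2 0 0}
  let l : Filter ι := comap (fun q => q.1.1) (𝓝 (θ₀, θ₀))
  have hl : Tendsto (fun q : ι => q.1.1) l (𝓝 (θ₀, θ₀)) := tendsto_comap
  have h1 : Tendsto (fun q : ι => q.1.1.1) l (𝓝 θ₀) := (continuous_fst.tendsto (θ₀, θ₀)).comp hl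
  have h2 : Tendsto (fun q : ι => q.1.1.2) l (𝓝 θ₀) := (continuous_snd.tendsto (θ₀, θ₀)).comp hl
  have H : NearbyJets l (fun _ => 1) θ₀ (fun q : ι => q.1.1.1) (fun q => q.1.1.2)
      fun q => q.1.2 :=
    { one_le := hr
      gauge := isBigO_refl _ _
      generic := hG
      act := fun q => q.2.1
      tendsto_left := h1
      tendsto_right := h2
      sub := (isLittleO_one_iff ℝ).2 (by simpa using h1.sub h2)
      nonneg := fun q => q.2.2 }
  have h3 : Tendsto (fun q : ι => q.1.2) l (𝓝 0) := (isLittleO_one_iff ℝ).1 H.param_isLittleO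
  obtain ⟨T, hT, hTV⟩ := mem_comap.1 (h3 hV)
  obtain ⟨W₁, hW₁, W₂, hW₂, hsub⟩ := mem_nhds_prod_iff.1 hT
  refine ⟨W₁ ∩ W₂, inter_mem hW₁ hW₂, fun y hy y' hy' hyy' => ?_⟩
  obtain ⟨m, -, -, hm⟩ := hyy'
  obtain ⟨m', hm', he⟩ := exists_act_eq_nonneg m y'
  exact ⟨m', hTV (a := ⟨((y, y'), m'), he.trans hm, hm'⟩) (hsub ⟨hy.1, hy'.2⟩), he.trans hm⟩

theorem ContDiff.of_uncurry_left {E X Y : Type*} [NormedAddCommGroup E] [NormedSpace ℝ E]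
    [NormedAddCommGroup X] [NormedSpace ℝ X] [NormedAddCommGroup Y] [NormedSpace ℝ Y]
    {A : E → X → Y} (hA : ContDiff ℝ ∞ fun q : E × X => A q.1 q.2) (x : X) :
    ContDiff ℝ ∞ fun e => A e x :=
  hA.comp (contDiff_id.prodMk contDiff_const)

theorem contDiff_act_left (θ : JetFibre r) : ContDiff ℝ ∞ fun m : Param r => act m θ :=
  ContDiff.of_uncurry_left (A := act) contDiff_act θ

/-- The infinitesimal action at a jet fibre. -/
noncomputable def infAct (θ : JetFibre r) : Param r →L[ℝ] JetFibre r :=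
  fderiv ℝ (fun m => act m θ) 0

theorem hasDerivAt_act_smul (θ : JetFibre r) (v : Param r) :
    HasDerivAt (fun s : ℝ => act (s • v) θ) (infAct θ v) 0 := by
  have h1 : HasDerivAt (fun s : ℝ => s • v) v 0 := by
    simpa using (hasDerivAt_id (0 : ℝ)).smul_const v
  have h2 : HasFDerivAt (fun m : Param r => act m θ) (infAct θ) ((0 : ℝ) • v) := by
    rw [zero_smul]
    exact ((contDiff_act_left θ).differentiable (by simp) 0).hasFDerivAt
  exact h2.comp_hasDerivAt (0 : ℝ) h1

/-- If the velocity in direction v vanishes, then `act` by s • v moves θ₀ by o(s). The estimate with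
gauge e = s yields s • v = o(s), so v = 0. Only s with nonnegative (0, 0) matrix entry are indexed;
they form a neighbourhood of 0. -/
theorem infAct_injective (hr : 1 ≤ r) {θ₀ : JetFibre r} (hG : Generic θ₀) (v : Param r)
    (hv : infAct θ₀ v = 0) : v = 0 := by
  have hd := hasDerivAt_act_smul θ₀ v
  have hcA : ContinuousAt (fun s : ℝ => paramMatrix (s • v) 0 0) 0 :=
    ((contDiff_paramMatrix (r := r) 0 0).continuous.comp
      (continuous_id.smul continuous_const)).continuousAt
  have hpos : {s : ℝ | 0 ≤ paramMatrix (s • v) 0 0} ∈ 𝓝 (0 : ℝ) := by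
    have h1 : (0 : ℝ) < paramMatrix ((0 : ℝ) • v) 0 0 := by simp [paramMatrix]
    filter_upwards [hcA.eventually (lt_mem_nhds h1)] with s hs using hs.le
  let ι := {s : ℝ | 0 ≤ paramMatrix (s • v) 0 0}
  let l : Filter ι := comap Subtype.val (𝓝 0)
  have hl : Tendsto (fun s : ι => (s : ℝ)) l (𝓝 0) := tendsto_comap
  have H : NearbyJets l (fun s : ι => (s : ℝ)) θ₀ (fun s => act ((s : ℝ) • v) θ₀) (fun _ => θ₀)
      fun s => (s : ℝ) • v :=
    { one_le := hr
      gauge := hl.isBigO_one ℝ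
      generic := hG
      act := fun _ => rfl
      tendsto_left := by
        have := hd.continuousAt.tendsto.comp hl
        simpa only [zero_smul, act_zero, Function.comp_def] using this
      tendsto_right := tendsto_const_nhds
      sub := by
        have h1 := (hasDerivAt_iff_isLittleO.1 hd).comp_tendsto hl
        simpa [hv, act_zero, Function.comp_def] using h1
      nonneg := fun s => s.2 }
  have h1 := H.param_isLittleO
  have h2 : (fun s : ℝ => s • v) =o[𝓝 0] fun s : ℝ => s := by
    have h3 : map (Subtype.val : ι → ℝ) l = 𝓝 0 := by
      rw [map_comap, Subtype.range_coe]
      exact inf_eq_left.2 (le_principal_iff.2 hpos)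
    rw [← h3, isLittleO_map]
    exact h1
  have h4 : HasDerivAt (fun s : ℝ => s • v) 0 0 := by
    rw [hasDerivAt_iff_isLittleO]
    simpa using h2
  have h5 : HasDerivAt (fun s : ℝ => s • v) v 0 := by
    simpa using (hasDerivAt_id (0 : ℝ)).smul_const v
  exact h5.unique h4

theorem polySec_add_smul (θ η : JetFibre r) (s : ℝ) :
    polySec (θ + s • η) = fun z => polySec θ z + s • polySec η z := by
  funext z
  simp only [polySec, polyMap, Pi.add_apply, Pi.smul_apply, smul_add, Finset.sum_add_distrib,
    Finset.smul_sum]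
  congr 1
  exact Finset.sum_congr rfl fun J _ => smul_comm _ _ _

theorem gAt_add_smul (θ η : JetFibre r) (s : ℝ) (w : Sym2 (Fin 2)) :
    gAt (θ + s • η) w = gAt θ w + s * gAt η w := by
  simp [gAt, polySec_add_smul]

theorem hAt_add_smul (θ η : JetFibre r) (s : ℝ) (w : Sym2 (Fin 2)) :
    hAt (θ + s • η) w = hAt θ w + s * hAt η w := by
  simp [hAt, polySec_add_smul]

theorem dAt_add_smul (θ η : JetFibre r) (s : ℝ) (i : Fin 2) (w : Sym2 (Fin 2)) :
    dAt (θ + s • η) i w = dAt θ i w + s * dAt η i w := by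
  have h1 := (contDiff_polySec θ).differentiable (by simp) 0
  have h2 := (contDiff_polySec η).differentiable (by simp) 0
  have h3 : fderiv ℝ (fun z => polySec θ z + s • polySec η z) 0 =
      fderiv ℝ (polySec θ) 0 + s • fderiv ℝ (polySec η) 0 :=
    (h1.hasFDerivAt.add (h2.hasFDerivAt.const_smul s)).fderiv
  simp [dAt, polySec_add_smul, pd, h3]

/-- With g = h the unit form, ∂₁h = diag(1, 0) and ∂₂h with components 1, 1, -1, one finds α
proportional to (1, 0) and γ to (0, -1), and the triple determinant is 1. -/
theorem exists_generic (hr : 1 ≤ r) : ∃ θ : JetFibre r, Generic θ := by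
  let form : ℝ → ℝ → ℝ → SymForm := fun a b c s =>
    if s = s(0, 0) then a else if s = s(0, 1) then b else c
  have hne : (s(0, 0) : Sym2 (Fin 2)) ≠ s(0, 1) := by decide
  have hne1 : (s(1, 1) : Sym2 (Fin 2)) ≠ s(0, 1) := by decide
  have hne2 : (s(1, 1) : Sym2 (Fin 2)) ≠ s(0, 0) := by decide
  let d : Fin 2 → SymForm := ![form 1 0 0, form 1 1 (-1)]
  let τ : Base → Fibre := fun z => (form 1 0 1, form 1 0 1) +
    (z 0 • ((0, d 0) : Fibre) + z 1 • ((0, d 1) : Fibre))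
  have hp : ∀ j, HasFDerivAt (fun z : Base => z j)
      (ContinuousLinearMap.proj (R := ℝ) (φ := fun _ : Fin 2 => ℝ) j) 0 := fun j =>
    hasFDerivAt_apply j 0
  have hτ : ∀ i, pd i τ 0 = (0, d i) := by
    intro i
    have h1 := (((hp 0).smul_const ((0, d 0) : Fibre)).add
      ((hp 1).smul_const ((0, d 1) : Fibre))).const_add (form 1 0 1, form 1 0 1)
    have h2 : fderiv ℝ τ 0 = _ := h1.fderiv
    rw [pd, h2]
    fin_cases i <;> simp
  have e0 : polySec (jetAt r τ 0) 0 = τ 0 :=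
    mpd_polySec (jetAt r τ 0) τ rfl (a := 0) (b := 0) (by omega)
  have e1 : ∀ i, pd i (polySec (jetAt r τ 0)) 0 = (0, d i) := by
    intro i
    rw [← hτ i]
    fin_cases i
    · exact mpd_polySec (jetAt r τ 0) τ rfl (a := 1) (b := 0) (by omega)
    · exact mpd_polySec (jetAt r τ 0) τ rfl (a := 0) (b := 1) (by omega)
  have hτ0 : τ 0 = (form 1 0 1, form 1 0 1) := by simp [τ]
  have hg : gAt (jetAt r τ 0) = form 1 0 1 := by rw [gAt, e0, hτ0]
  have hh : hAt (jetAt r τ 0) = form 1 0 1 := by rw [hAt, e0, hτ0]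
  have hd : dAt (jetAt r τ 0) = d := by
    funext i
    rw [dAt, e1]
  have key : GenericData (form 1 0 1) (form 1 0 1) d := by
    constructor <;>
      simp [d, form, discPair, tripleDet, secondCovector, hne1, hne2]
  refine ⟨jetAt r τ 0, ?_⟩
  rw [Generic, hg, hh, hd]
  exact key

/-- On the line from any x to x₁ the function is analytic and not identically zero, so by the
identity theorem it cannot vanish near x. -/
theorem dense_of_analytic_line {X : Type*} [NormedAddCommGroup X] [NormedSpace ℝ X] {F : X → ℝ}
    (hF : ∀ x y, AnalyticOnNhd ℝ (fun s : ℝ => F (x + s • y)) Set.univ) {x₁ : X} (h₁ : F x₁ ≠ 0) :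
    Dense {x | F x ≠ 0} := by
  intro x
  have hfreq : ∃ᶠ s in 𝓝 (0 : ℝ), F (x + s • (x₁ - x)) ≠ 0 := by
    intro h
    have h1 := (hF x (x₁ - x)).eq_of_eventuallyEq (g := fun _ => 0) analyticOnNhd_const (z₀ := 0)
      (by filter_upwards [h] with s hs; simpa using hs)
    have h2 := congrFun h1 1
    simp only [one_smul, add_sub_cancel] at h2
    exact h₁ h2
  rw [mem_closure_iff_frequently]
  have hc : Continuous fun s : ℝ => x + s • (x₁ - x) := by fun_prop
  have h3 : Tendsto (fun s : ℝ => x + s • (x₁ - x)) (𝓝 0) (𝓝 x) := by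
    simpa using hc.tendsto 0
  exact h3.frequently hfreq

theorem dense_generic (hr : 1 ≤ r) : Dense {θ : JetFibre r | Generic θ} := by
  obtain ⟨η, hη⟩ := exists_generic hr
  refine (dense_of_analytic_line (F := fun θ : JetFibre r => discPair (gAt θ) (gAt θ) *
    discPair (hAt θ) (hAt θ) * tripleDet (hAt θ) (dAt θ 0) (dAt θ 1) *
      (discPair (hAt θ) (dAt θ 0) * secondCovector (gAt θ) (hAt θ) (dAt θ) 1 -
        discPair (hAt θ) (dAt θ 1) * secondCovector (gAt θ) (hAt θ) (dAt θ) 0))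
    (fun θ η s _ => ?_) (x₁ := η) ?_).mono fun θ h => ?_
  · simp only [discPair, tripleDet, secondCovector, gAt_add_smul, hAt_add_smul, dAt_add_smul]
    fun_prop
  · exact mul_ne_zero (mul_ne_zero (mul_ne_zero hη.1 hη.2) hη.3) hη.4
  · simp only [Set.mem_ofPred_eq, mul_ne_zero_iff] at h
    exact ⟨h.1.1.1, h.1.1.2, h.1.2, h.2⟩

end Consequences

/-! ### The slice theorem. -/

section Slice

variable {E X : Type*} [NormedAddCommGroup E] [NormedSpace ℝ E] [FiniteDimensional ℝ E]
  [NormedAddCommGroup X] [NormedSpace ℝ X] [FiniteDimensional ℝ X]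

/-- A slice for a local action whose orbits are the classes of a relation `R`, near a point where
the infinitesimal action is injective and related points are related by small transformations. -/
theorem exists_slice {A : E → X → X} (hA : ContDiff ℝ ∞ fun q : E × X => A q.1 q.2)
    (hA0 : ∀ x, A 0 x = x) {R : X → X → Prop} (hsymm : ∀ {x y}, R x y → R y x)
    (htrans : ∀ {x y z}, R x y → R y z → R x z) (hR : ∀ᶠ e in 𝓝 (0 : E), ∀ x, R (A e x) x)
    {x₀ : X} (hinj : ∀ v, fderiv ℝ (fun e => A e x₀) 0 v = 0 → v = 0)
    (hproper : ∀ V ∈ 𝓝 (0 : E), ∃ W ∈ 𝓝 x₀, ∀ y ∈ W, ∀ y' ∈ W, R y y' → ∃ e ∈ V, A e y' = y)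
    {N : ℕ} (hN : Module.finrank ℝ E + N = Module.finrank ℝ X) {O : Set X} (hO : IsOpen O)
    (hx₀ : x₀ ∈ O) : ∃ W : Set X, IsOpen W ∧ x₀ ∈ W ∧ W ⊆ O ∧ ∃ I : X → Fin N → ℝ,
      ContDiffOn ℝ ∞ I W ∧ (∀ x ∈ W, Function.Surjective (fderiv ℝ I x)) ∧
      ∀ x ∈ W, ∀ y ∈ W, R x y ↔ I x = I y := by
  set D : E →L[ℝ] X := fderiv ℝ (fun e => A e x₀) 0 with hD
  have hDinj : LinearMap.ker (D : E →ₗ[ℝ] X) = ⊥ :=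
    LinearMap.ker_eq_bot'.2 hinj
  obtain ⟨T, hT⟩ := (LinearMap.range (D : E →ₗ[ℝ] X)).exists_isCompl
  have hTN : Module.finrank ℝ T = N := by
    have h1 := Submodule.finrank_add_eq_of_isCompl hT
    have h2 := LinearMap.finrank_range_of_inj (LinearMap.ker_eq_bot.1 hDinj)
    omega
  let eT : (Fin N → ℝ) ≃ₗ[ℝ] T := LinearEquiv.ofFinrankEq _ _ (by simp [hTN])
  let j : (Fin N → ℝ) →L[ℝ] X := LinearMap.toContinuousLinearMap (T.subtype ∘ₗ eT.toLinearMap)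
  have hjT : ∀ τ, j τ ∈ T := fun τ => (eT τ).2
  have hjinj : ∀ τ, j τ = 0 → τ = 0 := by
    intro τ h
    have : eT τ = 0 := Subtype.ext h
    simpa using this
  -- The action spreads the affine slice x₀ + T, with T complementary to the orbit directions; Φ is
  -- a local diffeomorphism at 0, and the invariants are the slice coordinates of its inverse.
  let Φ : E × (Fin N → ℝ) → X := fun q => A q.1 (x₀ + j q.2)
  have hΦ : ContDiff ℝ ∞ Φ :=
    hA.comp (contDiff_fst.prodMk (contDiff_const.add (j.contDiff.comp contDiff_snd)))
  have hΦ0 : Φ 0 = x₀ := by simp [Φ, hA0]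
  have hderiv : HasFDerivAt Φ (D.coprod j) 0 := by
    have hd := (hΦ.differentiable (by simp) 0).hasFDerivAt
    have h1 : (fderiv ℝ Φ 0).comp (ContinuousLinearMap.inl ℝ E (Fin N → ℝ)) = D := by
      have h2 : HasFDerivAt (fun e : E => Φ (e, 0))
          ((fderiv ℝ Φ 0).comp (ContinuousLinearMap.inl ℝ E (Fin N → ℝ))) 0 :=
        HasFDerivAt.comp (0 : E) (f := fun e : E => (e, (0 : Fin N → ℝ))) hd
          (hasFDerivAt_prodMk_left (0 : E) (0 : Fin N → ℝ))
      have h3 : (fun e : E => Φ (e, 0)) = fun e => A e x₀ := by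
        funext e
        simp [Φ]
      rw [h3] at h2
      exact h2.fderiv.symm
    have h4 : (fderiv ℝ Φ 0).comp (ContinuousLinearMap.inr ℝ E (Fin N → ℝ)) = j := by
      have h2 : HasFDerivAt (fun τ : Fin N → ℝ => Φ (0, τ))
          ((fderiv ℝ Φ 0).comp (ContinuousLinearMap.inr ℝ E (Fin N → ℝ))) 0 :=
        HasFDerivAt.comp (0 : Fin N → ℝ) (f := fun τ : Fin N → ℝ => ((0 : E), τ)) hd
          (hasFDerivAt_prodMk_right (0 : E) (0 : Fin N → ℝ))
      have h3 : (fun τ : Fin N → ℝ => Φ (0, τ)) = fun τ => x₀ + j τ := by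
        funext τ
        simp [Φ, hA0]
      rw [h3] at h2
      exact h2.unique (j.hasFDerivAt.const_add x₀)
    have h5 : fderiv ℝ Φ 0 = D.coprod j := by
      rw [← h1, ← h4]
      ext q <;> simp
    rwa [h5] at hd
  have hbij : Function.Bijective (D.coprod j : E × (Fin N → ℝ) →ₗ[ℝ] X) := by
    constructor
    · refine LinearMap.ker_eq_bot.1 (LinearMap.ker_eq_bot'.2 fun q hq => ?_)
      have h1 : D q.1 + j q.2 = 0 := hq
      have h2 : D q.1 ∈ T := by
        rw [eq_neg_of_add_eq_zero_left h1]
        exact T.neg_mem (hjT _)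
      have h3 : D q.1 = 0 := Submodule.disjoint_def.1 hT.disjoint _ ⟨q.1, rfl⟩ h2
      have h4 : j q.2 = 0 := by simpa [h3] using h1
      exact Prod.ext (hinj _ h3) (hjinj _ h4)
    · intro x
      have h1 : x ∈ LinearMap.range (D : E →ₗ[ℝ] X) ⊔ T := by
        rw [hT.sup_eq_top]
        exact Submodule.mem_top
      obtain ⟨y, ⟨v, rfl⟩, t, ht, rfl⟩ := Submodule.mem_sup.1 h1
      refine ⟨(v, eT.symm ⟨t, ht⟩), ?_⟩
      simp [j]
  let L : (E × (Fin N → ℝ)) ≃L[ℝ] X := (LinearEquiv.ofBijective _ hbij).toContinuousLinearEquiv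
  have hL : (L : E × (Fin N → ℝ) →L[ℝ] X) = D.coprod j := by
    ext q <;> rfl
  have hderivL : HasFDerivAt Φ (L : E × (Fin N → ℝ) →L[ℝ] X) 0 := by rwa [hL]
  let F := hΦ.contDiffAt.toOpenPartialHomeomorph Φ hderivL (by simp)
  have hF0 : (0 : E × (Fin N → ℝ)) ∈ F.source :=
    hΦ.contDiffAt.mem_toOpenPartialHomeomorph_source hderivL (by simp)
  have hcf : Continuous (fderiv ℝ Φ) := hΦ.continuous_fderiv (by simp)
  have hO1 : IsOpen {q | fderiv ℝ Φ q ∈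
      Set.range ((↑) : ((E × (Fin N → ℝ)) ≃L[ℝ] X) → (E × (Fin N → ℝ) →L[ℝ] X))} :=
    ContinuousLinearEquiv.isOpen.preimage hcf
  have hnhds : F.source ∩ {q | fderiv ℝ Φ q ∈
      Set.range ((↑) : ((E × (Fin N → ℝ)) ≃L[ℝ] X) → (E × (Fin N → ℝ) →L[ℝ] X))} ∩
      (Prod.fst ⁻¹' {e | ∀ x, R (A e x) x} ∩ Φ ⁻¹' O) ∈ 𝓝 ((0 : E), (0 : Fin N → ℝ)) := by
    refine inter_mem (inter_mem (F.open_source.mem_nhds hF0) (hO1.mem_nhds ⟨L, ?_⟩))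
      (inter_mem (continuous_fst.continuousAt.preimage_mem_nhds hR)
        (hΦ.continuous.continuousAt.preimage_mem_nhds (hO.mem_nhds ?_)))
    · exact hderivL.fderiv.symm
    · rw [show (((0 : E), (0 : Fin N → ℝ))) = 0 from rfl, hΦ0]
      exact hx₀
  obtain ⟨U₁, U₂, hU₁, h0U₁, hU₂, h0U₂, hU⟩ := mem_nhds_prod_iff'.1 hnhds
  obtain ⟨W₀, hW₀, hprop⟩ := hproper U₁ (hU₁.mem_nhds h0U₁)
  have hjc : Continuous fun τ => x₀ + j τ := by fun_prop
  -- The slice is shrunk into W₀, so that two related slice points are related by a parameter in U₁,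
  -- where Φ is still injective.
  let U₃ : Set (Fin N → ℝ) := U₂ ∩ (fun τ => x₀ + j τ) ⁻¹' interior W₀
  have hU₃ : IsOpen U₃ := hU₂.inter (isOpen_interior.preimage hjc)
  have h0U₃ : (0 : Fin N → ℝ) ∈ U₃ :=
    ⟨h0U₂, by simpa using mem_interior_iff_mem_nhds.2 hW₀⟩
  let F' := F.restrOpen (U₁ ×ˢ U₃) (hU₁.prod hU₃)
  have hsrc : ∀ q ∈ F'.source, q.1 ∈ U₁ ∧ q.2 ∈ U₃ := fun q hq => hq.2
  have hbig : ∀ q ∈ F'.source, q ∈ U₁ ×ˢ U₂ := fun q hq => ⟨hq.2.1, hq.2.2.1⟩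
  have hmem : ∀ q : E × (Fin N → ℝ), q.1 ∈ U₁ → q.2 ∈ U₃ → q ∈ F'.source := fun q h1 h2 =>
    ⟨(hU ⟨h1, h2.1⟩).1.1, h1, h2⟩
  have hcoe : ∀ q, F' q = Φ q := fun q => rfl
  have hdet : ∀ q ∈ F'.source, ∃ L' : (E × (Fin N → ℝ)) ≃L[ℝ] X,
      HasFDerivAt Φ (L' : E × (Fin N → ℝ) →L[ℝ] X) q := by
    intro q hq
    obtain ⟨L', hL'⟩ := (hU (hbig q hq)).1.2
    exact ⟨L', by rw [hL']; exact (hΦ.differentiable (by simp) q).hasFDerivAt⟩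
  have hsm : ∀ x ∈ F'.target, ContDiffAt ℝ ∞ F'.symm x := by
    intro x hx
    obtain ⟨L', hL'⟩ := hdet _ (F'.map_target hx)
    exact F'.contDiffAt_symm hx hL' hΦ.contDiffAt
  have hrel : ∀ x ∈ F'.target, R x (x₀ + j (F'.symm x).2) := by
    intro x hx
    have h1 := (hU (hbig _ (F'.map_target hx))).2.1 (x₀ + j (F'.symm x).2)
    have h2 := F'.right_inv hx
    rw [hcoe] at h2
    simp only [Φ] at h2
    rwa [h2] at h1
  have h0mem : (0 : E × (Fin N → ℝ)) ∈ F'.source := hmem 0 h0U₁ h0U₃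
  refine ⟨F'.target, F'.open_target, ?_, fun x hx => ?_, fun x => (F'.symm x).2, fun x hx =>
    (contDiff_snd.contDiffAt.comp x (hsm x hx)).contDiffWithinAt, fun x hx τ => ?_,
    fun x hx y hy => ⟨fun hxy => ?_, fun hxy => ?_⟩⟩
  · have := F'.map_source h0mem
    rwa [hcoe, hΦ0] at this
  · have h1 := (hU (hbig _ (F'.map_target hx))).2.2
    have h2 := F'.right_inv hx
    rw [hcoe] at h2
    rw [Set.mem_preimage, h2] at h1
    exact h1
  · have hq := F'.map_target hx
    -- Surjectivity: on the source, I ∘ Φ is the second projection, whose derivative is onto.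
    have h1 : HasFDerivAt (fun x => (F'.symm x).2) (fderiv ℝ (fun x => (F'.symm x).2) x)
        (Φ (F'.symm x)) := by
      have h2 := F'.right_inv hx
      rw [hcoe] at h2
      rw [h2]
      exact ((contDiff_snd.contDiffAt.comp x (hsm x hx)).differentiableAt (by simp)).hasFDerivAt
    have h3 := h1.comp (F'.symm x) (hΦ.differentiable (by simp) (F'.symm x)).hasFDerivAt
    have h4 : HasFDerivAt (fun q => (F'.symm (Φ q)).2)
        (ContinuousLinearMap.snd ℝ E (Fin N → ℝ)) (F'.symm x) := by
      refine hasFDerivAt_snd.congr_of_eventuallyEq ?_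
      filter_upwards [F'.open_source.mem_nhds hq] with q hq
      have := F'.left_inv hq
      rw [hcoe] at this
      rw [this]
    have h5 := h3.unique h4
    refine ⟨fderiv ℝ Φ (F'.symm x) (0, τ), ?_⟩
    exact congrArg (fun M : E × (Fin N → ℝ) →L[ℝ] (Fin N → ℝ) => M (0, τ)) h5
  · have hqx := hsrc _ (F'.map_target hx)
    have hqy := hsrc _ (F'.map_target hy)
    -- Related points have related slice points; a small parameter e then gives Φ(e, τ_y) = Φ(0,
    -- τ_x), and injectivity forces τ_x = τ_y.
    have h1 : R (x₀ + j (F'.symm x).2) (x₀ + j (F'.symm y).2) :=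
      htrans (hsymm (hrel x hx)) (htrans hxy (hrel y hy))
    obtain ⟨e, he, hee⟩ := hprop _ (interior_subset hqx.2.2) _ (interior_subset hqy.2.2) h1
    have h2 : F' (e, (F'.symm y).2) = F' (0, (F'.symm x).2) := by
      rw [hcoe, hcoe]
      simp only [Φ, hA0]
      exact hee
    have h3 := F'.injOn (hmem (e, (F'.symm y).2) he hqy.2) (hmem (0, (F'.symm x).2) h0U₁ hqx.2) h2
    exact (congrArg Prod.snd h3).symm
  · have h1 := hrel x hx
    have hxy' : (F'.symm x).2 = (F'.symm y).2 := hxy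
    rw [hxy'] at h1
    exact htrans h1 (hsymm (hrel y hy))

end Slice

/-! ### Prolonged vector fields and the infinitesimal action. -/

section Prolongation

variable {r : ℕ}

theorem infCongrForm_mk (A : Matrix (Fin 2) (Fin 2) ℝ) (b : SymForm) (i j : Fin 2) :
    infCongrForm A b s(i, j) = -∑ s, (b s(i, s) * A s j + b s(s, j) * A s i) := rfl

theorem characteristic_fst (ψ : Base → Base) (a : Matrix (Fin 2) (Fin 2) ℝ) (σ : Base → Fibre)
    (z : Base) (k l : Fin 2) : (characteristic ψ a σ z).1 s(k, l) =
      -∑ s, (gComp s(k, s) (σ z) * pd l ψ z s + gComp s(s, l) (σ z) * pd k ψ z s) -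
        ∑ i, ψ z i * gComp s(k, l) (pd i σ z) := by
  simp only [characteristic, Prod.fst_sub, Pi.sub_apply, infCongrForm_mk, jacobian_apply,
    Fin.sum_univ_two, gComp_apply, Prod.fst_add, Prod.smul_fst, Pi.add_apply, Pi.smul_apply,
    smul_eq_mul]

theorem characteristic_snd (ψ : Base → Base) (a : Matrix (Fin 2) (Fin 2) ℝ) (σ : Base → Fibre)
    (z : Base) (k l : Fin 2) : (characteristic ψ a σ z).2 s(k, l) =
      -∑ s, (hComp s(k, s) (σ z) * a s l + hComp s(s, l) (σ z) * a s k) -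
        ∑ i, ψ z i * hComp s(k, l) (pd i σ z) := by
  simp only [characteristic, Prod.snd_sub, Pi.sub_apply, infCongrForm_mk,
    Fin.sum_univ_two, hComp_apply, Prod.snd_add, Prod.smul_snd, Pi.add_apply, Pi.smul_apply,
    smul_eq_mul]

theorem contDiffAt_characteristic {ψ : Base → Base} {a : Matrix (Fin 2) (Fin 2) ℝ}
    {σ : Base → Fibre} {t : Base} (hψ : ContDiffAt ℝ ∞ ψ t) (hσ : ContDiffAt ℝ ∞ σ t) :
    ContDiffAt ℝ ∞ (characteristic ψ a σ) t := by
  have h1 : ∀ L : Fibre →L[ℝ] ℝ, ContDiffAt ℝ ∞ (fun z => L (σ z)) t := fun L =>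
    L.contDiff.contDiffAt.comp t hσ
  have h2 : ∀ (L : Fibre →L[ℝ] ℝ) i, ContDiffAt ℝ ∞ (fun z => L (pd i σ z)) t := fun L i =>
    L.contDiff.contDiffAt.comp t (hσ.pd i)
  have h3 := fun i => contDiffAt_pi.1 hψ i
  have h4 := fun k i => contDiffAt_pi.1 (hψ.pd k) i
  refine contDiffAt_fibre (fun k l => ?_) fun k l => ?_
  · simp only [characteristic_fst]
    exact (ContDiffAt.sum fun s _ => ((h1 _).mul (h4 _ _)).add ((h1 _).mul (h4 _ _))).neg.sub
      (ContDiffAt.sum fun i _ => (h3 i).mul (h2 _ i))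
  · simp only [characteristic_snd]
    exact (ContDiffAt.sum fun s _ => ((h1 _).mul contDiffAt_const).add
      ((h1 _).mul contDiffAt_const)).neg.sub (ContDiffAt.sum fun i _ => (h3 i).mul (h2 _ i))

theorem hasDerivAt_fibre {f : ℝ → Fibre} {v : Fibre} {x : ℝ}
    (h1 : ∀ k l, HasDerivAt (fun y => (f y).1 s(k, l)) (v.1 s(k, l)) x)
    (h2 : ∀ k l, HasDerivAt (fun y => (f y).2 s(k, l)) (v.2 s(k, l)) x) : HasDerivAt f v x :=
  (hasDerivAt_pi.2 fun s => Sym2.ind h1 s).prodMk (hasDerivAt_pi.2 fun s => Sym2.ind h2 s)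

theorem pd_id_add_smul {ψ : Base → Base} {z : Base} (hψ : DifferentiableAt ℝ ψ z) (s : ℝ)
    (k i : Fin 2) : pd k (fun y => y + s • ψ y) z i =
      (1 : Matrix (Fin 2) (Fin 2) ℝ) i k + s * pd k ψ z i := by
  have h := ((hasFDerivAt_id z).add (hψ.hasFDerivAt.const_smul s)).fderiv
  have h' : fderiv ℝ (fun y => y + s • ψ y) z = _ := h
  simp [pd, h', Matrix.one_apply, Pi.single_apply]

theorem hasDerivAt_congrForm {J : ℝ → Matrix (Fin 2) (Fin 2) ℝ} {B : Matrix (Fin 2) (Fin 2) ℝ}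
    {b : ℝ → SymForm} {c : SymForm} (hJ : ∀ i k, HasDerivAt (fun s => J s i k) (B i k) 0)
    (hJ0 : J 0 = 1) (hb : ∀ k l, HasDerivAt (fun s => b s s(k, l)) (c s(k, l)) 0) (k l : Fin 2) :
    HasDerivAt (fun s => congrForm (J s) (b s) s(k, l))
      (-infCongrForm B (b 0) s(k, l) + c s(k, l)) 0 := by
  have h := HasDerivAt.fun_sum (u := Finset.univ) fun i (_ : i ∈ Finset.univ) =>
    HasDerivAt.fun_sum (u := Finset.univ) fun j (_ : j ∈ Finset.univ) =>
      ((hJ i k).mul (hJ j l)).mul (hb i j)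
  simp only [congrForm_mk]
  refine h.congr_deriv ?_
  simp only [infCongrForm_mk, hJ0, Fin.sum_univ_two, Matrix.one_apply, Pi.mul_apply]
  fin_cases k <;> fin_cases l <;> simp [swap_eq] <;> ring

/-- Minus the characteristic is the velocity of the transformed section. -/
theorem hasDerivAt_tS {ψ : Base → Base} (a : Matrix (Fin 2) (Fin 2) ℝ) {σ : Base → Fibre} {z : Base}
    (hψ : DifferentiableAt ℝ ψ z) (hσ : DifferentiableAt ℝ σ z) :
    HasDerivAt (fun s : ℝ => tS (fun y => y + s • ψ y) (1 + s • a) σ z)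
      (-characteristic ψ a σ z) 0 := by
  have h1 : HasDerivAt (fun s : ℝ => z + s • ψ z) (ψ z) 0 := by
    simpa using ((hasDerivAt_id (0 : ℝ)).smul_const (ψ z)).const_add z
  have h2 : HasDerivAt (fun s : ℝ => σ (z + s • ψ z)) (fderiv ℝ σ z (ψ z)) 0 := by
    refine HasFDerivAt.comp_hasDerivAt (0 : ℝ) ?_ h1
    simpa using hσ.hasFDerivAt
  have h3 : fderiv ℝ σ z (ψ z) = ∑ i, ψ z i • pd i σ z := by
    conv_lhs => rw [pi_eq_sum_univ' (ψ z)]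
    simp [pd]
  have hb1 : ∀ k l, HasDerivAt (fun s : ℝ => (σ (z + s • ψ z)).1 s(k, l))
      ((∑ i, ψ z i • pd i σ z).1 s(k, l)) 0 := fun k l => by
    rw [← h3]
    exact (gComp s(k, l)).hasFDerivAt.comp_hasDerivAt (0 : ℝ) h2
  have hb2 : ∀ k l, HasDerivAt (fun s : ℝ => (σ (z + s • ψ z)).2 s(k, l))
      ((∑ i, ψ z i • pd i σ z).2 s(k, l)) 0 := fun k l => by
    rw [← h3]
    exact (hComp s(k, l)).hasFDerivAt.comp_hasDerivAt (0 : ℝ) h2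
  have hlin : ∀ x y : ℝ, HasDerivAt (fun s : ℝ => x + s * y) y 0 := fun x y => by
    simpa using ((hasDerivAt_id (0 : ℝ)).mul_const y).const_add x
  have hJ : ∀ i k, HasDerivAt (fun s : ℝ => jacobian (fun y => y + s • ψ y) z i k)
      (jacobian ψ z i k) 0 := fun i k => by
    simp only [jacobian_apply, pd_id_add_smul hψ]
    exact hlin _ _
  have hJ0 : jacobian (fun y => y + (0 : ℝ) • ψ y) z = 1 := by
    simpa using jacobian_id z
  have hA : ∀ i k, HasDerivAt (fun s : ℝ => (1 + s • a) i k) (a i k) 0 := fun i k => hlin _ _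
  refine hasDerivAt_fibre (fun k l => ?_) fun k l => ?_
  · refine (hasDerivAt_congrForm hJ hJ0 hb1 k l).congr_deriv ?_
    simp [characteristic]
    ring
  · refine (hasDerivAt_congrForm hA (by simp) hb2 k l).congr_deriv ?_
    simp [characteristic]
    ring

/-- Time and space derivatives commute, so the velocity of the jet is the jet of the velocity of the
section, which is minus the characteristic. -/
theorem infAct_eq (θ : JetFibre r) (w : Param r) : infAct θ w =
    -jetAt r (characteristic (polyMap posPair w.1) (Matrix.of w.2) (polySec θ)) 0 := by
  have hψ := contDiff_polyMap (posPair (r := r)) w.1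
  have hσ := contDiff_polySec θ
  have e1 : ∀ s : ℝ, paramMap (s • w) = fun y => y + s • polyMap posPair w.1 y := by
    intro s
    funext y
    simp only [paramMap, polyMap, Finset.smul_sum, Prod.smul_fst, Pi.smul_apply]
    congr 1
    exact Finset.sum_congr rfl fun J _ => smul_comm _ _ _
  have e2 : ∀ s : ℝ, paramMatrix (s • w) = 1 + s • Matrix.of w.2 := fun s => rfl
  let F : ℝ × Base → Fibre := fun q => tS (fun y => y + q.1 • polyMap posPair w.1 y)
    (1 + q.1 • Matrix.of w.2) (polySec θ) q.2
  have hm : ContDiff ℝ ∞ fun q : ℝ × Base => q.2 + q.1 • polyMap posPair w.1 q.2 :=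
    contDiff_snd.add (contDiff_fst.smul (hψ.comp contDiff_snd))
  have hF : ContDiff ℝ ∞ F := contDiff_tS_param (φ := fun s y => y + s • polyMap posPair w.1 y)
    (A := fun s => 1 + s • Matrix.of w.2) (σ := fun _ => polySec θ) hm
    (fun i k => contDiff_const.add (contDiff_id.mul contDiff_const)) (hσ.comp hm)
  have h1 : (fun z => timeDeriv F (0, z)) = fun z =>
      -characteristic (polyMap posPair w.1) (Matrix.of w.2) (polySec θ) z := by
    funext z
    exact (hasDerivAt_timeDeriv hF 0 z).unique (hasDerivAt_tS (Matrix.of w.2)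
      (hψ.differentiable (by simp) z) (hσ.differentiable (by simp) z))
  refine (hasDerivAt_act_smul θ w).unique (hasDerivAt_pi.2 fun J => ?_)
  have h2 := hasDerivAt_mpd hF J.1.1 J.1.2 0 0
  rw [h1] at h2
  have h3 := (mpd_clm (-ContinuousLinearMap.id ℝ Fibre) (contDiffAt_characteristic
    (a := Matrix.of w.2) (hψ.contDiffAt (x := 0)) hσ.contDiffAt) J.1.1 J.1.2).self_of_nhds
  simp only [neg_apply, ContinuousLinearMap.id_apply] at h3
  rw [h3] at h2
  simp only [act, e1, e2]
  exact h2

/-- The term ψⁱ ∂ᵢσ seems to require the (r+1)-jet of σ; the vanishing of ψ' at t removes the top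
derivatives. -/
theorem jetAt_characteristic_congr {ψ ψ' : Base → Base} {a : Matrix (Fin 2) (Fin 2) ℝ}
    {σ σ' : Base → Fibre} {t : Base} (hψ0 : ψ' t = 0) (sψ : ContDiffAt ℝ ∞ ψ t)
    (sψ' : ContDiffAt ℝ ∞ ψ' t) (sσ : ContDiffAt ℝ ∞ σ t) (sσ' : ContDiffAt ℝ ∞ σ' t)
    (hψ : ∀ a b, a + b ≤ r + 1 → mpd a b ψ t = mpd a b ψ' t) (hσ : jetAt r σ t = jetAt r σ' t) :
    jetAt r (characteristic ψ a σ) t = jetAt r (characteristic ψ' a σ') t := by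
  have hbp := idealPair_top_bot (ι := Unit)
  have cψ : ∀ s, Close (⊥ : AddSubgroup (Unit → ℝ)) (fun _ => t) (r + 2) (fun _ z => ψ z s)
      fun _ z => ψ' z s := by
    intro s
    rw [close_iff_mpd (fun _ => contDiffAt_pi.1 sψ s) fun _ => contDiffAt_pi.1 sψ' s]
    intro a b hab
    rw [AddSubgroup.mem_bot]
    funext _
    have h1 := (mpd_clm (ContinuousLinearMap.proj (R := ℝ) (φ := fun _ : Fin 2 => ℝ) s) sψ a
      b).self_of_nhds
    have h2 := (mpd_clm (ContinuousLinearMap.proj (R := ℝ) (φ := fun _ : Fin 2 => ℝ) s) sψ' a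
      b).self_of_nhds
    simp only [ContinuousLinearMap.proj_apply] at h1 h2
    rw [h1, h2, hψ a b (by omega), sub_self]
    rfl
  have cJ : ∀ k i, Close (⊥ : AddSubgroup (Unit → ℝ)) (fun _ => t) (r + 1) (fun _ z => pd k ψ z i)
      fun _ z => pd k ψ' z i := fun k i =>
    ((cψ i).pd (fun _ => contDiffAt_pi.1 sψ i) (fun _ => contDiffAt_pi.1 sψ' i) k).congr
      (fun _ => (pd_coord sψ k i).symm) fun _ => (pd_coord sψ' k i).symm
  rw [jetAt_eq_iff (contDiffAt_characteristic sψ sσ) (contDiffAt_characteristic sψ' sσ')]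
  rw [jetAt_eq_iff sσ sσ'] at hσ
  have sv : ∀ i, SmoothFamily (fun _ : Unit => t) fun _ z => ψ z i :=
    fun i _ => contDiffAt_pi.1 sψ i
  have sv' : ∀ i, SmoothFamily (fun _ : Unit => t) fun _ z => ψ' z i :=
    fun i _ => contDiffAt_pi.1 sψ' i
  have sJ : ∀ k i, SmoothFamily (fun _ : Unit => t) fun _ z => pd k ψ z i :=
    fun k i _ => contDiffAt_pi.1 (sψ.pd k) i
  have sJ' : ∀ k i, SmoothFamily (fun _ : Unit => t) fun _ z => pd k ψ' z i :=
    fun k i _ => contDiffAt_pi.1 (sψ'.pd k) i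
  have sL : ∀ L : Fibre →L[ℝ] ℝ, SmoothFamily (fun _ : Unit => t) fun _ z => L (σ z) :=
    fun L _ => L.contDiff.contDiffAt.comp t sσ
  have sL' : ∀ L : Fibre →L[ℝ] ℝ, SmoothFamily (fun _ : Unit => t) fun _ z => L (σ' z) :=
    fun L _ => L.contDiff.contDiffAt.comp t sσ'
  have sD : ∀ (L : Fibre →L[ℝ] ℝ) i, SmoothFamily (fun _ : Unit => t) fun _ z => L (pd i σ z) :=
    fun L i _ => L.contDiff.contDiffAt.comp t (sσ.pd i)
  have sD' : ∀ (L : Fibre →L[ℝ] ℝ) i, SmoothFamily (fun _ : Unit => t) fun _ z => L (pd i σ' z) :=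
    fun L i _ => L.contDiff.contDiffAt.comp t (sσ'.pd i)
  have cc : ∀ c : ℝ, SmoothFamily (fun _ : Unit => t) fun _ _ => c := fun c _ => contDiffAt_const
  have cT : ∀ (L : Fibre →L[ℝ] ℝ) i, Close (⊥ : AddSubgroup (Unit → ℝ)) (fun _ => t) (r + 1)
      (fun _ z => L (σ z)) (fun _ z => L (σ' z)) → Close (⊥ : AddSubgroup (Unit → ℝ)) (fun _ => t)
      (r + 1) (fun _ z => ψ z i * L (pd i σ z)) fun _ z => ψ' z i * L (pd i σ' z) := by
    intro L i hL
    have h1 : Close (⊥ : AddSubgroup (Unit → ℝ)) (fun _ => t) r (fun _ z => L (pd i σ z))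
        fun _ z => L (pd i σ' z) :=
      (hL.pd (sL L) (sL' L) i).congr (fun _ => pd_clm L sσ i) fun _ => pd_clm L sσ' i
    have h2 : Close (⊥ : AddSubgroup (Unit → ℝ)) (fun _ => t) (r + 1)
        (fun _ z => ψ z i * L (pd i σ z)) fun _ z => ψ' z i * L (pd i σ z) :=
      Close.mul hbp ((cψ i).of_le (by omega)) (Close.refl _) (jetwise_top _) (jetwise_top _) (sv i)
        (sv' i) (sD L i) (sD L i)
    -- The difference of the ∂ᵢσ is controlled only below order r; the factor ψ', zero at t,
    -- supplies the missing order.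
    have h3 : Close (⊥ : AddSubgroup (Unit → ℝ)) (fun _ => t) (r + 1)
        (fun _ z => ψ' z i * L (pd i σ z)) fun _ z => ψ' z i * L (pd i σ' z) :=
      (Jetwise.mul_succ hbp (jetwise_top _) (fun u _ => by
        rw [AddSubgroup.mem_bot]
        funext _
        simp [hψ0]) h1 (jetwise_top _) (sv' i) ((sD L i).sub (sD' L i))).congr fun _ =>
          Eventually.of_forall fun z => mul_sub _ _ _
    exact h2.trans h3 ((sv i).mul (sD L i)) ((sv' i).mul (sD L i)) ((sv' i).mul (sD' L i))
  have cS : ∀ (L : Fibre →L[ℝ] ℝ), Close (⊥ : AddSubgroup (Unit → ℝ)) (fun _ => t) (r + 1)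
      (fun _ z => L (σ z)) (fun _ z => L (σ' z)) → Close (⊥ : AddSubgroup (Unit → ℝ)) (fun _ => t)
      (r + 1) (fun _ z => ∑ i, ψ z i * L (pd i σ z)) fun _ z => ∑ i, ψ' z i * L (pd i σ' z) :=
    fun L hL => Close.sum (fun i _ => cT L i hL) (fun i _ => (sv i).mul (sD L i))
      fun i _ => (sv' i).mul (sD' L i)
  have cM : ∀ (L : Fibre →L[ℝ] ℝ) (f f' : Base → ℝ), Close (⊥ : AddSubgroup (Unit → ℝ)) (fun _ => t)
      (r + 1) (fun _ z => L (σ z)) (fun _ z => L (σ' z)) →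
      SmoothFamily (fun _ : Unit => t) (fun _ => f) →
      SmoothFamily (fun _ : Unit => t) (fun _ => f') →
      Close (⊥ : AddSubgroup (Unit → ℝ)) (fun _ => t) (r + 1) (fun _ => f) (fun _ => f') →
      Close (⊥ : AddSubgroup (Unit → ℝ)) (fun _ => t) (r + 1) (fun _ z => L (σ z) * f z)
        fun _ z => L (σ' z) * f' z := fun L f f' hL sf sf' hf =>
    Close.mul hbp hL hf (jetwise_top _) (jetwise_top _) (sL L) (sL' L) sf sf'
  have cD : ∀ F F' G G' : Base → ℝ,
      SmoothFamily (fun _ : Unit => t) (fun _ => F) →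
      SmoothFamily (fun _ : Unit => t) (fun _ => F') →
      SmoothFamily (fun _ : Unit => t) (fun _ => G) →
      SmoothFamily (fun _ : Unit => t) (fun _ => G') →
      Close (⊥ : AddSubgroup (Unit → ℝ)) (fun _ => t) (r + 1) (fun _ => F) (fun _ => F') →
      Close (⊥ : AddSubgroup (Unit → ℝ)) (fun _ => t) (r + 1) (fun _ => G) (fun _ => G') →
      Close (⊥ : AddSubgroup (Unit → ℝ)) (fun _ => t) (r + 1) (fun _ z => -F z - G z)
        fun _ z => -F' z - G' z := fun F F' G G' sF sF' sG sG' hF hG =>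
    (Jetwise.neg (Jetwise.add hF hG (sF.sub sF') (sG.sub sG'))).congr fun _ =>
      Eventually.of_forall fun z => by ring
  have cA : ∀ F F' G G' : Base → ℝ,
      SmoothFamily (fun _ : Unit => t) (fun _ => F) →
      SmoothFamily (fun _ : Unit => t) (fun _ => F') →
      SmoothFamily (fun _ : Unit => t) (fun _ => G) →
      SmoothFamily (fun _ : Unit => t) (fun _ => G') →
      Close (⊥ : AddSubgroup (Unit → ℝ)) (fun _ => t) (r + 1) (fun _ => F) (fun _ => F') →
      Close (⊥ : AddSubgroup (Unit → ℝ)) (fun _ => t) (r + 1) (fun _ => G) (fun _ => G') →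
      Close (⊥ : AddSubgroup (Unit → ℝ)) (fun _ => t) (r + 1) (fun _ z => F z + G z)
        fun _ z => F' z + G' z := fun F F' G G' sF sF' sG sG' hF hG =>
    (Jetwise.add hF hG (sF.sub sF') (sG.sub sG')).congr fun _ =>
      Eventually.of_forall fun z => by ring
  have sS : ∀ L : Fibre →L[ℝ] ℝ, SmoothFamily (fun _ : Unit => t) fun _ z =>
      ∑ i, ψ z i * L (pd i σ z) := fun L => SmoothFamily.sum fun i _ => (sv i).mul (sD L i)
  have sS' : ∀ L : Fibre →L[ℝ] ℝ, SmoothFamily (fun _ : Unit => t) fun _ z =>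
      ∑ i, ψ' z i * L (pd i σ' z) := fun L => SmoothFamily.sum fun i _ => (sv' i).mul (sD' L i)
  constructor
  · intro s
    induction s using Sym2.ind with
    | _ k l =>
      simp only [characteristic_fst]
      refine cD _ _ _ _ (SmoothFamily.sum fun s _ => ((sL _).mul (sJ l s)).add ((sL _).mul (sJ k s)))
        (SmoothFamily.sum fun s _ => ((sL' _).mul (sJ' l s)).add ((sL' _).mul (sJ' k s)))
        (sS _) (sS' _) (Close.sum (fun s _ => cA _ _ _ _ ((sL _).mul (sJ l s))
          ((sL' _).mul (sJ' l s)) ((sL _).mul (sJ k s)) ((sL' _).mul (sJ' k s))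
          (cM _ _ _ (hσ.1 _) (sJ l s) (sJ' l s) (cJ l s))
          (cM _ _ _ (hσ.1 _) (sJ k s) (sJ' k s) (cJ k s)))
          (fun s _ => ((sL _).mul (sJ l s)).add ((sL _).mul (sJ k s)))
          (fun s _ => ((sL' _).mul (sJ' l s)).add ((sL' _).mul (sJ' k s)))) (cS _ (hσ.1 _))
  · intro s
    induction s using Sym2.ind with
    | _ k l =>
      simp only [characteristic_snd]
      refine cD _ _ _ _ (SmoothFamily.sum fun s _ => ((sL _).mul (cc _)).add ((sL _).mul (cc _)))
        (SmoothFamily.sum fun s _ => ((sL' _).mul (cc _)).add ((sL' _).mul (cc _)))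
        (sS _) (sS' _) (Close.sum (fun s _ => cA _ _ _ _ ((sL _).mul (cc _))
          ((sL' _).mul (cc _)) ((sL _).mul (cc _)) ((sL' _).mul (cc _))
          (cM _ _ _ (hσ.2 _) (cc _) (cc _) (Close.refl _))
          (cM _ _ _ (hσ.2 _) (cc _) (cc _) (Close.refl _)))
          (fun s _ => ((sL _).mul (cc _)).add ((sL _).mul (cc _)))
          (fun s _ => ((sL' _).mul (cc _)).add ((sL' _).mul (cc _)))) (cS _ (hσ.2 _))

/-- The fibre component of a prolonged vector, with the transport terms removed by translation. -/
theorem prolonged_eq_jetAt {ψ : Base → Base} {a : Matrix (Fin 2) (Fin 2) ℝ} {σ : Base → Fibre}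
    {t : Base} (sψ : ContDiffAt ℝ ∞ ψ t) (sσ : ContDiffAt ℝ ∞ σ t) :
    (fun J : MultiIdx r => mpd (J.1.1 : ℕ) (J.1.2 : ℕ) (characteristic ψ a σ) t +
        ∑ i, ψ t i • mpd (J.1.1 : ℕ) (J.1.2 : ℕ) (pd i σ) t) =
      jetAt r (characteristic (fun z => ψ (t + z) - ψ t) a fun z => σ (t + z)) 0 := by
  have h1 : (characteristic (fun z => ψ (t + z) - ψ t) a fun z => σ (t + z)) = fun z =>
      (fun y => characteristic ψ a σ y + (ψ t 0 • pd 0 σ y + ψ t 1 • pd 1 σ y)) (t + z) := by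
    funext z
    simp only [characteristic, jacobian_translate, pd_translate, Fin.sum_univ_two, Pi.sub_apply,
      sub_smul]
    abel
  have s1 : ∀ i, ContDiffAt ℝ ∞ (fun y => ψ t i • pd i σ y) t := fun i =>
    (sσ.pd i).const_smul (ψ t i)
  rw [h1, jetAt_translate (fun y => characteristic ψ a σ y + (ψ t 0 • pd 0 σ y + ψ t 1 • pd 1 σ y))]
  funext J
  have h2 := fun i => (mpd_clm (ψ t i • ContinuousLinearMap.id ℝ Fibre) (sσ.pd i) J.1.1
    J.1.2).self_of_nhds
  simp only [smul_apply, ContinuousLinearMap.id_apply] at h2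
  rw [jetAt, (mpd_add (contDiffAt_characteristic sψ sσ) ((s1 0).add (s1 1)) _ _).self_of_nhds]
  simp only
  rw [(mpd_add (s1 0) (s1 1) _ _).self_of_nhds]
  simp only
  rw [h2, h2, Fin.sum_univ_two]

/-- The value ψ(t) moves only the base point and is arbitrary, so nothing is required of v.1. The
higher Taylor coefficients of ψ and the matrix a make up the parameter w, up to the sign of
`infAct_eq`. -/
theorem isProlongedVector_iff {S : Set Base} (hS : IsOpen S) {θ v : Jet r} (hθ : θ.1 ∈ S) :
    IsProlongedVector S r θ v ↔ ∃ w, v.2 = infAct θ.2 w := by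
  constructor
  · rintro ⟨ψ, a, σ, hψ, hσ, hj, rfl⟩
    have sψ : ContDiffAt ℝ ∞ ψ θ.1 := hψ.contDiffAt (hS.mem_nhds hθ)
    have sσ : ContDiffAt ℝ ∞ σ θ.1 := hσ.contDiffAt (hS.mem_nhds hθ)
    have hθ2 : jetAt r σ θ.1 = θ.2 := congrArg Prod.snd hj
    let ψ₁ : Base → Base := fun z => ψ (θ.1 + z) - ψ θ.1
    let w : Param r := (fun J => mpd (posPair J).1 (posPair J).2 ψ₁ 0, fun i j => a i j)
    have st : ContDiffAt ℝ ∞ (fun z : Base => θ.1 + z) 0 := contDiffAt_const.add contDiffAt_id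
    have sψ₁ : ContDiffAt ℝ ∞ ψ₁ 0 :=
      (ContDiffAt.comp (0 : Base) (by simpa using sψ) st).sub contDiffAt_const
    have sσ₁ : ContDiffAt ℝ ∞ (fun z => σ (θ.1 + z)) 0 :=
      ContDiffAt.comp (0 : Base) (by simpa using sσ) st
    refine ⟨-w, ?_⟩
    rw [map_neg, infAct_eq, neg_neg]
    refine (prolonged_eq_jetAt sψ sσ).trans ?_
    refine jetAt_characteristic_congr (polyMap_posPair_zero _) sψ₁
      (contDiff_polyMap _ _).contDiffAt sσ₁ (contDiff_polySec _).contDiffAt (fun b c hbc => ?_) ?_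
    · by_cases h0 : 0 < b + c
      · obtain ⟨J, hJ⟩ := exists_posPair hbc h0
        have h1 := mpd_polyMap posPair_injective w.1 J
        rw [hJ] at h1
        rw [h1]
        simp only [w, hJ]
        rfl
      · obtain ⟨rfl, rfl⟩ : b = 0 ∧ c = 0 := by omega
        have h1 : polyMap posPair w.1 0 = 0 := polyMap_posPair_zero _
        show ψ₁ 0 = polyMap posPair w.1 0
        rw [h1]
        simp [ψ₁]
    · rw [jetAt_translate, hθ2, jetAt_polySec]
  · rintro ⟨w, hw⟩
    have st : ContDiff ℝ ∞ fun x : Base => x - θ.1 := contDiff_id.sub contDiff_const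
    let ψ : Base → Base := fun x => v.1 + polyMap posPair (-w).1 (x - θ.1)
    let σ : Base → Fibre := fun x => polySec θ.2 (x - θ.1)
    have sψ : ContDiff ℝ ∞ ψ := contDiff_const.add ((contDiff_polyMap _ _).comp st)
    have sσ : ContDiff ℝ ∞ σ := (contDiff_polySec _).comp st
    have hψ0 : ψ θ.1 = v.1 := by simp [ψ, polyMap_posPair_zero]
    have hσ₁ : (fun z => σ (θ.1 + z)) = polySec θ.2 := by
      funext z
      simp [σ]
    have hψ₁ : (fun z => ψ (θ.1 + z) - ψ θ.1) = polyMap posPair (-w).1 := by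
      funext z
      rw [hψ0]
      simp [ψ]
    refine ⟨ψ, Matrix.of (-w).2, σ, sψ.contDiffOn, sσ.contDiffOn, Prod.ext rfl ?_, Prod.ext hψ0.symm ?_⟩
    · show jetAt r σ θ.1 = θ.2
      rw [← jetAt_translate, hσ₁, jetAt_polySec]
    · refine Eq.trans ?_ (prolonged_eq_jetAt sψ.contDiffAt sσ.contDiffAt).symm
      rw [hψ₁, hσ₁, hw, ← neg_neg w, map_neg, infAct_eq, neg_neg, neg_neg]

end Prolongation

/-! ### Orbit space dimension and number of invariants. -/

section Counting

variable {r : ℕ}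

theorem eventually_jetRel : ∀ᶠ m in 𝓝 (0 : Param r), ∀ θ, JetRel (act m θ) θ := by
  have hM : ContDiff ℝ ∞ fun q : Param r × Base => paramMap q.1 q.2 :=
    contDiff_snd.add (contDiff_polyMap_param _ (contDiff_fst.comp contDiff_fst) contDiff_snd)
  have hJ : ∀ i k, Continuous fun m : Param r => jacobian (paramMap m) 0 i k := by
    intro i k
    simp only [jacobian_apply]
    fin_cases k
    · exact (contDiff_pi.1 (contDiff_mpd_const hM 1 0 0) i).continuous
    · exact (contDiff_pi.1 (contDiff_mpd_const hM 0 1 0) i).continuous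
  have hJc : Continuous fun m : Param r => (jacobian (paramMap m) 0).det :=
    (continuous_matrix hJ).matrix_det
  have hAc : Continuous fun m : Param r => (paramMatrix m).det :=
    (continuous_matrix fun i k => (contDiff_paramMatrix i k).continuous).matrix_det
  have h1 : paramMap (0 : Param r) = fun z => z := by
    funext z
    simp [paramMap, polyMap]
  have h2 : paramMatrix (0 : Param r) = 1 := by
    ext i j
    simp [paramMatrix]
  filter_upwards [hJc.continuousAt.eventually_ne (y := 0) (by simp [h1, jacobian_id]),
    hAc.continuousAt.eventually_ne (y := 0) (by simp [h2])] with m hm1 hm2 θ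
  exact ⟨m, hm1, hm2, rfl⟩

/-- Functions constant on the classes of `JetRel` are annihilated by the infinitesimal action. -/
theorem fderiv_infAct_eq_zero {F : Type*} [NormedAddCommGroup F] [NormedSpace ℝ F]
    {I : JetFibre r → F} {W : Set (JetFibre r)} (hW : IsOpen W)
    (hI : ∀ x ∈ W, ∀ y ∈ W, JetRel x y → I x = I y) {θ : JetFibre r} (hθ : θ ∈ W)
    (hd : DifferentiableAt ℝ I θ) (w : Param r) : fderiv ℝ I θ (infAct θ w) = 0 := by
  have h1 := hasDerivAt_act_smul θ w
  have h2 : HasDerivAt (fun s : ℝ => I (act (s • w) θ)) (fderiv ℝ I θ (infAct θ w)) 0 := by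
    refine HasFDerivAt.comp_hasDerivAt (0 : ℝ) ?_ h1
    rw [zero_smul, act_zero]
    exact hd.hasFDerivAt
  have hs : Tendsto (fun s : ℝ => s • w) (𝓝 0) (𝓝 0) := by
    have : Continuous fun s : ℝ => s • w := by fun_prop
    simpa using this.tendsto 0
  have hc : ∀ᶠ s : ℝ in 𝓝 0, act (s • w) θ ∈ W := by
    have h3 := h1.continuousAt
    refine h3.eventually (hW.mem_nhds ?_)
    show act ((0 : ℝ) • w) θ ∈ W
    rwa [zero_smul, act_zero]
  have h4 : (fun s : ℝ => I (act (s • w) θ)) =ᶠ[𝓝 0] fun _ => I θ := by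
    filter_upwards [hc, hs.eventually eventually_jetRel] with s h5 h6
    exact hI _ h5 _ hθ (h6 θ)
  exact h2.unique ((hasDerivAt_const (0 : ℝ) (I θ)).congr_of_eventuallyEq h4)

/-- Independent functionals annihilated by the prolonged vectors. -/
theorem card_le_of_annihilates {E X B : Type*} [NormedAddCommGroup E] [NormedSpace ℝ E]
    [NormedAddCommGroup X] [NormedSpace ℝ X] [FiniteDimensional ℝ X] [NormedAddCommGroup B]
    [NormedSpace ℝ B] [FiniteDimensional ℝ B] {D : E →L[ℝ] X} {N m : ℕ}
    (hN : Module.finrank ℝ (LinearMap.range (D : E →ₗ[ℝ] X)) + N = Module.finrank ℝ X)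
    {l : Fin m → (B × X →L[ℝ] ℝ)} (hl : LinearIndependent ℝ l)
    (h : ∀ n b e, l n (b, D e) = 0) : m ≤ N := by
  set R := LinearMap.range (D : E →ₗ[ℝ] X)
  let k : Fin m → R.dualAnnihilator := fun n =>
    ⟨(l n : B × X →ₗ[ℝ] ℝ) ∘ₗ LinearMap.inr ℝ B X, by
      rw [Submodule.mem_dualAnnihilator]
      rintro _ ⟨e, rfl⟩
      exact h n 0 e⟩
  let T : R.dualAnnihilator →ₗ[ℝ] (B × X →L[ℝ] ℝ) :=
    { toFun := fun φ => LinearMap.toContinuousLinearMap ((φ : Module.Dual ℝ X) ∘ₗ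
        LinearMap.snd ℝ B X)
      map_add' := fun φ φ' => by ext <;> simp
      map_smul' := fun c φ => by ext <;> simp }
  have hT : T ∘ k = l := by
    funext n
    refine ContinuousLinearMap.ext fun q => ?_
    -- Taking e = 0 shows that base directions are annihilated, so each functional comes from the
    -- dual of X and lies in the annihilator of the range, of dimension N.
    have h1 : l n (q.1, 0) = 0 := by simpa using h n q.1 0
    have h2 : l n q = l n (q.1, 0) + l n (0, q.2) := by
      rw [← map_add]
      simp
    rw [h2, h1, zero_add]
    rfl
  have hk : LinearIndependent ℝ k := LinearIndependent.of_comp T (by rwa [hT])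
  have h1 := hk.fintype_card_le_finrank
  have h2 := Subspace.finrank_add_finrank_dualAnnihilator_eq R
  rw [Fintype.card_fin] at h1
  omega

/-- The given point may have a smaller orbit direction space. Independence of continuously varying
differentials persists nearby, and some nearby jet lies over D, where the rank is as expected. -/
theorem invariant_count_le {S : Set Base} (hS : IsOpen S) {N : ℕ} {D : Set (JetFibre r)}
    (hD : Dense D) (hrank : ∀ θ ∈ D, Module.finrank ℝ (LinearMap.range
      (infAct θ : Param r →ₗ[ℝ] JetFibre r)) + N = Module.finrank ℝ (JetFibre r))
    {U : Set (Jet r)} (hU : IsOpen U) (hUS : U ⊆ jetSpace S r) {m : ℕ} {f : Fin m → Jet r → ℝ}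
    (hf : ∀ n, IsScalarInvariant S r U (f n)) {η : Jet r} (hη : η ∈ U)
    (hl : LinearIndependent ℝ fun n => fderiv ℝ (f n) η) : m ≤ N := by
  have hc : ContinuousOn (fun η n => fderiv ℝ (f n) η) U :=
    continuousOn_pi.2 fun n => (hf n).1.continuousOn_fderiv_of_isOpen hU (by simp)
  have hO : IsOpen (U ∩ (fun η n => fderiv ℝ (f n) η) ⁻¹' {l | LinearIndependent ℝ l}) :=
    hc.isOpen_inter_preimage hU isOpen_setOfPred_linearIndependent
  have hd : Dense (Prod.snd ⁻¹' D : Set (Jet r)) := hD.preimage isOpenMap_snd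
  obtain ⟨ζ, ⟨hζU, hζl⟩, hζD⟩ := hd.inter_open_nonempty _ hO ⟨η, hη, hl⟩
  exact card_le_of_annihilates (hrank _ hζD) hζl fun n b e =>
    (hf n).2 ζ hζU _ ((isProlongedVector_iff hS (hUS hζU)).2 ⟨e, rfl⟩)

/-- Local slices on a dense open invariant set of jet fibres determine the dimension of the orbit
space and the number of independent invariants. -/
theorem orbitSpaceDim_and_invariantCount {S : Set Base} (hS : IsOpen S) {N : ℕ}
    {D : Set (JetFibre r)} (hDo : IsOpen D) (hDd : Dense D)
    (hDi : ∀ θ ∈ D, ∀ θ', JetRel θ θ' → θ' ∈ D)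
    (hrank : ∀ θ ∈ D, Module.finrank ℝ (LinearMap.range
      (infAct θ : Param r →ₗ[ℝ] JetFibre r)) + N = Module.finrank ℝ (JetFibre r))
    (hslice : ∀ θ ∈ D, ∃ W : Set (JetFibre r), IsOpen W ∧ θ ∈ W ∧ W ⊆ D ∧
      ∃ I : JetFibre r → Fin N → ℝ, ContDiffOn ℝ ∞ I W ∧
        (∀ x ∈ W, Function.Surjective (fderiv ℝ I x)) ∧
        ∀ x ∈ W, ∀ y ∈ W, JetRel x y ↔ I x = I y) :
    HasOrbitSpaceDim S r N ∧ HasInvariantCount S r N := by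
  have hprod : ∀ W : Set (JetFibre r), IsOpen W → IsOpen (S ×ˢ W : Set (Jet r)) := fun W hW =>
    hS.prod hW
  have hsub : (S ×ˢ D : Set (Jet r)) ⊆ jetSpace S r := fun θ hθ => hθ.1
  have hdense : jetSpace S r ⊆ closure (S ×ˢ D : Set (Jet r)) := by
    intro θ hθ
    rw [closure_prod_eq, hDd.closure_eq]
    exact ⟨subset_closure hθ, trivial⟩
  have hcomp : ∀ {W : Set (JetFibre r)} {I : JetFibre r → Fin N → ℝ}, IsOpen W →
      ContDiffOn ℝ ∞ I W → ∀ η ∈ (S ×ˢ W : Set (Jet r)), HasFDerivAt (fun η : Jet r => I η.2)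
        ((fderiv ℝ I η.2).comp (ContinuousLinearMap.snd ℝ Base (JetFibre r))) η :=
    fun hW hI η hη => HasFDerivAt.comp η
      ((hI.contDiffAt (hW.mem_nhds hη.2)).differentiableAt (by simp)).hasFDerivAt hasFDerivAt_snd
  have hsm : ∀ {W : Set (JetFibre r)} {I : JetFibre r → Fin N → ℝ},
      ContDiffOn ℝ ∞ I W → ContDiffOn ℝ ∞ (fun η : Jet r => I η.2) (S ×ˢ W) :=
    fun hI => hI.comp contDiff_snd.contDiffOn fun η hη => hη.2
  have hsnd : Function.Surjective (ContinuousLinearMap.snd ℝ Base (JetFibre r)) :=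
    Prod.snd_surjective
  refine ⟨⟨S ×ˢ D, hprod D hDo, hsub, hdense, fun θ hθ θ' h => ?_, fun θ hθ => ?_⟩,
    ⟨S ×ˢ D, hprod D hDo, hsub, hdense, fun θ hθ => ?_⟩,
    fun U hU hUS m f hf η hη hl => invariant_count_le hS hDd hrank hU hUS hf hη hl⟩
  · obtain ⟨-, h1, h2⟩ := (sameOrbit_iff hS).1 h
    exact ⟨h1, hDi _ hθ.2 _ h2⟩
  · obtain ⟨W, hW, hθW, hWD, I, hI, hsurj, hR⟩ := hslice θ.2 hθ.2
    refine ⟨S ×ˢ W, hprod W hW, ⟨hθ.1, hθW⟩, Set.prod_mono_right hWD, fun η => I η.2, hsm hI,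
      fun η hη => ?_, fun η hη η' hη' => ?_⟩
    · rw [(hcomp hW hI η hη).fderiv]
      exact (hsurj _ hη.2).comp hsnd
    · rw [sameOrbit_iff hS, ← hR _ hη.2 _ hη'.2]
      exact ⟨fun h => h.2.2, fun h => ⟨hη.1, hη'.1, h⟩⟩
  · obtain ⟨W, hW, hθW, hWD, I, hI, hsurj, hR⟩ := hslice θ.2 hθ.2
    have hn : ∀ n, ∀ η ∈ (S ×ˢ W : Set (Jet r)), fderiv ℝ (fun η : Jet r => I η.2 n) η =
        (ContinuousLinearMap.proj (R := ℝ) (φ := fun _ : Fin N => ℝ) n).comp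
          ((fderiv ℝ I η.2).comp (ContinuousLinearMap.snd ℝ Base (JetFibre r))) := fun n η hη =>
      ((ContinuousLinearMap.proj (R := ℝ) (φ := fun _ : Fin N => ℝ) n).hasFDerivAt.comp η
        (hcomp hW hI η hη)).fderiv
    refine ⟨S ×ˢ W, hprod W hW, ⟨hθ.1, hθW⟩, Set.prod_mono_right hWD, fun n η => I η.2 n,
      fun n => ⟨contDiffOn_pi.1 (hsm hI) n, fun η hη v hv => ?_⟩, fun η hη => ?_⟩
    · obtain ⟨w, hw⟩ := (isProlongedVector_iff hS hη.1).1 hv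
      rw [hn n η hη]
      have h1 := fderiv_infAct_eq_zero hW (fun x hx y hy => (hR x hx y hy).1) hη.2
        ((hI.contDiffAt (hW.mem_nhds hη.2)).differentiableAt (by simp)) w
      rw [← hw] at h1
      exact congrFun h1 n
    · have hη' : Function.Surjective ((fderiv ℝ I η.2).comp
          (ContinuousLinearMap.snd ℝ Base (JetFibre r))) := (hsurj _ hη.2).comp hsnd
      rw [Fintype.linearIndependent_iff]
      intro c hc n
      obtain ⟨v, hv⟩ := hη' (Pi.single n 1)
      have h1 := congrArg (fun l : Jet r →L[ℝ] ℝ => l v) hc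
      simp only [hn _ η hη, sum_apply, smul_apply,
        ContinuousLinearMap.comp_apply (ContinuousLinearMap.proj _), hv] at h1
      simpa [Pi.single_apply] using h1

/-- On generic jets the infinitesimal action is injective, so its rank is the full dimension of
`Param r`, and properness provides slices of complementary dimension N. -/
theorem orbitSpaceDim_and_invariantCount_of_one_le {S : Set Base} (hS : IsOpen S) (hr : 1 ≤ r)
    {N : ℕ} (hN : Module.finrank ℝ (Param r) + N = Module.finrank ℝ (JetFibre r)) :
    HasOrbitSpaceDim S r N ∧ HasInvariantCount S r N := by
  refine orbitSpaceDim_and_invariantCount hS (D := {θ | Generic θ}) isOpen_generic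
    (dense_generic hr) (fun θ hθ θ' h => h.symm.generic hr hθ) (fun θ hθ => ?_) fun θ hθ => ?_
  · rw [LinearMap.finrank_range_of_inj, hN]
    exact LinearMap.ker_eq_bot.1 (LinearMap.ker_eq_bot'.2 (infAct_injective hr hθ))
  · have h1 : ∀ v, fderiv ℝ (fun m => act m θ) 0 v = 0 → v = 0 := infAct_injective hr hθ
    have h2 : ∀ V ∈ 𝓝 (0 : Param r), ∃ W ∈ 𝓝 θ, ∀ y ∈ W, ∀ y' ∈ W, JetRel y y' →
        ∃ m ∈ V, act m y' = y := fun V hV => exists_near_param hr hθ hV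
    exact exists_slice (A := act) (R := JetRel) (O := {θ | Generic θ}) contDiff_act act_zero
      (fun h => h.symm) (fun h h' => h.trans h') eventually_jetRel h1 h2 hN isOpen_generic hθ

end Counting

/-! ### Order zero: open orbits. -/

section OrderZero

theorem infCongrForm_surjective {b : SymForm} (hb : discPair b b ≠ 0) (q : SymForm) :
    ∃ A, infCongrForm A b = q := by
  have hd : b s(0, 0) * b s(1, 1) - b s(0, 1) * b s(0, 1) ≠ 0 := by
    intro h
    apply hb
    rw [discPair]
    linear_combination 2 * h
  let Δ := b s(0, 0) * b s(1, 1) - b s(0, 1) * b s(0, 1)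
  -- The matrix is A = -½ b⁻¹ q: then bA = -½ q is symmetric and -(bA + (bA)ᵀ) = q.
  refine ⟨!![-(b s(1, 1) * q s(0, 0) - b s(0, 1) * q s(0, 1)) / (2 * Δ),
    -(b s(1, 1) * q s(0, 1) - b s(0, 1) * q s(1, 1)) / (2 * Δ);
    -(b s(0, 0) * q s(0, 1) - b s(0, 1) * q s(0, 0)) / (2 * Δ),
    -(b s(0, 0) * q s(1, 1) - b s(0, 1) * q s(0, 1)) / (2 * Δ)], symForm_ext fun k l => ?_⟩
  have hΔ : Δ ≠ 0 := hd
  have hΔ' : Δ = b s(0, 0) * b s(1, 1) - b s(0, 1) * b s(0, 1) := rfl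
  clear_value Δ
  rw [infCongrForm_mk]
  fin_cases k <;> fin_cases l <;> simp [swap_eq] <;> field_simp <;> rw [hΔ'] <;> ring

/-- At order zero only the Jacobian of ψ and the matrix a matter. They are independent, one acting
on g and the other on h, so each form is treated separately. -/
theorem infAct_surjective {θ : JetFibre 0} (hg : discPair (gAt θ) (gAt θ) ≠ 0)
    (hh : discPair (hAt θ) (hAt θ) ≠ 0) : Function.Surjective (infAct θ) := by
  intro q
  let J₀ : MultiIdx 0 := ⟨(0, 0), le_rfl⟩
  have hJ₀ : ∀ J : MultiIdx 0, J = J₀ := by decide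
  obtain ⟨B, hB⟩ := infCongrForm_surjective hg (-(q J₀).1)
  obtain ⟨A, hA⟩ := infCongrForm_surjective hh (-(q J₀).2)
  let w : Param 0 := (fun J i => B i (if posPair J = (1, 0) then 0 else 1), A)
  have h0 : polyMap posPair w.1 0 = 0 := polyMap_posPair_zero _
  have hJ : jacobian (polyMap posPair w.1) 0 = B := by
    ext i k
    rw [jacobian_apply]
    fin_cases k
    · obtain ⟨J, hJ⟩ := exists_posPair (r := 0) (a := 1) (b := 0) (by omega) (by omega)
      have h1 := mpd_polyMap posPair_injective w.1 J
      rw [hJ] at h1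
      refine (congrFun h1 i).trans ?_
      simp [w, hJ]
    · obtain ⟨J, hJ⟩ := exists_posPair (r := 0) (a := 0) (b := 1) (by omega) (by omega)
      have h1 := mpd_polyMap posPair_injective w.1 J
      rw [hJ] at h1
      refine (congrFun h1 i).trans ?_
      simp [w, hJ]
  refine ⟨w, ?_⟩
  rw [infAct_eq]
  funext J
  rw [hJ₀ J]
  show -characteristic (polyMap posPair w.1) (Matrix.of w.2) (polySec θ) 0 = q J₀
  have h2 : characteristic (polyMap posPair w.1) (Matrix.of w.2) (polySec θ) 0 = -q J₀ := by
    simp only [characteristic, h0, Pi.zero_apply, zero_smul, Finset.sum_const_zero, sub_zero, hJ]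
    exact Prod.ext hB hA
  rw [h2, neg_neg]

theorem dense_nondegenerate {r : ℕ} : Dense {θ : JetFibre r | discPair (gAt θ) (gAt θ) ≠ 0 ∧
    discPair (hAt θ) (hAt θ) ≠ 0} := by
  let b : SymForm := fun s => if s = s(0, 1) then 1 else 0
  have hne : (s(0, 0) : Sym2 (Fin 2)) ≠ s(0, 1) := by decide
  have hb : discPair b b ≠ 0 := by simp [discPair, b, hne]
  have e0 : polySec (jetAt r (fun _ => (b, b)) 0) 0 = (b, b) :=
    mpd_polySec (jetAt r (fun _ => (b, b)) 0) _ rfl (a := 0) (b := 0) (by omega)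
  refine (dense_of_analytic_line (F := fun θ : JetFibre r => discPair (gAt θ) (gAt θ) *
    discPair (hAt θ) (hAt θ)) (fun θ η s _ => ?_) (x₁ := jetAt r (fun _ => (b, b)) 0) ?_).mono
      fun θ h => mul_ne_zero_iff.1 h
  · simp only [discPair, gAt_add_smul, hAt_add_smul]
    fun_prop
  · rw [gAt, hAt, e0]
    exact mul_ne_zero hb hb

/-- The orbit map is a submersion at the identity, so a class contains a neighbourhood of each of
its nondegenerate points; the constant map to ℝ⁰ is then the required submersion. -/
theorem orbitSpaceDim_and_invariantCount_zero {S : Set Base} (hS : IsOpen S) :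
    HasOrbitSpaceDim S 0 0 ∧ HasInvariantCount S 0 0 := by
  have hDo : IsOpen {θ : JetFibre 0 | discPair (gAt θ) (gAt θ) ≠ 0 ∧
      discPair (hAt θ) (hAt θ) ≠ 0} :=
    (isOpen_ne.preimage contDiff_discPair_gg.continuous).inter
      (isOpen_ne.preimage contDiff_discPair_hh.continuous)
  refine orbitSpaceDim_and_invariantCount hS hDo dense_nondegenerate (fun θ hθ θ' h => ?_)
    (fun θ hθ => ?_) fun θ hθ => ?_
  · obtain ⟨m, -, -, rfl⟩ := h
    obtain ⟨h1, h2⟩ := hθ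
    rw [(dataLaw_act_zero m θ').1, discPair_congrForm] at h1
    rw [(dataLaw_act_zero m θ').2, discPair_congrForm] at h2
    exact ⟨right_ne_zero_of_mul h1, right_ne_zero_of_mul h2⟩
  · rw [LinearMap.range_eq_top.2 (infAct_surjective hθ.1 hθ.2), finrank_top, add_zero]
  · have h1 : HasStrictFDerivAt (fun m => act m θ) (infAct θ) 0 :=
      (contDiff_act_left θ).contDiffAt.hasStrictFDerivAt (by simp)
    have h2 := h1.map_nhds_eq_of_surj (LinearMap.range_eq_top.2 (infAct_surjective hθ.1 hθ.2))
    rw [act_zero] at h2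
    have h3 : {y | JetRel y θ} ∈ 𝓝 θ := by
      rw [← h2]
      exact mem_map.2 (eventually_jetRel.mono fun m hm => hm θ)
    have hsub : ∀ {x}, x ∈ interior {y | JetRel y θ} → JetRel x θ := fun hx =>
      (interior_subset hx : _ ∈ {y | JetRel y θ})
    refine ⟨interior {y | JetRel y θ} ∩ _, isOpen_interior.inter hDo,
      ⟨mem_interior_iff_mem_nhds.2 h3, hθ⟩, Set.inter_subset_right, fun _ => 0, contDiffOn_const,
      fun x _ y => ⟨0, Subsingleton.elim _ _⟩, fun x hx y hy => ⟨fun _ => rfl, fun _ =>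
        (hsub hx.1).trans (hsub hy.1).symm⟩⟩

end OrderZero

/-! ### Dimension count and conclusion. -/

theorem finrank_param (r : ℕ) :
    Module.finrank ℝ (Param r) = Fintype.card (PosIdx r) * 2 + 4 := by
  rw [Module.finrank_prod, Module.finrank_pi_fintype, Module.finrank_pi_fintype]
  simp [Module.finrank_pi_fintype]

theorem finrank_jetFibre (r : ℕ) :
    Module.finrank ℝ (JetFibre r) = Fintype.card (MultiIdx r) * 6 := by
  have h : Fintype.card (Sym2 (Fin 2)) = 3 := by decide
  rw [Module.finrank_pi_fintype]
  simp [h]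

theorem mainTheorem3 (S : Set Base) (hS : IsOpen S) (hne : S.Nonempty) (r N : ℕ)
    (hrN : (r, N) ∈ ({(0, 0), (1, 4), (2, 14), (3, 28), (4, 46)} : Set (ℕ × ℕ))) :
    HasOrbitSpaceDim S r N ∧ HasInvariantCount S r N := by
  simp only [Set.mem_insert_iff, Set.mem_singleton_iff, Prod.mk.injEq] at hrN
  obtain ⟨rfl, rfl⟩ | ⟨rfl, rfl⟩ | ⟨rfl, rfl⟩ | ⟨rfl, rfl⟩ | ⟨rfl, rfl⟩ := hrN
  · exact orbitSpaceDim_and_invariantCount_zero hS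
  all_goals
    refine orbitSpaceDim_and_invariantCount_of_one_le hS (by omega) ?_
    rw [finrank_param, finrank_jetFibre]
    decide
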